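/- Write $\mathbb{R}_+=[0,\infty)$, $\hat x=\min(1,x)$, $\check x=\max(1,x)$. For $\beta,r\ge 0$ let $Y_{-\beta,r}$ be the space of $c\in L^1(\mathbb{R}_+)$ with $\|c\|_{-\beta,r}:=\int_0^\infty (x^{-\beta}+x^r)|c(x)|\,dx<\infty$, and let $Y^+_{-\beta,r}$ be its cone of (a.e.) non-negative elements. Assumptions on the kernel. Let $K:\mathbb{R}_+^3\to\mathbb{R}_+$ be measurable with $K(x,y,z)=K(y,x,z)$, and $K(x,y,z)=0$ whenever $z>x$. Let $\mu,\nu\in[0,2]$ with $\mu+\nu\le 3$ and $\lambda:=\max(\mu,\nu)>1$, let $\alpha\ge 0$ and $\varphi\in Y^+_{-2\alpha,2\lambda}$. Assume that for all $x,y,z>0$ $$K(x,y,z)\le \hat x^{-\alpha}\hat y^{-\alpha}\,\tfrac12\big(\check x^{\mu}\check y^{\nu}+\check x^{\nu}\check y^{\mu}\big)\varphi(z),$$ that $x\mapsto K(x,y,z)$ is twice differentiable with $$\partial_x^2K(x,y,z)\le \hat y^{-\alpha}\check y^{\lambda}\varphi(z),$$ and, if $\alpha>0$, that there is a constant $C_\alpha>0$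 such that for all $y>0$ and $x>z>0$ $$\widehat{(x-z)}^{-\alpha}K(x,y,z)\le C_\alpha\,\hat x^{-2\alpha}\hat y^{-\alpha}\check x^{\lambda}\check y^{\lambda}\varphi(z).$$ Weak solutions. Put $(\Delta_zf)(x)=f(x+z)-2f(x)+f(x-z)$, $\kappa[u](x,y,z)=K(x,y,z)u(x)u(y)$ and $D=\{(x,y,z)\in\mathbb{R}_+^3: x\ge z,\ y\ge z\}$. For $0<T<\infty$, a weak solution on $[0,T)$ of the continuous generalized exchange-driven growth equation (CGEDG) in $Y_{-\alpha,\lambda}$ with initial datum $c_0\in Y_{-\alpha,\lambda}^+$ is a map $c:[0,T)\to Y^+_{-\alpha,\lambda}$ such that (a) $t\mapsto\int_0^\infty f(x)c_t(x)\,dx$ is continuous on $[0,T)$ for every $f\in L^\infty(\mathbb{R}_+)$, and $\sup_{t\in[0,T)}\|c_t\|_{-\alpha,\lambda}<\infty$; (b) $\int_0^t\int_0^\infty\int_z^\infty\int_0^\infty \kappa[c_s](x,y,z)\,dy\,dx\,dz\,ds<\infty$ for all $t\in[0,T)$; (c) for all $t\in[0,T)$ and all $f\in L^\infty(\mathbb{R}_+)$,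 $$\int_0^\infty f(x)\,[c_t(x)-c_0(x)]\,dx=\int_0^t\iiint_D(\Delta_zf)(x)\,\kappa[c_s](x,y,z)\,dx\,dy\,dz\,ds .$$ A global weak solution is a map on $[0,\infty)$ that is a weak solution on $[0,T)$ for every finite $T>0$. Theorem (Global existence). Under these assumptions, for every initial datum $c_0\in Y^+_{-\alpha,\lambda}$ there is a global weak solution $c$ of (CGEDG) in $Y_{-\alpha,\lambda}$ with initial datum $c_0$. It satisfies $c_t\in Y^+_{-\alpha,\lambda}$ for all $t\ge 0$, and it conserves mass and first moment: $\int_0^\infty c_t(x)\,dx=\int_0^\infty c_0(x)\,dx$ and $\int_0^\infty x\,c_t(x)\,dx=\int_0^\infty x\,c_0(x)\,dx$ for all $t\ge 0$. -/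

import Mathlib

open MeasureTheory Set
open scoped ENNReal NNReal

namespace CGEDG

/-- `x̂ = 1 ∧ x`. -/
noncomputable def hat (x : ℝ) : ℝ := min 1 x

/-- `x̌ = 1 ∨ x`. -/
noncomputable def check (x : ℝ) : ℝ := max 1 x

/-- Membership in the weighted Lebesgue space `Y_{-β,r}`: `c ∈ L¹(ℝ₊)` and
`∫₀^∞ (x^{-β} + x^r) |c(x)| dx < ∞`. The point `0`, being a null set, is left out. -/
def MemY (β r : ℝ) (c : ℝ → ℝ) : Prop :=
  IntegrableOn c (Ioi 0) ∧ IntegrableOn (fun x => (x ^ (-β) + x ^ r) * |c x|) (Ioi 0)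

/-- Membership in the positive cone `Y⁺_{-β,r}`. -/
def MemYPos (β r : ℝ) (c : ℝ → ℝ) : Prop :=
  MemY β r c ∧ ∀ᵐ x ∂(volume.restrict (Ioi (0 : ℝ))), 0 ≤ c x

/-- The norm of `Y_{-β,r}`. -/
noncomputable def normY (β r : ℝ) (c : ℝ → ℝ) : ℝ :=
  ∫ x in Ioi (0 : ℝ), (x ^ (-β) + x ^ r) * |c x|

/-- `f ∈ L^∞(ℝ₊)`. -/
def MemLinf (f : ℝ → ℝ) : Prop := MemLp f ∞ (volume.restrict (Ioi (0 : ℝ)))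

/-- The global assumptions on the kernel `K : ℝ₊³ → ℝ₊` (values outside `ℝ₊³` play no role). -/
structure GlobalAssumption (K : ℝ → ℝ → ℝ → ℝ) : Prop where
  measurable : Measurable fun p : ℝ≥0 × ℝ≥0 × ℝ≥0 => K p.1 p.2.1 p.2.2
  nonneg : ∀ x y z : ℝ, 0 ≤ x → 0 ≤ y → 0 ≤ z → 0 ≤ K x y z
  symm : ∀ x y z : ℝ, 0 ≤ x → 0 ≤ y → 0 ≤ z → K x y z = K y x z
  eq_zero : ∀ x y z : ℝ, 0 ≤ x → 0 ≤ y → 0 ≤ z → x < z → K x y z = 0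

/-- The assumption for global existence, with `λ = max μ ν`.

The bounds are only asked for at positive arguments, where no negative power of zero occurs. For
`z > 0` nothing is lost at the boundary: `K` vanishes there for `x < z` and for `y < z`. Likewise
`K(z,y,z) = 0` by continuity, so that the last bound is only asked for when `z < x`. -/
structure ExistenceAssumption (K : ℝ → ℝ → ℝ → ℝ) (φ : ℝ → ℝ) (α μ ν : ℝ) : Prop where
  mu_mem : μ ∈ Icc (0 : ℝ) 2
  nu_mem : ν ∈ Icc (0 : ℝ) 2
  add_le : μ + ν ≤ 3
  one_lt : 1 < max μ ν
  alpha_nonneg : 0 ≤ α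
  phi_mem : MemYPos (2 * α) (2 * max μ ν) φ
  bound : ∀ x y z : ℝ, 0 < x → 0 < y → 0 < z →
    K x y z ≤ hat x ^ (-α) * hat y ^ (-α) *
      (2⁻¹ * (check x ^ μ * check y ^ ν + check x ^ ν * check y ^ μ)) * φ z
  diff : ∀ y z : ℝ, 0 < y → 0 < z → DifferentiableOn ℝ (fun x => K x y z) (Ioi 0)
  diff_deriv : ∀ y z : ℝ, 0 < y → 0 < z →
    DifferentiableOn ℝ (deriv fun x => K x y z) (Ioi 0)
  deriv2_le : ∀ x y z : ℝ, 0 < x → 0 < y → 0 < z →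
    deriv (deriv fun x' => K x' y z) x ≤ hat y ^ (-α) * check y ^ max μ ν * φ z
  singular : 0 < α → ∃ C : ℝ, 0 < C ∧ ∀ x y z : ℝ, 0 < y → 0 < z → z < x →
    hat (x - z) ^ (-α) * K x y z ≤
      C * hat x ^ (-(2 * α)) * hat y ^ (-α) * check x ^ max μ ν * check y ^ max μ ν * φ z

/-- The discrete Laplacian `(Δ_z f)(x) = f(x+z) - 2 f(x) + f(x-z)`. -/
def discreteLaplacian (z : ℝ) (f : ℝ → ℝ) (x : ℝ) : ℝ := f (x + z) - 2 * f x + f (x - z)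

/-- `κ[u](x,y,z) = K(x,y,z) u(x) u(y)`. -/
def kappa (K : ℝ → ℝ → ℝ → ℝ) (u : ℝ → ℝ) (x y z : ℝ) : ℝ := K x y z * u x * u y

/-- `{(x,y,z) ∈ ℝ₊³ : x ≥ z}`. -/
def fluxDomain : Set (ℝ × ℝ × ℝ) := {p | 0 ≤ p.2.2 ∧ p.2.2 ≤ p.1 ∧ 0 ≤ p.2.1}

/-- `D = {(x,y,z) ∈ ℝ₊³ : x ≥ z, y ≥ z}`. -/
def exchangeDomain : Set (ℝ × ℝ × ℝ) := {p | 0 ≤ p.2.2 ∧ p.2.2 ≤ p.1 ∧ p.2.2 ≤ p.2.1}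

/-- `∭_D (Δ_z f)(x) κ[u](x,y,z) d(x,y,z)`. -/
noncomputable def weakForm (K : ℝ → ℝ → ℝ → ℝ) (f u : ℝ → ℝ) : ℝ :=
  ∫ p in exchangeDomain, discreteLaplacian p.2.2 f p.1 * kappa K u p.1 p.2.1 p.2.2

/-- (Weak) continuity of `t ↦ c_t ∈ Y_{-β,r}` on `[0,T)`. -/
def WeaklyContinuous (β r T : ℝ) (c : ℝ → ℝ → ℝ) : Prop :=
  ∀ f : ℝ → ℝ, MemLinf f →
    ContinuousOn (fun t => ∫ x in Ioi (0 : ℝ), (x ^ (-β) + x ^ r) * f x * c t x) (Ico 0 T)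

/-- `c` is a weak solution on `[0,T)`, `T` finite, with initial datum `c₀` and values in
`Y⁺_{-β,r}`. (The weak form at `t = 0` says that `c 0 = c₀` almost everywhere.) -/
structure IsWeakSolution (K : ℝ → ℝ → ℝ → ℝ) (β r T : ℝ) (c₀ : ℝ → ℝ) (c : ℝ → ℝ → ℝ) :
    Prop where
  mem : ∀ t ∈ Ico 0 T, MemYPos β r (c t)
  continuous : WeaklyContinuous 0 0 T c
  bounded : ∃ M : ℝ, ∀ t ∈ Ico 0 T, normY β r (c t) ≤ M
  flux_finite : ∀ t ∈ Ico 0 T,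
    ∫⁻ s in Ioc 0 t, ∫⁻ p in fluxDomain, ENNReal.ofReal (kappa K (c s) p.1 p.2.1 p.2.2) < ∞
  weak_form : ∀ t ∈ Ico 0 T, ∀ f : ℝ → ℝ, MemLinf f →
    IntervalIntegrable (fun s => weakForm K f (c s)) volume 0 t ∧
    ∫ x in Ioi (0 : ℝ), f x * (c t x - c₀ x) = ∫ s in (0 : ℝ)..t, weakForm K f (c s)

/-- A global weak solution: a function on `[0,∞)` that is a weak solution on `[0,T)` for every
finite `T`; thus its norm in `Y_{-β,r}` is locally bounded in time. -/
def IsGlobalWeakSolution (K : ℝ → ℝ → ℝ → ℝ) (β r : ℝ) (c₀ : ℝ → ℝ) (c : ℝ → ℝ → ℝ) : Prop :=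
  ∀ T : ℝ, 0 < T → IsWeakSolution K β r T c₀ c

end CGEDG

/-!
The solution is a limit of explicit Euler schemes for truncated kernels.

*Kernel.* On the set where the equation lives, `0 < z < x` and `z < y`, all singular factors
`x̂ ^ (-α)`, `ŷ ^ (-α)` are at most `ẑ ^ (-α)`, so that they can be moved into the weight
`θ(z) = ẑ ^ (-2α) φ(z)`, which is integrable against `1 + z²`. What remains of the assumptions is
collected in `KernelBounds`. These bounds survive the truncation `min(K, n θ)`
(`KernelBounds.truncate`): the one-sided bound on `∂ₓ²K` enters only as an upper bound on second
differences, that is as semiconcavity, and a minimum of semiconcave functions is semiconcave.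

*A priori bounds.* For a truncated kernel the exchange rates are bounded and a sufficiently small
Euler step preserves positivity. Mass and first moment are conserved, since `1` and `x` have
vanishing second differences. The second difference of `x ^ λ` is of order `x ^ (λ - 2) z²`; by
`μ + ν ≤ 3` the product `x ^ (λ - 2) K` has growth `x ^ λ y + x y ^ λ`, and as the first moment is
conserved the moment of order `λ` obeys a linear Gronwall inequality (`far_moment_bound`). The last
kernel assumption gives the same for the moment of order `-α` (`near_moment_bound`). The weight
`x ^ λ min(1, x / R)`, a product of `x ^ λ` and a concave function, yields uniformly small tails
(`far_tail_bound`).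

*Compactness.* With the environment `u` frozen, a step is linear in the transported density.
Splitting the initial datum into a bounded part and a part of small mass, the mass of the
second part is conserved, while the supremum of the first grows at most exponentially, because the
gain minus the loss for a constant density is a second difference of `K` in `x`. Hence the scheme is
uniformly integrable (`uniform_integrability`), and uniformly Lipschitz in time with values in `L¹`
up to one time step (`eulerPath_lipschitz`).

*Limit.* Along a fixed ultrafilter every sequence of uniformly integrable densities converges
setwise, for all times at once and without extraction of subsequences (`exists_setwise_limit`);
setwise limits of uniformly integrable measures pass to products (`tendsto_prod_setwise`). As the
tails are small, the collision functional converges at each time (`IsLimit.tendsto_collision`).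
Dominated convergence fails along ultrafilters, but the equicontinuity in time makes the convergence
uniform, so that the time integrals converge as well (`IsLimit.weak_form`).
-/

open Filter Topology

namespace CGEDG

/-! ### Setwise limits of measures along an ultrafilter -/

section SetwiseLimit

variable {X : Type*} [MeasurableSpace X] {ι : Type*}

/-- Along an ultrafilter, a family of measures that is dominated, up to an arbitrarily small
error, by finite measures converges setwise to a finite measure. This plays the role of the
Dunford–Pettis theorem: the domination is the uniform integrability, and makes the setwise
limit countably additive. -/
theorem exists_setwise_limit (U : Ultrafilter ι) (m : ι → Measure X)
    (hm : ∀ ε : ℝ≥0∞, 0 < ε → ∃ ρ : Measure X, IsFiniteMeasure ρ ∧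
      ∀ i, ∀ A, MeasurableSet A → m i A ≤ ρ A + ε) :
    ∃ μ : Measure X, IsFiniteMeasure μ ∧
      ∀ A, MeasurableSet A → Tendsto (fun i => m i A) U (𝓝 (μ A)) := by
  have hlim : ∀ A : Set X, ∃ l : ℝ≥0∞, Tendsto (fun i => m i A) U (𝓝 l) := fun A => by
    obtain ⟨l, -, hl⟩ := isCompact_univ.ultrafilter_le_nhds (U.map fun i => m i A) (by simp)
    exact ⟨l, hl⟩
  choose M hM using hlim
  have hM0 : M ∅ = 0 := tendsto_nhds_unique (hM ∅) (by simp)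
  have hadd : ∀ A B, MeasurableSet B → Disjoint A B → M (A ∪ B) = M A + M B := by
    intro A B hB hd
    refine tendsto_nhds_unique (hM (A ∪ B)) ?_
    simp_rw [measure_union hd hB]
    exact (hM A).add (hM B)
  have hmono : ∀ A B, A ⊆ B → M A ≤ M B := fun A B h =>
    le_of_tendsto_of_tendsto' (hM A) (hM B) fun i => measure_mono h
  have hU : ∀ ⦃f : ℕ → Set X⦄ (_ : ∀ i, MeasurableSet (f i)),
      Pairwise (Function.onFun Disjoint f) → M (⋃ i, f i) = ∑' i, M (f i) := by
    intro f hf hd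
    have hfin : ∀ N : ℕ, M (⋃ i ∈ Finset.range N, f i) = ∑ i ∈ Finset.range N, M (f i) := by
      intro N
      refine tendsto_nhds_unique (hM _) ?_
      simp_rw [measure_biUnion_finset (fun i _ j _ hij => hd hij) (fun i _ => hf i)]
      exact tendsto_finsetSum _ fun i _ => hM (f i)
    refine le_antisymm ?_ ?_
    · refine ENNReal.le_of_forall_pos_le_add fun ε hε _ => ?_
      have hε2 : (0 : ℝ≥0∞) < ε / 2 := by
        simpa using hε.ne'
      obtain ⟨ρ, hρ, hle⟩ := hm (ε / 2) hε2
      let t : ℕ → Set X := fun N => ⋃ i ∈ {i | N ≤ i}, f i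
      have ht : ∀ N, MeasurableSet (t N) := fun N =>
        MeasurableSet.biUnion (Set.to_countable _) fun i _ => hf i
      have hanti : Antitone t := fun a b hab =>
        biUnion_subset_biUnion_left fun i (hi : b ≤ i) => le_trans hab hi
      have hinter : ⋂ N, t N = ∅ := by
        ext x
        simp only [t, mem_iInter, mem_iUnion, mem_ofPred_eq, exists_prop, mem_empty_iff_false,
          iff_false, not_forall]
        by_cases hx : ∃ j, x ∈ f j
        · obtain ⟨j, hj⟩ := hx
          refine ⟨j + 1, ?_⟩
          rintro ⟨i, hi, hxi⟩
          exact (Set.disjoint_left.1 (hd (show j ≠ i by omega)) hj) hxi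
        · exact ⟨0, fun ⟨i, _, hxi⟩ => hx ⟨i, hxi⟩⟩
      have htend : Tendsto (fun N => ρ (t N)) atTop (𝓝 0) := by
        have := tendsto_measure_iInter_atTop (μ := ρ)
          (fun N => (ht N).nullMeasurableSet) hanti ⟨0, measure_ne_top _ _⟩
        simpa [hinter, Function.comp_def] using this
      obtain ⟨N, hN⟩ := ((tendsto_order.1 htend).2 _ hε2).exists
      have hsplit : (⋃ i, f i) = (⋃ i ∈ Finset.range N, f i) ∪ t N := by
        ext x
        simp only [t, mem_iUnion, mem_union, Finset.mem_range, mem_ofPred_eq, exists_prop]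
        constructor
        · rintro ⟨i, hi⟩
          rcases lt_or_ge i N with h | h
          · exact Or.inl ⟨i, h, hi⟩
          · exact Or.inr ⟨i, h, hi⟩
        · rintro (⟨i, -, hi⟩ | ⟨i, -, hi⟩) <;> exact ⟨i, hi⟩
      have hdisj : Disjoint (⋃ i ∈ Finset.range N, f i) (t N) := by
        simp only [t, disjoint_iUnion_left, disjoint_iUnion_right]
        intro i hi j hj
        exact hd (by have := Finset.mem_range.1 hj; simp at hi; omega)
      rw [hsplit, hadd _ _ (ht N) hdisj, hfin]
      have h1 : M (t N) ≤ ε := by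
        have : M (t N) ≤ ρ (t N) + ε / 2 := le_of_tendsto' (hM _) fun i => hle i _ (ht N)
        refine this.trans ((add_le_add_left hN.le _).trans ?_)
        rw [ENNReal.add_halves]
      exact add_le_add (ENNReal.sum_le_tsum _) h1
    · rw [ENNReal.tsum_eq_iSup_nat]
      refine iSup_le fun N => ?_
      rw [← hfin]
      exact hmono _ _ (iUnion₂_subset fun i _ => subset_iUnion f i)
  let μ : Measure X := Measure.ofMeasurable (fun A _ => M A) hM0 hU
  have hμ : ∀ A, MeasurableSet A → μ A = M A := fun A hA => Measure.ofMeasurable_apply A hA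
  refine ⟨μ, ⟨?_⟩, fun A hA => by rw [hμ A hA]; exact hM A⟩
  obtain ⟨ρ, hρ, hle⟩ := hm 1 one_pos
  rw [hμ _ MeasurableSet.univ]
  refine lt_of_le_of_lt (le_of_tendsto' (hM univ) fun i => hle i univ MeasurableSet.univ) ?_
  exact ENNReal.add_lt_top.2 ⟨measure_lt_top _ _, ENNReal.one_lt_top⟩

/-- Setwise convergence of measures of bounded mass implies convergence of the integrals of
bounded measurable functions. -/
theorem tendsto_lintegral_of_setwise {l : Filter ι} {m : ι → Measure X} {μ : Measure X}
    (h : ∀ A, MeasurableSet A → Tendsto (fun i => m i A) l (𝓝 (μ A)))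
    {c : ℝ≥0} (hc : ∀ i, m i univ ≤ c) (hcμ : μ univ ≤ c)
    {G : X → ℝ≥0∞} (hG : Measurable G) {b : ℝ≥0} (hb : ∀ x, G x ≤ b) :
    Tendsto (fun i => ∫⁻ x, G x ∂(m i)) l (𝓝 (∫⁻ x, G x ∂μ)) := by
  -- The staircase below `G` with steps of height `δ` is a finite sum of indicators.
  have stair : ∀ δ : ℝ≥0, 0 < δ → ∃ S : X → ℝ≥0∞,
      (∀ ν : Measure X, ∫⁻ x, S x ∂ν ≤ ∫⁻ x, G x ∂ν) ∧
      (∀ ν : Measure X, ∫⁻ x, G x ∂ν ≤ ∫⁻ x, S x ∂ν + δ * ν univ) ∧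
      Tendsto (fun i => ∫⁻ x, S x ∂(m i)) l (𝓝 (∫⁻ x, S x ∂μ)) := by
    intro δ hδ
    obtain ⟨N, hN⟩ := exists_nat_gt (b / δ)
    have hNb : b ≤ N * δ := by
      rw [div_lt_iff₀ hδ] at hN; exact hN.le
    let A : ℕ → Set X := fun i => {x | ((i + 1 : ℕ) * δ : ℝ≥0) ≤ G x}
    have hA : ∀ i, MeasurableSet (A i) := fun i => measurableSet_le measurable_const hG
    let S : X → ℝ≥0∞ := fun x => ∑ i ∈ Finset.range N, (A i).indicator (fun _ => (δ : ℝ≥0∞)) x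
    have hSm : Measurable S :=
      Finset.measurable_sum _ fun i _ => measurable_const.indicator (hA i)
    have hS : ∀ ν : Measure X, ∫⁻ x, S x ∂ν = ∑ i ∈ Finset.range N, δ * ν (A i) := by
      intro ν
      simp only [S]
      rw [lintegral_finsetSum _ fun i _ => measurable_const.indicator (hA i)]
      refine Finset.sum_congr rfl fun i _ => ?_
      rw [lintegral_indicator (hA i), lintegral_const, Measure.restrict_apply_univ]
    have hpt : ∀ x, S x ≤ G x ∧ G x ≤ S x + δ := by
      intro x
      have hfin : G x ≠ ∞ := ne_top_of_le_ne_top ENNReal.coe_ne_top (hb x)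
      lift G x to ℝ≥0 using hfin with g hg
      have hgb : g ≤ b := by have := hb x; rw [← hg] at this; exact_mod_cast this
      set K := ⌊g / δ⌋₊ with hK
      have h1 : (K : ℝ≥0) * δ ≤ g := by
        rw [← le_div_iff₀ hδ]; exact Nat.floor_le zero_le
      have h2 : g < (K + 1) * δ := by
        rw [← div_lt_iff₀ hδ]; exact Nat.lt_floor_add_one _
      have hKN : K ≤ N := by
        by_contra hlt
        push Not at hlt
        have : ((N + 1 : ℕ) : ℝ≥0) * δ ≤ K * δ := by gcongr; exact_mod_cast hlt
        have h3 : ((N + 1 : ℕ) : ℝ≥0) * δ ≤ N * δ := this.trans (h1.trans (hgb.trans hNb))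
        have h4 := le_of_mul_le_mul_right h3 hδ
        norm_cast at h4
        omega
      have hSx : S x = (K * δ : ℝ≥0) := by
        have hmem : ∀ i, x ∈ A i ↔ i < K := by
          intro i
          simp only [A, mem_ofPred_eq, ← hg, ENNReal.coe_le_coe]
          rw [← le_div_iff₀ hδ, ← Nat.le_floor_iff zero_le, ← hK, Nat.succ_le_iff]
        have : S x = ∑ i ∈ Finset.range N, if i < K then (δ : ℝ≥0∞) else 0 := by
          refine Finset.sum_congr rfl fun i _ => ?_
          rw [indicator_apply]
          simp only [hmem]
        rw [this, ← Finset.sum_filter]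
        have hfl : (Finset.range N).filter (fun i => i < K) = Finset.range K := by
          ext i; simp; omega
        rw [hfl]
        simp
      rw [hSx]
      constructor
      · exact_mod_cast h1
      · have h5 : g ≤ K * δ + δ := by rw [add_mul, one_mul] at h2; exact h2.le
        exact_mod_cast h5
    refine ⟨S, fun ν => lintegral_mono fun x => (hpt x).1, fun ν => ?_, ?_⟩
    · calc ∫⁻ x, G x ∂ν ≤ ∫⁻ x, S x + δ ∂ν := lintegral_mono fun x => (hpt x).2
        _ = _ := by rw [lintegral_add_left hSm, lintegral_const]
    · simp_rw [hS]
      exact tendsto_finsetSum _ fun i _ =>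
        ENNReal.Tendsto.const_mul (h _ (hA i)) (Or.inr ENNReal.coe_ne_top)
  have hfinμ : ∫⁻ x, G x ∂μ ≠ ∞ := by
    refine ne_top_of_le_ne_top (b := b * c) (by finiteness) ?_
    calc ∫⁻ x, G x ∂μ ≤ ∫⁻ _, b ∂μ := lintegral_mono hb
      _ = b * μ univ := lintegral_const _
      _ ≤ _ := by gcongr
  rw [ENNReal.tendsto_nhds hfinμ]
  intro ε hε
  obtain ⟨η, hη0, hηε⟩ : ∃ η : ℝ≥0, 0 < η ∧ (η : ℝ≥0∞) ≤ ε / 2 := by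
    obtain ⟨η, h0, h1⟩ := ENNReal.lt_iff_exists_nnreal_btwn.1 (ENNReal.half_pos hε.ne')
    exact ⟨η, by simpa using h0, h1.le⟩
  have hδ : 0 < η / (c + 1) := by positivity
  obtain ⟨S, hS1, hS2, hS3⟩ := stair _ hδ
  have hδc : ((η / (c + 1) : ℝ≥0) : ℝ≥0∞) * c ≤ ε / 2 := by
    refine le_trans ?_ hηε
    have : η / (c + 1) * c ≤ η := by
      rw [div_mul_eq_mul_div]
      exact div_le_of_le_mul₀ (by positivity) zero_le (by gcongr; simp)
    exact_mod_cast this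
  have hSfin : ∫⁻ x, S x ∂μ ≠ ∞ := ne_top_of_le_ne_top hfinμ (hS1 μ)
  filter_upwards [(ENNReal.tendsto_nhds hSfin).1 hS3 (ε / 2) (ENNReal.half_pos hε.ne')] with i hi
  have hub : ∀ ν : Measure X, ν univ ≤ c → ∫⁻ x, G x ∂ν ≤ ∫⁻ x, S x ∂ν + ε / 2 := fun ν hν =>
    (hS2 ν).trans (add_le_add_right ((mul_le_mul_right hν _).trans hδc) _)
  constructor
  · rw [tsub_le_iff_right]
    refine (hub μ hcμ).trans ?_
    have := hi.1
    rw [tsub_le_iff_right] at this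
    calc ∫⁻ x, S x ∂μ + ε / 2 ≤ (∫⁻ x, S x ∂(m i) + ε / 2) + ε / 2 := by gcongr
      _ = ∫⁻ x, S x ∂(m i) + ε := by rw [add_assoc, ENNReal.add_halves]
      _ ≤ _ := add_le_add_left (hS1 _) _
  · refine (hub _ (hc i)).trans ?_
    calc ∫⁻ x, S x ∂(m i) + ε / 2 ≤ (∫⁻ x, S x ∂μ + ε / 2) + ε / 2 := by gcongr; exact hi.2
      _ = ∫⁻ x, S x ∂μ + ε := by rw [add_assoc, ENNReal.add_halves]
      _ ≤ _ := add_le_add_left (hS1 _) _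

/-- Bounds on integrals of (possibly unbounded) functions pass to setwise limits. -/
theorem lintegral_le_of_setwise {l : Filter ι} [l.NeBot] {m : ι → Measure X} {μ : Measure X}
    (h : ∀ A, MeasurableSet A → Tendsto (fun i => m i A) l (𝓝 (μ A)))
    {c : ℝ≥0} (hc : ∀ i, m i univ ≤ c) (hcμ : μ univ ≤ c)
    {G : X → ℝ≥0∞} (hG : Measurable G) {B : ℝ≥0∞} (hB : ∀ i, ∫⁻ x, G x ∂(m i) ≤ B) :
    ∫⁻ x, G x ∂μ ≤ B := by
  have hsup : ∀ x, G x = ⨆ n : ℕ, min (G x) n := fun x => by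
    rw [← inf_iSup_eq, ENNReal.iSup_natCast, inf_top_eq]
  have hmeas : ∀ n : ℕ, Measurable fun x => min (G x) (n : ℝ≥0∞) := fun n =>
    hG.min measurable_const
  rw [lintegral_congr hsup, lintegral_iSup hmeas fun a b hab x => by
    simp only; gcongr]
  refine iSup_le fun n => ?_
  have := tendsto_lintegral_of_setwise h hc hcμ (hmeas n) (b := n) fun x => by simp
  exact le_of_tendsto' this fun i => (lintegral_mono fun x => min_le_left _ _).trans (hB i)

/-- Under the domination of `exists_setwise_limit`, setwise convergence is inherited by the
product of the measures with themselves. -/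
theorem tendsto_prod_setwise (U : Ultrafilter ι) {m : ι → Measure X} {μ : Measure X}
    [∀ i, IsFiniteMeasure (m i)] [IsFiniteMeasure μ]
    {c : ℝ≥0} (hc : ∀ i, m i univ ≤ c)
    (hm : ∀ ε : ℝ≥0∞, 0 < ε → ∃ ρ : Measure X, IsFiniteMeasure ρ ∧
      ∀ i, ∀ A, MeasurableSet A → m i A ≤ ρ A + ε)
    (h : ∀ A, MeasurableSet A → Tendsto (fun i => m i A) U (𝓝 (μ A)))
    {E : Set (X × X)} (hE : MeasurableSet E) :
    Tendsto (fun i => (m i).prod (m i) E) U (𝓝 (μ.prod μ E)) := by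
  have hdom : ∀ ε : ℝ≥0∞, 0 < ε → ∃ ρ : Measure (X × X), IsFiniteMeasure ρ ∧
      ∀ i, ∀ A, MeasurableSet A → (m i).prod (m i) A ≤ ρ A + ε := by
    intro ε hε
    have hε2 := ENNReal.half_pos hε.ne'
    obtain ⟨ρ, hρ, h1⟩ := hm (ε / 2 / (c + 1)) (ENNReal.div_pos hε2.ne' (by finiteness))
    obtain ⟨ρ', hρ', h2⟩ := hm (ε / 2 / (ρ univ + 1)) (ENNReal.div_pos hε2.ne' (by finiteness))
    have small : ∀ a b : ℝ≥0∞, b ≠ ∞ → a / (b + 1) * b ≤ a := fun a b hb => by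
      calc a / (b + 1) * b ≤ a / (b + 1) * (b + 1) := by gcongr; simp
        _ = a := ENNReal.div_mul_cancel (by simp) (by finiteness)
    refine ⟨ρ'.prod ρ, inferInstance, fun i A hA => ?_⟩
    calc (m i).prod (m i) A = ∫⁻ x, m i (Prod.mk x ⁻¹' A) ∂(m i) := Measure.prod_apply hA
      _ ≤ ∫⁻ x, ρ (Prod.mk x ⁻¹' A) + ε / 2 / (c + 1) ∂(m i) :=
          lintegral_mono fun x => h1 i _ (measurable_prodMk_left hA)
      _ = (m i).prod ρ A + ε / 2 / (c + 1) * m i univ := by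
          rw [lintegral_add_right _ measurable_const, lintegral_const, Measure.prod_apply hA]
      _ ≤ (m i).prod ρ A + ε / 2 := by
          gcongr
          exact (mul_le_mul_right (hc i) _).trans (small _ _ (by finiteness))
      _ = ∫⁻ y, m i ((fun x => (x, y)) ⁻¹' A) ∂ρ + ε / 2 := by rw [Measure.prod_apply_symm hA]
      _ ≤ ∫⁻ y, ρ' ((fun x => (x, y)) ⁻¹' A) + ε / 2 / (ρ univ + 1) ∂ρ + ε / 2 := by
          gcongr with y
          exact h2 i _ (measurable_prodMk_right hA)
      _ = ρ'.prod ρ A + ε / 2 / (ρ univ + 1) * ρ univ + ε / 2 := by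
          rw [lintegral_add_right _ measurable_const, lintegral_const,
            Measure.prod_apply_symm hA]
      _ ≤ ρ'.prod ρ A + ε / 2 + ε / 2 := by gcongr; exact small _ _ (by finiteness)
      _ = ρ'.prod ρ A + ε := by rw [add_assoc, ENNReal.add_halves]
  obtain ⟨π, hπ, hlim⟩ := exists_setwise_limit U (fun i => (m i).prod (m i)) hdom
  have hprod : μ.prod μ = π := by
    refine Measure.prod_eq fun s t hs ht => ?_
    refine tendsto_nhds_unique (hlim _ (hs.prod ht)) ?_
    simp_rw [Measure.prod_prod]
    exact ENNReal.Tendsto.mul (h s hs) (Or.inr (measure_ne_top _ _)) (h t ht)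
      (Or.inr (measure_ne_top _ _))
  rw [hprod]
  exact hlim E hE

end SetwiseLimit

/-! ### Euler steps for the exchange operator -/

/-- The total rate `∫∫ k(x,y,z) u(y) dy dz` at which a site in state `x` exchanges mass. -/
noncomputable def rate (k : ℝ × ℝ × ℝ → ℝ≥0∞) (u : ℝ → ℝ≥0∞) (x : ℝ) : ℝ≥0∞ :=
  ∫⁻ q : ℝ × ℝ, k (x, q) * u q.1

/-- The collision functional `∭ G(x,y,z) k(x,y,z) v(x) u(y) dx dy dz`. -/
noncomputable def collision (k G : ℝ × ℝ × ℝ → ℝ≥0∞) (v u : ℝ → ℝ≥0∞) : ℝ≥0∞ :=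
  ∫⁻ p : ℝ × ℝ × ℝ, G p * k p * (v p.1 * u p.2.1)

/-- One explicit Euler step of length `h`, with the environment `u` frozen; it is linear in `v`.
The subtraction of extended non-negative numbers is truncated, so that the step is only
meaningful if `2 h · rate k u x ≤ 1` for all `x`. -/
noncomputable def eulerStep (k : ℝ × ℝ × ℝ → ℝ≥0∞) (h : ℝ≥0) (u v : ℝ → ℝ≥0∞) (x : ℝ) : ℝ≥0∞ :=
  (1 - 2 * h * rate k u x) * v x +
    h * ∫⁻ q : ℝ × ℝ, (k (x - q.2, q) * v (x - q.2) + k (x + q.2, q) * v (x + q.2)) * u q.1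

section Euler

variable {k : ℝ × ℝ × ℝ → ℝ≥0∞} {u v : ℝ → ℝ≥0∞} {h : ℝ≥0}

theorem measurable_rate (hk : Measurable k) (hu : Measurable u) : Measurable (rate k u) := by
  unfold rate
  exact Measurable.lintegral_prod_right' (f := fun p : ℝ × ℝ × ℝ => k p * u p.2.1) (by fun_prop)

theorem measurable_eulerStep (hk : Measurable k) (hu : Measurable u) (hv : Measurable v) :
    Measurable (eulerStep k h u v) := by
  unfold eulerStep
  refine Measurable.add ?_ (Measurable.const_mul ?_ _)
  · exact (measurable_const.sub ((measurable_rate hk hu).const_mul _)).mul hv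
  · exact Measurable.lintegral_prod_right' (f := fun p : ℝ × ℝ × ℝ =>
      (k (p.1 - p.2.2, p.2) * v (p.1 - p.2.2) + k (p.1 + p.2.2, p.2) * v (p.1 + p.2.2)) * u p.2.1)
      (by fun_prop)

theorem lintegral_mul_rate (hk : Measurable k) (hu : Measurable u) (hv : Measurable v)
    {f : ℝ → ℝ≥0∞} (hf : Measurable f) :
    ∫⁻ x, f x * (rate k u x * v x) = collision k (fun p => f p.1) v u := by
  unfold collision rate
  rw [Measure.volume_eq_prod ℝ (ℝ × ℝ), lintegral_prod _ (by fun_prop)]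
  refine lintegral_congr fun x => ?_
  rw [mul_comm (∫⁻ q, _), ← mul_assoc, ← lintegral_const_mul _ (by fun_prop)]
  refine lintegral_congr fun q => ?_
  ring

theorem lintegral_mul_shift (hk : Measurable k) (hu : Measurable u) (hv : Measurable v)
    {f : ℝ → ℝ≥0∞} (hf : Measurable f) {s : ℝ → ℝ} (hs : Measurable s) :
    ∫⁻ x, f x * ∫⁻ q : ℝ × ℝ, k (x - s q.2, q) * v (x - s q.2) * u q.1 =
      collision k (fun p => f (p.1 + s p.2.2)) v u := by
  unfold collision
  rw [Measure.volume_eq_prod ℝ (ℝ × ℝ), lintegral_prod_symm _ (by fun_prop)]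
  have : ∀ x, f x * ∫⁻ q : ℝ × ℝ, k (x - s q.2, q) * v (x - s q.2) * u q.1 =
      ∫⁻ q : ℝ × ℝ, f x * (k (x - s q.2, q) * v (x - s q.2) * u q.1) := fun x => by
    rw [lintegral_const_mul _ (by fun_prop)]
  simp_rw [this]
  rw [lintegral_lintegral_swap (by fun_prop)]
  refine lintegral_congr fun q => ?_
  rw [← lintegral_sub_right_eq_self (fun x => f (x + s q.2) * k (x, q) * (v x * u q.1)) (s q.2)]
  refine lintegral_congr fun x => ?_
  simp only [sub_add_cancel]
  ring

theorem collision_add (hk : Measurable k) (hu : Measurable u) (hv : Measurable v)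
    {G : ℝ × ℝ × ℝ → ℝ≥0∞} (hG : Measurable G) (G' : ℝ × ℝ × ℝ → ℝ≥0∞) :
    collision k (fun p => G p + G' p) v u = collision k G v u + collision k G' v u := by
  unfold collision
  rw [← lintegral_add_left (by fun_prop)]
  simp_rw [add_mul]

theorem collision_const_mul (hk : Measurable k) (hu : Measurable u) (hv : Measurable v)
    {G : ℝ × ℝ × ℝ → ℝ≥0∞} (hG : Measurable G) (c : ℝ≥0∞) :
    collision k (fun p => c * G p) v u = c * collision k G v u := by
  unfold collision
  rw [← lintegral_const_mul _ (by fun_prop)]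
  simp_rw [mul_assoc]

/-- The weak form of an Euler step, with the loss term moved to the left-hand side. -/
theorem lintegral_mul_eulerStep (hk : Measurable k) (hu : Measurable u) (hv : Measurable v)
    (hh : ∀ x, 2 * h * rate k u x ≤ 1) {f : ℝ → ℝ≥0∞} (hf : Measurable f) :
    (∫⁻ x, f x * eulerStep k h u v x) + h * collision k (fun p => 2 * f p.1) v u =
      (∫⁻ x, f x * v x) +
        h * collision k (fun p => f (p.1 + p.2.2) + f (p.1 - p.2.2)) v u := by
  have hr := measurable_rate hk hu
  have hsplit : ∀ x, f x * eulerStep k h u v x =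
      f x * ((1 - 2 * h * rate k u x) * v x) +
      (h * (f x * ∫⁻ q : ℝ × ℝ, k (x - id q.2, q) * v (x - id q.2) * u q.1) +
      h * (f x * ∫⁻ q : ℝ × ℝ, k (x - (-q.2), q) * v (x - (-q.2)) * u q.1)) := by
    intro x
    unfold eulerStep
    have : ∫⁻ q : ℝ × ℝ, (k (x - q.2, q) * v (x - q.2) + k (x + q.2, q) * v (x + q.2)) * u q.1 =
        (∫⁻ q : ℝ × ℝ, k (x - id q.2, q) * v (x - id q.2) * u q.1) +
        ∫⁻ q : ℝ × ℝ, k (x - (-q.2), q) * v (x - (-q.2)) * u q.1 := by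
      rw [← lintegral_add_left (by fun_prop)]
      simp only [id, sub_neg_eq_add, add_mul]
    rw [this]
    ring
  have hm1 : Measurable fun x => ∫⁻ q : ℝ × ℝ, k (x - id q.2, q) * v (x - id q.2) * u q.1 :=
    Measurable.lintegral_prod_right' (f := fun p : ℝ × ℝ × ℝ =>
      k (p.1 - id p.2.2, p.2) * v (p.1 - id p.2.2) * u p.2.1) (by fun_prop)
  have hm2 : Measurable fun x => ∫⁻ q : ℝ × ℝ, k (x - (-q.2), q) * v (x - (-q.2)) * u q.1 :=
    Measurable.lintegral_prod_right' (f := fun p : ℝ × ℝ × ℝ =>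
      k (p.1 - (-p.2.2), p.2) * v (p.1 - (-p.2.2)) * u p.2.1) (by fun_prop)
  simp_rw [hsplit]
  rw [lintegral_add_left (by fun_prop), lintegral_add_left (by fun_prop),
    lintegral_const_mul _ (by fun_prop), lintegral_const_mul _ (by fun_prop),
    lintegral_mul_shift hk hu hv hf measurable_id,
    lintegral_mul_shift hk hu hv hf measurable_neg,
    collision_const_mul hk hu hv (by fun_prop), collision_add hk hu hv (by fun_prop),
    ← lintegral_mul_rate hk hu hv hf]
  simp only [id, ← sub_eq_add_neg]
  have hloss : ∫⁻ x, f x * v x = (∫⁻ x, f x * ((1 - 2 * h * rate k u x) * v x)) +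
      h * (2 * ∫⁻ x, f x * (rate k u x * v x)) := by
    rw [← lintegral_const_mul _ (by fun_prop), ← lintegral_const_mul _ (by fun_prop),
      ← lintegral_add_left (by fun_prop)]
    refine lintegral_congr fun x => ?_
    have : v x = ((1 - 2 * h * rate k u x) + 2 * h * rate k u x) * v x := by
      rw [tsub_add_cancel_of_le (hh x), one_mul]
    conv_lhs => rw [this]
    ring
  rw [hloss]
  ring

theorem eulerStep_add (hk : Measurable k) (hu : Measurable u) (hv : Measurable v)
    (v' : ℝ → ℝ≥0∞) (x : ℝ) :
    eulerStep k h u (fun y => v y + v' y) x = eulerStep k h u v x + eulerStep k h u v' x := by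
  unfold eulerStep
  have : ∫⁻ q : ℝ × ℝ, (k (x - q.2, q) * (v (x - q.2) + v' (x - q.2)) +
        k (x + q.2, q) * (v (x + q.2) + v' (x + q.2))) * u q.1 =
      (∫⁻ q : ℝ × ℝ, (k (x - q.2, q) * v (x - q.2) + k (x + q.2, q) * v (x + q.2)) * u q.1) +
      ∫⁻ q : ℝ × ℝ, (k (x - q.2, q) * v' (x - q.2) + k (x + q.2, q) * v' (x + q.2)) * u q.1 := by
    rw [← lintegral_add_left (by fun_prop)]
    refine lintegral_congr fun q => ?_
    ring
  rw [this]
  ring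

/-- The Euler scheme started from `u₀`. -/
noncomputable def eulerIter (k : ℝ × ℝ × ℝ → ℝ≥0∞) (h : ℝ≥0) (u₀ : ℝ → ℝ≥0∞) :
    ℕ → ℝ → ℝ≥0∞
  | 0 => u₀
  | j + 1 => eulerStep k h (eulerIter k h u₀ j) (eulerIter k h u₀ j)

/-- The linear evolution of `v₀` in the environment given by the Euler scheme started
from `u₀`. -/
noncomputable def eulerTransport (k : ℝ × ℝ × ℝ → ℝ≥0∞) (h : ℝ≥0) (u₀ v₀ : ℝ → ℝ≥0∞) :
    ℕ → ℝ → ℝ≥0∞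
  | 0 => v₀
  | j + 1 => eulerStep k h (eulerIter k h u₀ j) (eulerTransport k h u₀ v₀ j)

theorem measurable_eulerIter (hk : Measurable k) (hu : Measurable u) (j : ℕ) :
    Measurable (eulerIter k h u j) := by
  induction j with
  | zero => exact hu
  | succ j ih => exact measurable_eulerStep hk ih ih

theorem measurable_eulerTransport (hk : Measurable k) (hu : Measurable u) (hv : Measurable v)
    (j : ℕ) : Measurable (eulerTransport k h u v j) := by
  induction j with
  | zero => exact hv
  | succ j ih => exact measurable_eulerStep hk (measurable_eulerIter hk hu j) ih

theorem eulerIter_eq_add_transport (hk : Measurable k) (hu : Measurable u) (hv : Measurable v)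
    {v' : ℝ → ℝ≥0∞} (huv : ∀ x, u x = v x + v' x) (j : ℕ) (x : ℝ) :
    eulerIter k h u j x = eulerTransport k h u v j x + eulerTransport k h u v' j x := by
  induction j generalizing x with
  | zero => exact huv x
  | succ j ih =>
    simp only [eulerTransport]
    rw [← eulerStep_add hk (measurable_eulerIter hk hu j) (measurable_eulerTransport hk hu hv j),
      ← funext ih]
    rfl

end Euler

/-! ### Elementary inequalities for powers -/

theorem one_le_check (x : ℝ) : 1 ≤ check x := le_max_left _ _

theorem check_pos (x : ℝ) : 0 < check x := one_pos.trans_le (one_le_check x)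

theorem rpow_le_interp {lam a : ℝ} (h1 : 1 ≤ lam) (h2 : lam ≤ 2) (ha : 0 ≤ a) :
    a ^ lam ≤ (2 - lam) * a + (lam - 1) * a ^ 2 := by
  rcases ha.eq_or_lt with rfl | hpos
  · rw [Real.zero_rpow (by linarith)]; simp
  have := Real.geom_mean_le_arith_mean2_weighted (w₁ := 2 - lam) (w₂ := lam - 1) (p₁ := a)
    (p₂ := a ^ 2) (by linarith) (by linarith) ha (by positivity) (by ring)
  refine le_trans (le_of_eq ?_) this
  rw [← Real.rpow_natCast a 2, ← Real.rpow_mul ha, ← Real.rpow_add hpos]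
  congr 1; push_cast; ring

/-- The second difference of `x ^ λ · ω x`, for `1 ≤ λ ≤ 2` and a non-negative concave function
`ω`. Only two consequences of the concavity enter. -/
theorem second_difference_rpow_mul_le {lam x z : ℝ} (h1 : 1 ≤ lam) (h2 : lam ≤ 2) (hz : 0 < z)
    (hzx : z < x) {ω : ℝ → ℝ} (hω : 0 ≤ ω x) (hmono : ω (x - z) ≤ ω x)
    (hconc : ω (x + z) + ω (x - z) ≤ 2 * ω x)
    (hslope : x * (ω x - ω (x - z)) ≤ z * ω x) :
    (x + z) ^ lam * ω (x + z) + (x - z) ^ lam * ω (x - z) ≤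
      2 * (x ^ lam * ω x) + 7 * (x ^ (lam - 2) * z ^ 2) * ω x := by
  have hx : 0 < x := hz.trans hzx
  set t := z / x with ht
  have ht0 : 0 < t := by positivity
  have ht1 : t < 1 := (div_lt_one hx).2 hzx
  have hz' : z = t * x := by rw [ht]; field_simp
  have hp : (x + z) ^ lam = x ^ lam * (1 + t) ^ lam := by
    rw [← Real.mul_rpow hx.le (by linarith)]; congr 1; rw [hz']; ring
  have hm : (x - z) ^ lam = x ^ lam * (1 - t) ^ lam := by
    rw [← Real.mul_rpow hx.le (by linarith)]; congr 1; rw [hz']; ring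
  have hx2 : x ^ (lam - 2) * z ^ 2 = x ^ lam * t ^ 2 := by
    rw [Real.rpow_sub hx, ht]
    have : x ^ (2 : ℝ) = x ^ 2 := by exact_mod_cast Real.rpow_natCast x 2
    rw [this]; field_simp
  rw [hp, hm, hx2]
  have hup := rpow_le_interp h1 h2 (a := 1 + t) (by linarith)
  have hum := rpow_le_interp h1 h2 (a := 1 - t) (by linarith)
  have hlow : (1 - t) ^ 2 ≤ (1 - t) ^ lam := by
    rw [← Real.rpow_natCast]
    exact Real.rpow_le_rpow_of_exponent_ge (by linarith) (by linarith) (by exact_mod_cast h2)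
  set a := (1 + t) ^ lam
  set b := (1 - t) ^ lam
  set d := ω x - ω (x - z) with hd
  have hd0 : 0 ≤ d := by linarith
  have hdt : d ≤ t * ω x := by
    rw [ht, div_mul_eq_mul_div, le_div_iff₀ hx]; linarith
  have ha0 : 0 ≤ a := Real.rpow_nonneg (by linarith) _
  have hsum : a + b ≤ 2 + 2 * t ^ 2 := by nlinarith [sq_nonneg t]
  have hdiff : a - b ≤ 5 * t := by nlinarith [sq_nonneg t]
  have hxl : 0 < x ^ lam := Real.rpow_pos_of_pos hx _
  have key : a * ω (x + z) + b * ω (x - z) ≤ 2 * ω x + 7 * t ^ 2 * ω x := by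
    calc a * ω (x + z) + b * ω (x - z) ≤ a * (ω x + d) + b * (ω x - d) := by
          have e1 : ω (x + z) ≤ ω x + d := by linarith
          have e2 : ω (x - z) = ω x - d := by linarith
          rw [e2]; gcongr
      _ = (a + b) * ω x + (a - b) * d := by ring
      _ ≤ (2 + 2 * t ^ 2) * ω x + 5 * t * d := by gcongr
      _ ≤ (2 + 2 * t ^ 2) * ω x + 5 * t * (t * ω x) := by gcongr
      _ = _ := by ring
  calc _ = x ^ lam * (a * ω (x + z) + b * ω (x - z)) := by ring
    _ ≤ x ^ lam * (2 * ω x + 7 * t ^ 2 * ω x) := by gcongr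
    _ = _ := by ring

theorem rpow_sub_two_mul_sq_le {lam x z : ℝ} (h1 : 1 ≤ lam) (hz : 0 < z) (hzx : z < x) :
    x ^ (lam - 2) * z ^ 2 ≤ (1 + z ^ 2) * check x ^ (lam - 2) := by
  have hx : 0 < x := hz.trans hzx
  rcases le_total 1 x with h | h
  · rw [check, max_eq_right h, mul_comm]
    gcongr
    linarith
  · rw [check, max_eq_left h, Real.one_rpow, mul_one]
    have h3 : x ^ (lam - 2) * z ^ 2 ≤ x ^ (lam - 2) * x ^ (2 : ℝ) := by
      have : x ^ (2 : ℝ) = x ^ 2 := by exact_mod_cast Real.rpow_natCast x 2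
      rw [this]; gcongr
    rw [← Real.rpow_add hx] at h3
    have h4 : x ^ (lam - 2 + 2) ≤ 1 := Real.rpow_le_one hx.le h (by linarith)
    nlinarith [sq_nonneg z]

/-- Two powers whose exponents are at most `λ` and add up to at most `λ + 1` are controlled by
the extreme distribution `(λ, 1)` of the exponents. -/
theorem rpow_mul_rpow_le {lam a b x y : ℝ} (hx : 1 ≤ x) (hy : 1 ≤ y) (ha : a ≤ lam) (hb : b ≤ lam)
    (hab : a + b ≤ lam + 1) : x ^ a * y ^ b ≤ x ^ lam * y + x * y ^ lam := by
  have main : ∀ {a b x y : ℝ}, 1 ≤ y → y ≤ x → a ≤ lam → a + b ≤ lam + 1 →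
      x ^ a * y ^ b ≤ x ^ lam * y := by
    intro a b x y hy hyx ha hab
    have hx := hy.trans hyx
    rcases le_total b 1 with h | h
    · calc x ^ a * y ^ b ≤ x ^ lam * y ^ (1 : ℝ) := by
            gcongr
        _ = _ := by rw [Real.rpow_one]
    · calc x ^ a * y ^ b = x ^ a * (y ^ (b - 1) * y) := by
            rw [← Real.rpow_add_one (by linarith)]; congr 2; ring
        _ ≤ x ^ a * (x ^ (b - 1) * y) := by
            gcongr
        _ = x ^ (a + (b - 1)) * y := by rw [Real.rpow_add (by linarith)]; ring
        _ ≤ x ^ lam * y := by gcongr; linarith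
  have hx0 : 0 ≤ x := by linarith
  have hy0 : 0 ≤ y := by linarith
  rcases le_total y x with h | h
  · have := main (a := a) (b := b) hy h ha hab
    have h2 : 0 ≤ x * y ^ lam := by positivity
    linarith
  · have := main (a := b) (b := a) hx h hb (by linarith)
    have h2 : 0 ≤ x ^ lam * y := by positivity
    linarith

/-! ### Kernel bounds in weighted form -/

/-- The weight `x̌ ^ r`. -/
noncomputable def farWeight (r x : ℝ) : ℝ≥0∞ := ENNReal.ofReal (check x ^ r)

/-- The weight `x̂ ^ (-α)`. -/
noncomputable def nearWeight (α x : ℝ) : ℝ≥0∞ := ENNReal.ofReal (hat x ^ (-α))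

theorem measurable_check : Measurable check := measurable_const.max measurable_id

theorem measurable_hat : Measurable hat := measurable_const.min measurable_id

@[fun_prop]
theorem measurable_farWeight (r : ℝ) : Measurable (farWeight r) :=
  (measurable_check.pow_const r).ennreal_ofReal

@[fun_prop]
theorem measurable_nearWeight (α : ℝ) : Measurable (nearWeight α) :=
  (measurable_hat.pow_const (-α)).ennreal_ofReal

theorem farWeight_mono {r s : ℝ} (h : r ≤ s) (x : ℝ) : farWeight r x ≤ farWeight s x :=
  ENNReal.ofReal_le_ofReal (Real.rpow_le_rpow_of_exponent_le (one_le_check x) h)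

@[simp]
theorem farWeight_zero (x : ℝ) : farWeight 0 x = 1 := by simp [farWeight]

theorem one_le_farWeight {r : ℝ} (h : 0 ≤ r) (x : ℝ) : 1 ≤ farWeight r x := by
  rw [← farWeight_zero x]; exact farWeight_mono h x

/-- The properties of an exchange kernel on which the a priori estimates rest. The kernel is
extended by zero to all of `ℝ³`; `θ` collects the dependence on the exchanged mass `z`, and
`growth_sub_two` combines the growth in `x` and `y` with the factor `x ^ (λ - 2)` coming from second
differences of `x ^ λ`. -/
structure KernelBounds (k : ℝ × ℝ × ℝ → ℝ≥0∞) (θ : ℝ → ℝ≥0∞) (α lam : ℝ) (C : ℝ≥0) : Prop where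
  measurable : Measurable k
  measurable_theta : Measurable θ
  one_lt : 1 < lam
  le_two : lam ≤ 2
  alpha_nonneg : 0 ≤ α
  moment : ∫⁻ z, ENNReal.ofReal (1 + z ^ 2) * θ z ≠ ∞
  supp : ∀ x y z, k (x, y, z) ≠ 0 → 0 < z ∧ z < x ∧ z < y
  growth : ∀ x y z, k (x, y, z) ≤ farWeight lam x * farWeight lam y * θ z
  growth_sub_two : ∀ x y z, farWeight (lam - 2) x * k (x, y, z) ≤
    (farWeight lam x * farWeight 1 y + farWeight 1 x * farWeight lam y) * θ z
  second_difference : ∀ x y z, k (x - z, y, z) + k (x + z, y, z) ≤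
    2 * k (x, y, z) + ENNReal.ofReal (z ^ 2) * farWeight lam y * θ z
  singular : ∀ x y z, nearWeight α (x - z) * k (x, y, z) ≤
    C * (farWeight lam x * farWeight lam y * nearWeight α y * θ z)

/-- Cutting a kernel off at a multiple of `θ` preserves all its bounds; in particular the one on
second differences, as a minimum of semiconcave functions is semiconcave. -/
theorem KernelBounds.truncate {k : ℝ × ℝ × ℝ → ℝ≥0∞} {θ : ℝ → ℝ≥0∞} {α lam : ℝ} {C : ℝ≥0}
    (hk : KernelBounds k θ α lam C) (n : ℝ≥0) :
    KernelBounds (fun p => min (k p) (n * θ p.2.2)) θ α lam C where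
  measurable := by
    have := hk.measurable; have := hk.measurable_theta
    fun_prop
  measurable_theta := hk.measurable_theta
  one_lt := hk.one_lt
  le_two := hk.le_two
  alpha_nonneg := hk.alpha_nonneg
  moment := hk.moment
  supp x y z h := hk.supp x y z fun h0 => h (by simp [h0])
  growth x y z := (min_le_left _ _).trans (hk.growth x y z)
  growth_sub_two x y z :=
    (mul_le_mul_right (min_le_left _ _) _).trans (hk.growth_sub_two x y z)
  second_difference x y z := by
    rcases le_total (k (x, y, z)) (n * θ z) with h | h
    · simp only [min_eq_left h]
      exact (add_le_add (min_le_left _ _) (min_le_left _ _)).trans (hk.second_difference x y z)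
    · simp only [min_eq_right h]
      refine le_add_right ?_
      rw [two_mul]
      exact add_le_add (min_le_right _ _) (min_le_right _ _)
  singular x y z := (mul_le_mul_right (min_le_left _ _) _).trans (hk.singular x y z)

/-! ### One-step estimates -/

section OneStep

variable {k : ℝ × ℝ × ℝ → ℝ≥0∞} {u v : ℝ → ℝ≥0∞} {h : ℝ≥0}

theorem lintegral_tensor {a b s u v : ℝ → ℝ≥0∞} (ha : Measurable a) (hb : Measurable b)
    (hs : Measurable s) (hv : Measurable v) (hu : Measurable u) :
    ∫⁻ p : ℝ × ℝ × ℝ, (a p.1 * b p.2.1 * s p.2.2) * (v p.1 * u p.2.1) =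
      (∫⁻ x, a x * v x) * (∫⁻ y, b y * u y) * ∫⁻ z, s z := by
  have : ∀ p : ℝ × ℝ × ℝ, (a p.1 * b p.2.1 * s p.2.2) * (v p.1 * u p.2.1) =
      (fun x => a x * v x) p.1 * (fun q : ℝ × ℝ => (fun y => b y * u y) q.1 * s q.2) p.2 :=
    fun p => by ring
  rw [lintegral_congr this, Measure.volume_eq_prod ℝ (ℝ × ℝ),
    lintegral_prod_mul (f := fun x => a x * v x)
      (g := fun q : ℝ × ℝ => (fun y => b y * u y) q.1 * s q.2) (by fun_prop) (by fun_prop),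
    Measure.volume_eq_prod,
    lintegral_prod_mul (f := fun y => b y * u y) (by fun_prop) (by fun_prop), mul_assoc]

theorem collision_mono {G G' : ℝ × ℝ × ℝ → ℝ≥0∞} (hG : ∀ p, k p ≠ 0 → G p ≤ G' p) :
    collision k G v u ≤ collision k G' v u := by
  refine lintegral_mono fun p => ?_
  by_cases hp : k p = 0
  · simp [hp]
  · have := hG p hp
    gcongr

theorem collision_congr {G G' : ℝ × ℝ × ℝ → ℝ≥0∞} (hG : ∀ p, k p ≠ 0 → G p = G' p) :
    collision k G v u = collision k G' v u :=
  le_antisymm (collision_mono fun p hp => (hG p hp).le) (collision_mono fun p hp => (hG p hp).ge)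

theorem collision_le {G : ℝ × ℝ × ℝ → ℝ≥0∞} {a b s : ℝ → ℝ≥0∞} (ha : Measurable a)
    (hb : Measurable b) (hs : Measurable s) (hv : Measurable v) (hu : Measurable u)
    (hG : ∀ p, G p * k p ≤ a p.1 * b p.2.1 * s p.2.2) :
    collision k G v u ≤ (∫⁻ x, a x * v x) * (∫⁻ y, b y * u y) * ∫⁻ z, s z := by
  rw [← lintegral_tensor ha hb hs hv hu]
  exact lintegral_mono fun p => mul_le_mul_left (hG p) _

theorem rate_le {θ : ℝ → ℝ≥0∞} (hθ : Measurable θ) {N : ℝ≥0} (hN : ∀ p, k p ≤ N * θ p.2.2)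
    (hu : Measurable u) (x : ℝ) : rate k u x ≤ N * (∫⁻ z, θ z) * ∫⁻ y, u y := by
  calc rate k u x ≤ ∫⁻ q : ℝ × ℝ, N * (u q.1 * θ q.2) := by
        refine lintegral_mono fun q => ?_
        calc k (x, q) * u q.1 ≤ N * θ q.2 * u q.1 := mul_le_mul_left (hN (x, q)) _
          _ = _ := by ring
    _ = _ := by
        rw [lintegral_const_mul _ (by fun_prop), Measure.volume_eq_prod,
          lintegral_prod_mul (by fun_prop) (by fun_prop)]
        ring

theorem step_mul_collision_le (hk : Measurable k) (hu : Measurable u) (hv : Measurable v)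
    (hh : ∀ x, 2 * h * rate k u x ≤ 1) {f : ℝ → ℝ≥0∞} (hf : Measurable f) :
    h * collision k (fun p => 2 * f p.1) v u ≤ ∫⁻ x, f x * v x := by
  have hr := measurable_rate hk hu
  rw [collision_const_mul hk hu hv (by fun_prop), ← lintegral_mul_rate hk hu hv hf,
    ← lintegral_const_mul _ (by fun_prop), ← lintegral_const_mul _ (by fun_prop)]
  refine lintegral_mono fun x => ?_
  calc h * (2 * (f x * (rate k u x * v x))) = 2 * h * rate k u x * (f x * v x) := by ring
    _ ≤ 1 * (f x * v x) := mul_le_mul_left (hh x) _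
    _ = _ := one_mul _

/-- Growth of a moment in one step, if the second differences of the weight are bounded
by `e`. -/
theorem lintegral_mul_eulerStep_le (hk : Measurable k) (hu : Measurable u) (hv : Measurable v)
    (hh : ∀ x, 2 * h * rate k u x ≤ 1) {f : ℝ → ℝ≥0∞} (hf : Measurable f)
    {e : ℝ × ℝ × ℝ → ℝ≥0∞}
    (hfe : ∀ x y z, k (x, y, z) ≠ 0 → f (x + z) + f (x - z) ≤ 2 * f x + e (x, y, z))
    (hfin : ∫⁻ x, f x * v x ≠ ∞) :
    ∫⁻ x, f x * eulerStep k h u v x ≤ (∫⁻ x, f x * v x) + h * collision k e v u := by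
  have hid := lintegral_mul_eulerStep hk hu hv hh hf
  have hle : collision k (fun p => f (p.1 + p.2.2) + f (p.1 - p.2.2)) v u ≤
      collision k (fun p => 2 * f p.1) v u + collision k e v u := by
    rw [← collision_add hk hu hv (by fun_prop)]
    exact collision_mono fun p hp => hfe p.1 p.2.1 p.2.2 hp
  refine (ENNReal.add_le_add_iff_right (ne_top_of_le_ne_top hfin
    (step_mul_collision_le hk hu hv hh hf))).1 ?_
  rw [hid, add_assoc, ← mul_add, add_comm (collision k e v u)]
  gcongr

/-- Conservation of moments with vanishing second differences. -/
theorem lintegral_mul_eulerStep_eq (hk : Measurable k) (hu : Measurable u) (hv : Measurable v)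
    (hh : ∀ x, 2 * h * rate k u x ≤ 1) {f : ℝ → ℝ≥0∞} (hf : Measurable f)
    (hf0 : ∀ x y z, k (x, y, z) ≠ 0 → f (x + z) + f (x - z) = 2 * f x)
    (hfin : ∫⁻ x, f x * v x ≠ ∞) :
    ∫⁻ x, f x * eulerStep k h u v x = ∫⁻ x, f x * v x := by
  have hid := lintegral_mul_eulerStep hk hu hv hh hf
  rw [collision_congr (G := fun p => f (p.1 + p.2.2) + f (p.1 - p.2.2))
    (G' := fun p => 2 * f p.1) fun p hp => hf0 p.1 p.2.1 p.2.2 hp] at hid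
  exact (ENNReal.add_left_inj (ne_top_of_le_ne_top hfin
    (step_mul_collision_le hk hu hv hh hf))).1 hid

/-- The growth of the supremum in one step is controlled by the second differences of the
kernel. -/
theorem eulerStep_le_const (hk : Measurable k) (hu : Measurable u)
    (hh : ∀ x, 2 * h * rate k u x ≤ 1) {b s : ℝ → ℝ≥0∞} (hb : Measurable b) (hs : Measurable s)
    (hks : ∀ x y z, k (x - z, y, z) + k (x + z, y, z) ≤ 2 * k (x, y, z) + b y * s z)
    {R : ℝ≥0∞} (hv : ∀ x, v x ≤ R) (x : ℝ) :
    eulerStep k h u v x ≤ (1 + h * ((∫⁻ y, b y * u y) * ∫⁻ z, s z)) * R := by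
  have h1 : ∫⁻ q : ℝ × ℝ, (k (x - q.2, q) * v (x - q.2) + k (x + q.2, q) * v (x + q.2)) * u q.1 ≤
      (2 * rate k u x + (∫⁻ y, b y * u y) * ∫⁻ z, s z) * R := by
    have e1 : (∫⁻ y, b y * u y) * ∫⁻ z, s z = ∫⁻ q : ℝ × ℝ, b q.1 * u q.1 * s q.2 := by
      rw [Measure.volume_eq_prod,
        lintegral_prod_mul (f := fun y => b y * u y) (by fun_prop) (by fun_prop)]
    rw [e1, rate, ← lintegral_const_mul _ (by fun_prop), ← lintegral_add_left (by fun_prop),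
      ← lintegral_mul_const _ (by fun_prop)]
    refine lintegral_mono fun q => ?_
    calc (k (x - q.2, q) * v (x - q.2) + k (x + q.2, q) * v (x + q.2)) * u q.1
        ≤ (k (x - q.2, q) * R + k (x + q.2, q) * R) * u q.1 := by
          gcongr <;> exact hv _
      _ = (k (x - q.2, q) + k (x + q.2, q)) * (u q.1 * R) := by ring
      _ ≤ (2 * k (x, q) + b q.1 * s q.2) * (u q.1 * R) := by
          exact mul_le_mul_left (hks x q.1 q.2) _
      _ = _ := by ring
  calc eulerStep k h u v x ≤ (1 - 2 * h * rate k u x) * R +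
        h * ((2 * rate k u x + (∫⁻ y, b y * u y) * ∫⁻ z, s z) * R) := by
        unfold eulerStep
        gcongr
        exact hv x
    _ = ((1 - 2 * h * rate k u x + 2 * h * rate k u x) +
        h * ((∫⁻ y, b y * u y) * ∫⁻ z, s z)) * R := by ring
    _ = _ := by rw [tsub_add_cancel_of_le (hh x)]

/-- The discrete Gronwall inequality. -/
theorem discrete_gronwall {a : ℕ → ℝ≥0∞} {K : ℝ≥0∞} (hK : K ≠ ∞) {J : ℕ}
    (ha : ∀ j < J, a (j + 1) ≤ (1 + h * K) * a j) {T : ℝ} (hT : J * h ≤ T) {j : ℕ} (hj : j ≤ J) :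
    a j ≤ ENNReal.ofReal (Real.exp (K.toReal * T)) * a 0 := by
  have main : ∀ j ≤ J, a j ≤ ENNReal.ofReal (Real.exp (K.toReal * (j * h))) * a 0 := by
    intro j
    induction j with
    | zero => intro _; simp
    | succ j ih =>
      intro hj
      have h1 : 1 + h * K ≤ ENNReal.ofReal (Real.exp (K.toReal * h)) := by
        calc 1 + h * K = ENNReal.ofReal (K.toReal * h + 1) := by
              rw [ENNReal.ofReal_add (by positivity) zero_le_one,
                ENNReal.ofReal_mul ENNReal.toReal_nonneg, ENNReal.ofReal_toReal hK,
                ENNReal.ofReal_coe_nnreal, ENNReal.ofReal_one]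
              ring
          _ ≤ _ := ENNReal.ofReal_le_ofReal (Real.add_one_le_exp _)
      calc a (j + 1) ≤ (1 + h * K) * a j := ha j (by omega)
        _ ≤ ENNReal.ofReal (Real.exp (K.toReal * h)) *
            (ENNReal.ofReal (Real.exp (K.toReal * (j * h))) * a 0) :=
            mul_le_mul' h1 (ih (by omega))
        _ = _ := by
            rw [← mul_assoc, ← ENNReal.ofReal_mul (Real.exp_nonneg _), ← Real.exp_add]
            congr 3
            push_cast
            ring
  refine (main j hj).trans ?_
  gcongr
  refine le_trans ?_ hT
  gcongr

end OneStep

/-! ### Estimates for the Euler scheme that are uniform in the step and in the cut-off -/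

/-- An initial datum, as a function on `ℝ` that vanishes on `(-∞, 0]`. -/
structure InitialDatum (α lam : ℝ) (u₀ : ℝ → ℝ≥0∞) : Prop where
  measurable : Measurable u₀
  eq_zero : ∀ x ≤ 0, u₀ x = 0
  far : ∫⁻ x, farWeight lam x * u₀ x ≠ ∞
  near : ∫⁻ x, nearWeight α x * u₀ x ≠ ∞

/-- A kernel and a step length for which the Euler scheme started from `u₀` preserves
positivity. -/
structure StableScheme (k : ℝ × ℝ × ℝ → ℝ≥0∞) (θ : ℝ → ℝ≥0∞) (α lam : ℝ) (C h : ℝ≥0)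
    (u₀ : ℝ → ℝ≥0∞) : Prop where
  bounds : KernelBounds k θ α lam C
  datum : InitialDatum α lam u₀
  small : ∀ u : ℝ → ℝ≥0∞, Measurable u → ∫⁻ x, u x = ∫⁻ x, u₀ x → ∀ x, 2 * h * rate k u x ≤ 1

theorem InitialDatum.mass_ne_top {α lam : ℝ} {u₀ : ℝ → ℝ≥0∞} (hu : InitialDatum α lam u₀)
    (hl : 0 ≤ lam) : ∫⁻ x, u₀ x ≠ ∞ :=
  ne_top_of_le_ne_top hu.far <| lintegral_mono fun x => by
    simpa using mul_le_mul_left (one_le_farWeight hl x) (u₀ x)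

theorem ofReal_le_farWeight {lam : ℝ} (hl : 1 ≤ lam) (x : ℝ) :
    ENNReal.ofReal x ≤ farWeight lam x :=
  le_trans (ENNReal.ofReal_le_ofReal (by rw [Real.rpow_one]; exact le_max_right _ _))
    (farWeight_mono hl x)

theorem InitialDatum.first_moment_ne_top {α lam : ℝ} {u₀ : ℝ → ℝ≥0∞}
    (hu : InitialDatum α lam u₀) (hl : 1 ≤ lam) : ∫⁻ x, ENNReal.ofReal x * u₀ x ≠ ∞ :=
  ne_top_of_le_ne_top hu.far <| lintegral_mono fun x =>
    mul_le_mul_left (ofReal_le_farWeight hl x) (u₀ x)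

theorem farWeight_one_le (x : ℝ) : farWeight 1 x ≤ 1 + ENNReal.ofReal x := by
  rw [farWeight, Real.rpow_one, check, ENNReal.ofReal_max, ENNReal.ofReal_one]
  exact max_le le_self_add le_add_self

theorem rpow_le_farWeight {lam x : ℝ} (hl : 0 ≤ lam) (hx : 0 ≤ x) :
    ENNReal.ofReal (x ^ lam) ≤ farWeight lam x :=
  ENNReal.ofReal_le_ofReal (Real.rpow_le_rpow hx (le_max_right _ _) hl)

theorem farWeight_le (lam x : ℝ) :
    farWeight lam x ≤ 1 + ENNReal.ofReal (x ^ lam) := by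
  rw [farWeight, check]
  rcases le_total x 1 with h | h
  · rw [max_eq_left h]; simp
  · rw [max_eq_right h]; exact le_add_self

/-- `second_difference_rpow_mul_le` for the weights with values in `[0, ∞]`. -/
theorem second_difference_weight_le {lam x z : ℝ} (h1 : 1 ≤ lam) (h2 : lam ≤ 2) (hz : 0 < z)
    (hzx : z < x) {ω : ℝ → ℝ} (hω : ∀ y, 0 < y → 0 ≤ ω y) (hmono : ω (x - z) ≤ ω x)
    (hconc : ω (x + z) + ω (x - z) ≤ 2 * ω x)
    (hslope : x * (ω x - ω (x - z)) ≤ z * ω x) :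
    ENNReal.ofReal ((x + z) ^ lam * ω (x + z)) + ENNReal.ofReal ((x - z) ^ lam * ω (x - z)) ≤
      2 * ENNReal.ofReal (x ^ lam * ω x) +
        7 * (ENNReal.ofReal (1 + z ^ 2) * farWeight (lam - 2) x * ENNReal.ofReal (ω x)) := by
  have hx : 0 < x := hz.trans hzx
  have e0 := hω x hx
  have ep := hω (x + z) (by linarith)
  have em := hω (x - z) (by linarith)
  have p0 : 0 ≤ x ^ lam := Real.rpow_nonneg hx.le _
  have pp : 0 ≤ (x + z) ^ lam := Real.rpow_nonneg (by linarith) _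
  have pm : 0 ≤ (x - z) ^ lam := Real.rpow_nonneg (by linarith) _
  have pc : 0 ≤ check x ^ (lam - 2) := Real.rpow_nonneg (check_pos x).le _
  have key := second_difference_rpow_mul_le h1 h2 hz hzx e0 hmono hconc hslope
  have key2 := mul_le_mul_of_nonneg_right (rpow_sub_two_mul_sq_le h1 hz hzx) e0
  have e2 : (2 : ℝ≥0∞) = ENNReal.ofReal 2 := by simp
  have e7 : (7 : ℝ≥0∞) = ENNReal.ofReal 7 := by simp
  rw [farWeight, ← ENNReal.ofReal_add (by positivity) (by positivity),
    ← ENNReal.ofReal_mul (by positivity), ← ENNReal.ofReal_mul (by positivity), e2, e7,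
    ← ENNReal.ofReal_mul (by positivity), ← ENNReal.ofReal_mul (by positivity),
    ← ENNReal.ofReal_add (by positivity) (by positivity)]
  refine ENNReal.ofReal_le_ofReal ?_
  linarith

theorem lintegral_theta_le (θ : ℝ → ℝ≥0∞) :
    ∫⁻ z, θ z ≤ ∫⁻ z, ENNReal.ofReal (1 + z ^ 2) * θ z := by
  refine lintegral_mono fun z => ?_
  have : (1 : ℝ≥0∞) ≤ ENNReal.ofReal (1 + z ^ 2) := by
    rw [← ENNReal.ofReal_one]
    exact ENNReal.ofReal_le_ofReal (by nlinarith [sq_nonneg z])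
  simpa using mul_le_mul_left this (θ z)

theorem lintegral_sq_mul_theta_le (θ : ℝ → ℝ≥0∞) :
    ∫⁻ z, ENNReal.ofReal (z ^ 2) * θ z ≤ ∫⁻ z, ENNReal.ofReal (1 + z ^ 2) * θ z :=
  lintegral_mono fun z =>
    mul_le_mul_left (ENNReal.ofReal_le_ofReal (by nlinarith [sq_nonneg z])) (θ z)

namespace StableScheme

variable {k : ℝ × ℝ × ℝ → ℝ≥0∞} {θ : ℝ → ℝ≥0∞} {α lam : ℝ} {C h : ℝ≥0} {u₀ : ℝ → ℝ≥0∞}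

theorem measurable_iter (hs : StableScheme k θ α lam C h u₀) (j : ℕ) :
    Measurable (eulerIter k h u₀ j) :=
  measurable_eulerIter hs.bounds.measurable hs.datum.measurable j

theorem mass_ne_top (hs : StableScheme k θ α lam C h u₀) : ∫⁻ x, u₀ x ≠ ∞ :=
  hs.datum.mass_ne_top (by linarith [hs.bounds.one_lt])

theorem lintegral_iter (hs : StableScheme k θ α lam C h u₀) (j : ℕ) :
    ∫⁻ x, eulerIter k h u₀ j x = ∫⁻ x, u₀ x := by
  induction j with
  | zero => rfl
  | succ j ih =>
    have hm := hs.measurable_iter j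
    have := lintegral_mul_eulerStep_eq hs.bounds.measurable hm hm (hs.small _ hm ih)
      (f := fun _ => 1) measurable_const (fun x y z _ => by norm_num)
      (by simpa [ih] using hs.mass_ne_top)
    simp only [one_mul] at this
    rw [← ih, ← this]
    rfl

theorem step_rate_le (hs : StableScheme k θ α lam C h u₀) (j : ℕ) (x : ℝ) :
    2 * h * rate k (eulerIter k h u₀ j) x ≤ 1 :=
  hs.small _ (hs.measurable_iter j) (hs.lintegral_iter j) x

theorem lintegral_transport (hs : StableScheme k θ α lam C h u₀) {v₀ : ℝ → ℝ≥0∞}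
    (hv : Measurable v₀) (hfin : ∫⁻ x, v₀ x ≠ ∞) (j : ℕ) :
    ∫⁻ x, eulerTransport k h u₀ v₀ j x = ∫⁻ x, v₀ x := by
  induction j with
  | zero => rfl
  | succ j ih =>
    have := lintegral_mul_eulerStep_eq hs.bounds.measurable (hs.measurable_iter j)
      (measurable_eulerTransport hs.bounds.measurable hs.datum.measurable hv j)
      (hs.step_rate_le j)
      (f := fun _ => 1) measurable_const (fun x y z _ => by norm_num)
      (by simp only [one_mul]; rwa [ih])
    simp only [one_mul] at this
    rw [← ih, ← this]
    rfl

theorem iter_eq_zero (hs : StableScheme k θ α lam C h u₀) (j : ℕ) {x : ℝ} (hx : x ≤ 0) :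
    eulerIter k h u₀ j x = 0 := by
  induction j generalizing x with
  | zero => exact hs.datum.eq_zero x hx
  | succ j ih =>
    have hz : ∀ q : ℝ × ℝ, (k (x - q.2, q) * eulerIter k h u₀ j (x - q.2) +
        k (x + q.2, q) * eulerIter k h u₀ j (x + q.2)) * eulerIter k h u₀ j q.1 = 0 := by
      intro q
      have h1 : k (x - q.2, q) = 0 := by
        by_contra hne
        have := hs.bounds.supp (x - q.2) q.1 q.2 hne
        linarith
      have h2 : k (x + q.2, q) = 0 := by
        by_contra hne
        have := hs.bounds.supp (x + q.2) q.1 q.2 hne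
        linarith
      simp [h1, h2]
    simp only [eulerIter, eulerStep, hz, ih hx]
    simp

theorem first_moment_iter (hs : StableScheme k θ α lam C h u₀) (j : ℕ) :
    ∫⁻ x, ENNReal.ofReal x * eulerIter k h u₀ j x = ∫⁻ x, ENNReal.ofReal x * u₀ x := by
  induction j with
  | zero => rfl
  | succ j ih =>
    have hm := hs.measurable_iter j
    rw [← ih]
    refine lintegral_mul_eulerStep_eq hs.bounds.measurable hm hm (hs.step_rate_le j)
      ENNReal.measurable_ofReal (fun x y z hk => ?_) ?_
    · obtain ⟨h1, h2, -⟩ := hs.bounds.supp x y z hk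
      rw [← ENNReal.ofReal_add (by linarith) (by linarith), two_mul,
        ← ENNReal.ofReal_add (by linarith) (by linarith)]
      congr 1; ring
    · rw [ih]; exact hs.datum.first_moment_ne_top hs.bounds.one_lt.le

theorem lintegral_farWeight_one_le (hs : StableScheme k θ α lam C h u₀) (j : ℕ) :
    ∫⁻ x, farWeight 1 x * eulerIter k h u₀ j x ≤
      (∫⁻ x, u₀ x) + ∫⁻ x, ENNReal.ofReal x * u₀ x := by
  have hm := hs.measurable_iter j
  rw [← hs.lintegral_iter j, ← hs.first_moment_iter j, ← lintegral_add_left hm]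
  refine lintegral_mono fun x => ?_
  calc farWeight 1 x * eulerIter k h u₀ j x
      ≤ (1 + ENNReal.ofReal x) * eulerIter k h u₀ j x := mul_le_mul_left (farWeight_one_le x) _
    _ = _ := by ring

/-- Weights need only be compared on `(0, ∞)`. -/
theorem lintegral_weight_mono (hs : StableScheme k θ α lam C h u₀) (j : ℕ) {f g : ℝ → ℝ≥0∞}
    (hfg : ∀ x, 0 < x → f x ≤ g x) :
    ∫⁻ x, f x * eulerIter k h u₀ j x ≤ ∫⁻ x, g x * eulerIter k h u₀ j x := by
  refine lintegral_mono fun x => ?_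
  rcases le_or_gt x 0 with hx | hx
  · simp [hs.iter_eq_zero j hx]
  · exact mul_le_mul_left (hfg x hx) _

/-- The growth of the moment of order `λ` in one step is linear in that moment: the coefficient
involves only the conserved moments of order `0` and `1`. -/
theorem far_moment_step (hs : StableScheme k θ α lam C h u₀) (j : ℕ)
    (hfin : ∫⁻ x, ENNReal.ofReal (x ^ lam) * eulerIter k h u₀ j x ≠ ∞) :
    ∫⁻ x, ENNReal.ofReal (x ^ lam) * eulerIter k h u₀ (j + 1) x ≤
      (∫⁻ x, ENNReal.ofReal (x ^ lam) * eulerIter k h u₀ j x) +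
      h * (14 * ((∫⁻ x, u₀ x) + ∫⁻ x, ENNReal.ofReal x * u₀ x) *
        (∫⁻ z, ENNReal.ofReal (1 + z ^ 2) * θ z) *
        ∫⁻ x, farWeight lam x * eulerIter k h u₀ j x) := by
  have hm := hs.measurable_iter j
  have hk := hs.bounds.measurable
  have hθ := hs.bounds.measurable_theta
  let e : ℝ × ℝ × ℝ → ℝ≥0∞ := fun p =>
    7 * (ENNReal.ofReal (1 + p.2.2 ^ 2) * farWeight (lam - 2) p.1)
  have hstep := lintegral_mul_eulerStep_le hk hm hm (hs.step_rate_le j)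
    (f := fun x => ENNReal.ofReal (x ^ lam)) (by fun_prop) (e := e)
    (fun x y z hne => by
      obtain ⟨h1, h2, -⟩ := hs.bounds.supp x y z hne
      have := second_difference_weight_le hs.bounds.one_lt.le hs.bounds.le_two h1 h2
        (ω := fun _ => 1) (fun _ _ => zero_le_one) le_rfl (by norm_num) (by simp; exact h1.le)
      simpa [e] using this) hfin
  refine hstep.trans (add_le_add_right (mul_le_mul_right ?_ _) _)
  set U := eulerIter k h u₀ j
  have hs1 : Measurable fun z : ℝ => 7 * (ENNReal.ofReal (1 + z ^ 2) * θ z) := by fun_prop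
  calc collision k e U U
      ≤ ∫⁻ p : ℝ × ℝ × ℝ,
          ((farWeight lam p.1 * farWeight 1 p.2.1 *
            (7 * (ENNReal.ofReal (1 + p.2.2 ^ 2) * θ p.2.2))) * (U p.1 * U p.2.1) +
          (farWeight 1 p.1 * farWeight lam p.2.1 *
            (7 * (ENNReal.ofReal (1 + p.2.2 ^ 2) * θ p.2.2))) * (U p.1 * U p.2.1)) := by
        refine lintegral_mono fun p => ?_
        have := hs.bounds.growth_sub_two p.1 p.2.1 p.2.2
        calc e p * k p * (U p.1 * U p.2.1)
            = 7 * ENNReal.ofReal (1 + p.2.2 ^ 2) * (farWeight (lam - 2) p.1 * k p) *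
              (U p.1 * U p.2.1) := by simp only [e]; ring
          _ ≤ 7 * ENNReal.ofReal (1 + p.2.2 ^ 2) * ((farWeight lam p.1 * farWeight 1 p.2.1 +
              farWeight 1 p.1 * farWeight lam p.2.1) * θ p.2.2) * (U p.1 * U p.2.1) := by
              gcongr
          _ = _ := by ring
    _ = 2 * 7 * ((∫⁻ x, farWeight 1 x * U x) * (∫⁻ z, ENNReal.ofReal (1 + z ^ 2) * θ z) *
          ∫⁻ x, farWeight lam x * U x) := by
        rw [lintegral_add_left (by fun_prop),
          lintegral_tensor (by fun_prop) (by fun_prop) hs1 hm hm,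
          lintegral_tensor (by fun_prop) (by fun_prop) hs1 hm hm,
          lintegral_const_mul _ (by fun_prop)]
        ring
    _ ≤ 2 * 7 * (((∫⁻ x, u₀ x) + ∫⁻ x, ENNReal.ofReal x * u₀ x) *
          (∫⁻ z, ENNReal.ofReal (1 + z ^ 2) * θ z) * ∫⁻ x, farWeight lam x * U x) := by
        gcongr; exact hs.lintegral_farWeight_one_le j
    _ = _ := by
        rw [show (14 : ℝ≥0∞) = 2 * 7 by norm_num]; ring

end StableScheme

/-- The moment of order `λ` stays bounded on bounded time intervals, with a bound that depends on
the kernel only through `θ`. -/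
theorem far_moment_bound (θ : ℝ → ℝ≥0∞) {α lam : ℝ} {u₀ : ℝ → ℝ≥0∞} (hu : InitialDatum α lam u₀)
    (C : ℝ≥0) (T : ℝ) :
    ∃ B : ℝ≥0, ∀ k h, StableScheme k θ α lam C h u₀ → ∀ j : ℕ, j * (h : ℝ) ≤ T →
      ∫⁻ x, farWeight lam x * eulerIter k h u₀ j x ≤ B := by
  by_cases hex : ∃ k h, StableScheme k θ α lam C h u₀
  swap
  · exact ⟨0, fun k h hs => (hex ⟨k, h, hs⟩).elim⟩
  obtain ⟨k₁, h₁, hs₁⟩ := hex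
  have hl := hs₁.bounds.one_lt
  set K := 14 * ((∫⁻ x, u₀ x) + ∫⁻ x, ENNReal.ofReal x * u₀ x) *
        (∫⁻ z, ENNReal.ofReal (1 + z ^ 2) * θ z) with hK
  have hKtop : K ≠ ∞ := by
    have e1 := hs₁.mass_ne_top
    have e2 := hs₁.datum.first_moment_ne_top hl.le
    have e3 := hs₁.bounds.moment
    finiteness
  set B := ENNReal.ofReal (Real.exp (K.toReal * T)) *
    ((∫⁻ x, u₀ x) + ∫⁻ x, farWeight lam x * u₀ x)
  have hB : B ≠ ∞ := by
    have e1 := hs₁.mass_ne_top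
    have e2 := hs₁.datum.far
    finiteness
  refine ⟨B.toNNReal, fun k h hs j hj => ?_⟩
  rw [ENNReal.coe_toNNReal hB]
  let M : ℕ → ℝ≥0∞ := fun j => ∫⁻ x, ENNReal.ofReal (x ^ lam) * eulerIter k h u₀ j x
  have hle : ∀ j, ∫⁻ x, farWeight lam x * eulerIter k h u₀ j x ≤ (∫⁻ x, u₀ x) + M j := by
    intro j
    rw [← hs.lintegral_iter j, ← lintegral_add_left (hs.measurable_iter j)]
    refine (hs.lintegral_weight_mono j fun x _ => farWeight_le lam x).trans (le_of_eq ?_)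
    exact lintegral_congr fun x => by ring
  have hM0 : M 0 ≤ ∫⁻ x, farWeight lam x * u₀ x :=
    hs.lintegral_weight_mono 0 fun x hx => rpow_le_farWeight (by linarith) hx.le
  have hstep : ∀ j, M j ≠ ∞ → M (j + 1) ≤ M j + h * (K * ((∫⁻ x, u₀ x) + M j)) := fun j hj =>
    (hs.far_moment_step j hj).trans
      (add_le_add_right (mul_le_mul_right (mul_le_mul_right (hle j) _) _) _)
  have hMfin : ∀ j, M j ≠ ∞ := by
    intro j
    induction j with
    | zero => exact ne_top_of_le_ne_top hu.far hM0
    | succ j ih =>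
      have e1 := hs.mass_ne_top
      exact ne_top_of_le_ne_top (by finiteness) (hstep j ih)
  refine (hle j).trans ?_
  have := discrete_gronwall (a := fun j => (∫⁻ x, u₀ x) + M j) (h := h) hKtop (J := j)
    (fun i _ => by
      calc (∫⁻ x, u₀ x) + M (i + 1) ≤ (∫⁻ x, u₀ x) + (M i + h * (K * ((∫⁻ x, u₀ x) + M i))) :=
            add_le_add_right (hstep i (hMfin i)) _
        _ = _ := by ring) hj le_rfl
  exact this.trans (mul_le_mul_right (add_le_add_right hM0 _) _)

/-! ### Singular moment, tails and uniform integrability -/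

/-- A bound that is only needed when there is a stable scheme may be proved in the presence of
the facts common to all of them. -/
theorem exists_bound_of_scheme {θ : ℝ → ℝ≥0∞} {α lam : ℝ} {C : ℝ≥0} {u₀ : ℝ → ℝ≥0∞}
    {β : Type*} [Nonempty β] {P : (ℝ × ℝ × ℝ → ℝ≥0∞) → ℝ≥0 → β → Prop}
    (h : ∀ k₁ h₁, StableScheme k₁ θ α lam C h₁ u₀ →
      ∃ b, ∀ k h, StableScheme k θ α lam C h u₀ → P k h b) :
    ∃ b, ∀ k h, StableScheme k θ α lam C h u₀ → P k h b := by
  by_cases hex : ∃ k h, StableScheme k θ α lam C h u₀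
  · obtain ⟨k₁, h₁, hs₁⟩ := hex
    exact h k₁ h₁ hs₁
  · exact ⟨Classical.arbitrary β, fun k h hs => (hex ⟨k, h, hs⟩).elim⟩

theorem StableScheme.collision_le_sq {k : ℝ × ℝ × ℝ → ℝ≥0∞} {θ : ℝ → ℝ≥0∞} {α lam : ℝ} {C h : ℝ≥0}
    {u₀ : ℝ → ℝ≥0∞} (hs : StableScheme k θ α lam C h u₀) (j : ℕ) :
    collision k (fun _ => 1) (eulerIter k h u₀ j) (eulerIter k h u₀ j) ≤
      (∫⁻ x, farWeight lam x * eulerIter k h u₀ j x) *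
      (∫⁻ x, farWeight lam x * eulerIter k h u₀ j x) * ∫⁻ z, θ z :=
  collision_le (by fun_prop) (by fun_prop) hs.bounds.measurable_theta (hs.measurable_iter j)
    (hs.measurable_iter j) fun p => by
      rw [one_mul]; exact hs.bounds.growth p.1 p.2.1 p.2.2

theorem nearWeight_anti {α x y : ℝ} (hα : 0 ≤ α) (hx : 0 < x) (hxy : x ≤ y) :
    nearWeight α y ≤ nearWeight α x := by
  refine ENNReal.ofReal_le_ofReal ?_
  exact Real.rpow_le_rpow_of_nonpos (lt_min one_pos hx) (min_le_min_left _ hxy) (by linarith)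

theorem farWeight_mul_nearWeight_le (α lam x : ℝ) :
    farWeight lam x * nearWeight α x ≤ nearWeight α x + farWeight lam x := by
  rcases le_total x 1 with h | h
  · have : farWeight lam x = 1 := by simp [farWeight, check, max_eq_left h]
    simp [this]
  · have : nearWeight α x = 1 := by simp [nearWeight, hat, min_eq_left h]
    simp [this]

/-- Once the moment of order `λ` is bounded, the singular moment `∫ x̂ ^ (-α) c` grows at most
exponentially. -/
theorem near_moment_bound (θ : ℝ → ℝ≥0∞) {α lam : ℝ} {u₀ : ℝ → ℝ≥0∞} (hu : InitialDatum α lam u₀)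
    (C : ℝ≥0) (T : ℝ) :
    ∃ B : ℝ≥0, ∀ k h, StableScheme k θ α lam C h u₀ → ∀ j : ℕ, j * (h : ℝ) ≤ T →
      ∫⁻ x, nearWeight α x * eulerIter k h u₀ j x ≤ B := by
  obtain ⟨B, hB⟩ := far_moment_bound θ hu C T
  refine exists_bound_of_scheme fun k₁ h₁ hs₁ => ?_
  set K := C * (B * ∫⁻ z, ENNReal.ofReal (1 + z ^ 2) * θ z)
  have hKtop : K ≠ ∞ := by
    have e3 := hs₁.bounds.moment
    finiteness
  set D := ENNReal.ofReal (Real.exp (K.toReal * T)) * ((∫⁻ x, nearWeight α x * u₀ x) + B)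
  have hD : D ≠ ∞ := by
    have e2 := hu.near
    finiteness
  refine ⟨D.toNNReal, fun k h hs j hj => ?_⟩
  rw [ENNReal.coe_toNNReal hD]
  have hα := hs.bounds.alpha_nonneg
  let M : ℕ → ℝ≥0∞ := fun j => ∫⁻ x, nearWeight α x * eulerIter k h u₀ j x
  have hBj : ∀ i < j, ∫⁻ x, farWeight lam x * eulerIter k h u₀ i x ≤ B := fun i hi =>
    hB k h hs i (le_trans (by gcongr) hj)
  have hstep : ∀ i < j, M i ≠ ∞ → M (i + 1) ≤ M i + h * (K * (M i + B)) := by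
    intro i hi hfin
    have hm := hs.measurable_iter i
    have hθ := hs.bounds.measurable_theta
    refine (lintegral_mul_eulerStep_le hs.bounds.measurable hm hm (hs.step_rate_le i)
      (measurable_nearWeight α) (e := fun p => nearWeight α (p.1 - p.2.2))
      (fun x y z hne => ?_) hfin).trans (add_le_add_right (mul_le_mul_right ?_ _) _)
    -- The weight is decreasing, so that only its value at `x - z` can make the moment grow.
    · obtain ⟨h1, h2, -⟩ := hs.bounds.supp x y z hne
      have e1 := nearWeight_anti hα (h1.trans h2) (y := x + z) (by linarith)
      refine add_le_add_left (e1.trans ?_) _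
      rw [two_mul]; exact le_self_add
    · set U := eulerIter k h u₀ i
      calc collision k (fun p => nearWeight α (p.1 - p.2.2)) U U
          ≤ (∫⁻ x, farWeight lam x * U x) *
              (∫⁻ y, (farWeight lam y * nearWeight α y) * U y) * ∫⁻ z, C * θ z := by
            refine collision_le (by fun_prop) (by fun_prop) (by fun_prop) hm hm fun p => ?_
            refine (hs.bounds.singular p.1 p.2.1 p.2.2).trans (le_of_eq ?_)
            ring
        _ ≤ B * (M i + B) * (C * ∫⁻ z, ENNReal.ofReal (1 + z ^ 2) * θ z) := by
            rw [lintegral_const_mul _ hθ]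
            refine mul_le_mul' (mul_le_mul' (hBj i hi) ?_)
              (mul_le_mul_right (lintegral_theta_le θ) _)
            · calc _ ≤ ∫⁻ y, (nearWeight α y + farWeight lam y) * U y :=
                    hs.lintegral_weight_mono i fun x _ => farWeight_mul_nearWeight_le α lam x
                _ = M i + ∫⁻ y, farWeight lam y * U y := by
                    simp_rw [add_mul]
                    rw [lintegral_add_left (by fun_prop)]
                _ ≤ _ := by gcongr; exact hBj i hi
        _ = _ := by ring
  have hMfin : ∀ i ≤ j, M i ≠ ∞ := by
    intro i
    induction i with
    | zero => intro _; exact hu.near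
    | succ i ih =>
      intro hi
      have e1 := ih (by omega)
      exact ne_top_of_le_ne_top (by finiteness) (hstep i (by omega) e1)
  have := discrete_gronwall (a := fun j => M j + B) (h := h) hKtop (J := j)
    (fun i hi => by
      calc M (i + 1) + B ≤ (M i + h * (K * (M i + B))) + B :=
            add_le_add_left (hstep i hi (hMfin i hi.le)) _
        _ = _ := by ring) hj le_rfl
  exact le_self_add.trans this

/-- Uniform smallness of the tails of the moment of order `λ`. The tail at `R` is measured with
the weight `x ^ λ · min(1, x / R)`; the second factor being concave, the moment with this weight
satisfies a linear Gronwall inequality. -/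
theorem far_tail_bound (θ : ℝ → ℝ≥0∞) {α lam : ℝ} {u₀ : ℝ → ℝ≥0∞} (hu : InitialDatum α lam u₀)
    (C : ℝ≥0) (T : ℝ) {ε : ℝ≥0∞} (hε : 0 < ε) :
    ∃ R : ℝ≥0, ∀ k h, StableScheme k θ α lam C h u₀ → ∀ j : ℕ, j * (h : ℝ) ≤ T →
      ∫⁻ x, (Ioi (R : ℝ)).indicator (farWeight lam) x * eulerIter k h u₀ j x ≤ ε := by
  obtain ⟨B, hB⟩ := far_moment_bound θ hu C T
  refine exists_bound_of_scheme fun k₁ h₁ hs₁ => ?_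
  have hl := hs₁.bounds.one_lt
  have hm0 := hs₁.mass_ne_top
  have humeas := hu.measurable
  set K := 7 * (B * ∫⁻ z, ENNReal.ofReal (1 + z ^ 2) * θ z)
  have hKtop : K ≠ ∞ := by
    have e3 := hs₁.bounds.moment
    finiteness
  let ω : ℕ → ℝ → ℝ := fun R x => min 1 (x / (R + 1))
  let ini : ℕ → ℝ≥0∞ := fun R =>
    (∫⁻ x, ENNReal.ofReal (x ^ lam * ω R x) * u₀ x) + ENNReal.ofReal (1 / (R + 1)) * ∫⁻ x, u₀ x
  have hω0 : ∀ R x, 0 < x → 0 ≤ ω R x := fun R x hx => by positivity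
  have hω1 : ∀ R x, ω R x ≤ 1 := fun R x => min_le_left _ _
  have hωmeas : ∀ R, Measurable (ω R) := fun R => by fun_prop
  have hini : Tendsto ini atTop (𝓝 0) := by
    have t1 : Tendsto (fun R : ℕ => ENNReal.ofReal (1 / ((R : ℝ) + 1)) * ∫⁻ x, u₀ x) atTop
        (𝓝 0) := by
      have : Tendsto (fun R : ℕ => ENNReal.ofReal (1 / ((R : ℝ) + 1))) atTop (𝓝 0) := by
        rw [← ENNReal.ofReal_zero]
        exact ENNReal.tendsto_ofReal tendsto_one_div_add_atTop_nhds_zero_nat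
      simpa using ENNReal.Tendsto.mul_const this (Or.inr hm0)
    have t2 : Tendsto (fun R : ℕ => ∫⁻ x, ENNReal.ofReal (x ^ lam * ω R x) * u₀ x) atTop
        (𝓝 (∫⁻ _ : ℝ, 0)) := by
      refine tendsto_lintegral_of_dominated_convergence (fun x => farWeight lam x * u₀ x)
        (fun R => by fun_prop) (fun R => Eventually.of_forall fun x => ?_) hu.far ?_
      · rcases le_or_gt x 0 with hx | hx
        · simp [hu.eq_zero x hx]
        · refine mul_le_mul_left ((ENNReal.ofReal_le_ofReal ?_).trans
            (rpow_le_farWeight (by linarith) hx.le)) _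
          have := hω1 R x
          have h2 : 0 ≤ x ^ lam := Real.rpow_nonneg hx.le _
          nlinarith
      · have hfin : ∀ᵐ x, u₀ x < ∞ := ae_lt_top humeas hm0
        filter_upwards [hfin] with x hx
        have t3 : Tendsto (fun R : ℕ => x / ((R : ℝ) + 1)) atTop (𝓝 0) := by
          have := tendsto_one_div_add_atTop_nhds_zero_nat (𝕜 := ℝ) |>.const_mul x
          simpa [div_eq_mul_inv] using this
        have t4 : Tendsto (fun R : ℕ => x ^ lam * ω R x) atTop (𝓝 0) := by
          have := (tendsto_const_nhds (x := (1 : ℝ))).min t3 |>.const_mul (x ^ lam)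
          simpa using this
        have t5 := ENNReal.Tendsto.mul_const (ENNReal.tendsto_ofReal t4) (b := u₀ x)
          (Or.inr hx.ne)
        simpa using t5
    rw [lintegral_zero] at t2
    have t3 := t2.add t1
    rw [add_zero] at t3
    exact t3
  have hexp : Tendsto (fun R => ENNReal.ofReal (Real.exp (K.toReal * T)) * ini R) atTop (𝓝 0) := by
    simpa using ENNReal.Tendsto.const_mul hini (Or.inr ENNReal.ofReal_ne_top)
  obtain ⟨R, hR⟩ := ((tendsto_order.1 hexp).2 ε hε).exists
  refine ⟨R + 1, fun k h hs j hj => ?_⟩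
  have hR0 : (0 : ℝ) < R + 1 := by positivity
  let M : ℕ → ℝ≥0∞ := fun j => ∫⁻ x, ENNReal.ofReal (x ^ lam * ω R x) * eulerIter k h u₀ j x
  -- The contribution of `x ≤ 1`, where `x̌ ^ λ · ω x` exceeds `x ^ λ · ω x`.
  set D := ENNReal.ofReal (1 / ((R : ℝ) + 1)) * ∫⁻ x, u₀ x with hD
  have hDtop : D ≠ ∞ := by finiteness
  have hBj : ∀ i < j, ∫⁻ x, farWeight lam x * eulerIter k h u₀ i x ≤ B := fun i hi =>
    hB k h hs i (le_trans (by gcongr) hj)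
  have hMtop : ∀ i, i ≤ j → M i ≠ ∞ := by
    intro i hi
    refine ne_top_of_le_ne_top (ENNReal.coe_ne_top (r := B)) (le_trans ?_
      (hB k h hs i (le_trans (by gcongr) hj)))
    refine hs.lintegral_weight_mono i fun x hx => ?_
    refine (ENNReal.ofReal_le_ofReal ?_).trans (rpow_le_farWeight (by linarith) hx.le)
    have := hω1 R x
    have h2 : 0 ≤ x ^ lam := Real.rpow_nonneg hx.le _
    nlinarith
  have hstep : ∀ i < j, M (i + 1) ≤ M i + h * (K * (M i + D)) := by
    intro i hi
    have hm := hs.measurable_iter i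
    have hθ := hs.bounds.measurable_theta
    refine (lintegral_mul_eulerStep_le hs.bounds.measurable hm hm (hs.step_rate_le i)
      (f := fun x => ENNReal.ofReal (x ^ lam * ω R x)) (by fun_prop)
      (e := fun p => 7 * (ENNReal.ofReal (1 + p.2.2 ^ 2) * farWeight (lam - 2) p.1 *
        ENNReal.ofReal (ω R p.1)))
      (fun x y z hne => ?_) (hMtop i hi.le)).trans (add_le_add_right (mul_le_mul_right ?_ _) _)
    · obtain ⟨h1, h2, -⟩ := hs.bounds.supp x y z hne
      have hx : 0 < x := h1.trans h2
      refine second_difference_weight_le hl.le hs.bounds.le_two h1 h2 (hω0 R) ?_ ?_ ?_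
      · exact min_le_min_left _ (by gcongr; linarith)
      · have hsum : (x + z) / ((R : ℝ) + 1) + (x - z) / (R + 1) = 2 * (x / (R + 1)) := by ring
        have e1 := min_le_left 1 ((x + z) / ((R : ℝ) + 1))
        have e2 := min_le_right 1 ((x + z) / ((R : ℝ) + 1))
        have e3 := min_le_left 1 ((x - z) / ((R : ℝ) + 1))
        have e4 := min_le_right 1 ((x - z) / ((R : ℝ) + 1))
        simp only [ω]
        rcases min_cases 1 (x / ((R : ℝ) + 1)) with h | h <;> linarith
      -- Concavity between `0`, `x - z` and `x`.
      · have e1 : x * ω R (x - z) ≥ (x - z) * ω R x := by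
          simp only [ω]
          rw [mul_min_of_nonneg _ _ hx.le, ge_iff_le]
          refine le_min ?_ ?_
          · have : min 1 (x / ((R : ℝ) + 1)) ≤ 1 := min_le_left _ _
            nlinarith
          · have : min 1 (x / ((R : ℝ) + 1)) ≤ x / (R + 1) := min_le_right _ _
            calc (x - z) * min 1 (x / ((R : ℝ) + 1)) ≤ (x - z) * (x / (R + 1)) := by
                  apply mul_le_mul_of_nonneg_left this; linarith
              _ = _ := by ring
        linarith
    · set U := eulerIter k h u₀ i
      have hs1 : Measurable fun z : ℝ => 7 * (ENNReal.ofReal (1 + z ^ 2) * θ z) := by fun_prop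
      calc _ ≤ (∫⁻ x, (farWeight lam x * ENNReal.ofReal (ω R x)) * U x) *
              (∫⁻ y, farWeight lam y * U y) *
              ∫⁻ z, 7 * (ENNReal.ofReal (1 + z ^ 2) * θ z) := by
            refine collision_le (by fun_prop) (by fun_prop) hs1 hm hm fun p => ?_
            have e1 : farWeight (lam - 2) p.1 ≤ 1 := by
              rw [← farWeight_zero p.1]
              exact farWeight_mono (by linarith [hs.bounds.le_two]) _
            calc _ = 7 * ENNReal.ofReal (1 + p.2.2 ^ 2) * ENNReal.ofReal (ω R p.1) *
                    (farWeight (lam - 2) p.1 * k p) := by ring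
              _ ≤ 7 * ENNReal.ofReal (1 + p.2.2 ^ 2) * ENNReal.ofReal (ω R p.1) *
                    (1 * (farWeight lam p.1 * farWeight lam p.2.1 * θ p.2.2)) := by
                  gcongr; exact hs.bounds.growth p.1 p.2.1 p.2.2
              _ = _ := by ring
        _ ≤ (M i + D) * B * (7 * ∫⁻ z, ENNReal.ofReal (1 + z ^ 2) * θ z) := by
            rw [lintegral_const_mul _ (by fun_prop)]
            gcongr
            · rw [hD, ← hs.lintegral_iter i, ← lintegral_const_mul _ hm,
                ← lintegral_add_left (by
                  have : Measurable fun x => ENNReal.ofReal (x ^ lam * ω R x) := by fun_prop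
                  exact this.mul hm)]
              calc _ ≤ ∫⁻ x, (ENNReal.ofReal (x ^ lam * ω R x) +
                      ENNReal.ofReal (1 / ((R : ℝ) + 1))) * U x := by
                    refine hs.lintegral_weight_mono i fun x hx => ?_
                    rcases le_total x 1 with h1 | h1
                    · have e1 : farWeight lam x = 1 := by simp [farWeight, check, max_eq_left h1]
                      rw [e1, one_mul]
                      refine le_add_left (ENNReal.ofReal_le_ofReal ((min_le_right _ _).trans ?_))
                      gcongr
                    · refine le_add_right (le_of_eq ?_)
                      rw [farWeight, check, max_eq_right h1,
                        ← ENNReal.ofReal_mul (Real.rpow_nonneg hx.le _)]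
                _ = _ := lintegral_congr fun x => by ring
            · exact hBj i hi
        _ = _ := by ring
  have hgr := discrete_gronwall (a := fun j => M j + D) (h := h) hKtop (J := j)
    (fun i hi => by
      calc M (i + 1) + D ≤ (M i + h * (K * (M i + D))) + D :=
            add_le_add_left (hstep i hi) _
        _ = _ := by ring) hj le_rfl
  calc _ ≤ M j := by
        refine hs.lintegral_weight_mono j fun x hx => ?_
        rw [indicator_apply]
        split_ifs with hxR
        · have hxR' : (R : ℝ) + 1 < x := by simpa using hxR
          have h1 : 1 ≤ x := by
            have : (0 : ℝ) ≤ R := by positivity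
            linarith
          have h2 : ω R x = 1 := min_eq_left ((one_le_div hR0).2 hxR'.le)
          rw [h2, mul_one, farWeight, check, max_eq_right h1]
        · exact zero_le
    _ ≤ M j + D := le_self_add
    _ ≤ ENNReal.ofReal (Real.exp (K.toReal * T)) * ini R := hgr
    _ ≤ ε := hR.le

/-- Uniform integrability. The scheme is linear in the transported density once the environment
is given, so that a decomposition of the initial datum into a bounded part and a part of small
mass persists: the mass of the latter is conserved, the supremum of the former grows at most
exponentially, by the one-sided bound on the second differences of the kernel. -/
theorem uniform_integrability (θ : ℝ → ℝ≥0∞) {α lam : ℝ} {u₀ : ℝ → ℝ≥0∞}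
    (hu : InitialDatum α lam u₀) (C : ℝ≥0) (T : ℝ) {ε : ℝ≥0∞} (hε : 0 < ε) :
    ∃ R : ℝ≥0, ∀ k h, StableScheme k θ α lam C h u₀ → ∀ j : ℕ, j * (h : ℝ) ≤ T →
      ∃ g : ℝ → ℝ≥0∞, Measurable g ∧ (∀ x, eulerIter k h u₀ j x ≤ R + g x) ∧ ∫⁻ x, g x ≤ ε := by
  obtain ⟨B, hB⟩ := far_moment_bound θ hu C T
  refine exists_bound_of_scheme fun k₁ h₁ hs₁ => ?_
  have hm0 := hs₁.mass_ne_top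
  have humeas := hu.measurable
  set K := B * ∫⁻ z, ENNReal.ofReal (1 + z ^ 2) * θ z
  have hKtop : K ≠ ∞ := by
    have e3 := hs₁.bounds.moment
    finiteness
  have ht : Tendsto (fun n : ℕ => ∫⁻ x, (u₀ x - n)) atTop (𝓝 (∫⁻ _ : ℝ, 0)) := by
    refine tendsto_lintegral_of_dominated_convergence u₀ (fun n => by fun_prop)
      (fun n => Eventually.of_forall fun x => tsub_le_self) hm0 ?_
    filter_upwards [ae_lt_top humeas hm0] with x hx
    obtain ⟨N, hN⟩ := ENNReal.exists_nat_gt hx.ne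
    refine tendsto_const_nhds.congr' ?_
    filter_upwards [eventually_ge_atTop N] with n hn
    rw [eq_comm, tsub_eq_zero_iff_le]
    exact hN.le.trans (by exact_mod_cast hn)
  rw [lintegral_zero] at ht
  obtain ⟨n, hn⟩ := ((tendsto_order.1 ht).2 ε hε).exists
  let v₀ : ℝ → ℝ≥0∞ := fun x => min (u₀ x) n
  let g₀ : ℝ → ℝ≥0∞ := fun x => u₀ x - n
  have hv : Measurable v₀ := by fun_prop
  have hg : Measurable g₀ := by fun_prop
  have hsplit : ∀ x, u₀ x = v₀ x + g₀ x := fun x => by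
    simp only [v₀, g₀]
    rcases le_total (u₀ x) n with h | h
    · rw [min_eq_left h, tsub_eq_zero_of_le h, add_zero]
    · rw [min_eq_right h, add_tsub_cancel_of_le h]
  set R := ENNReal.ofReal (Real.exp (K.toReal * T)) * n
  have hR : R ≠ ∞ := by finiteness
  refine ⟨R.toNNReal, fun k h hs j hj => ⟨eulerTransport k h u₀ g₀ j,
    measurable_eulerTransport hs.bounds.measurable humeas hg j, fun x => ?_, ?_⟩⟩
  · rw [eulerIter_eq_add_transport hs.bounds.measurable humeas hv hsplit,
      ENNReal.coe_toNNReal hR]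
    refine add_le_add_left ?_ _
    have hgr := discrete_gronwall (a := fun i => (1 + h * K) ^ i * n) (h := h) hKtop (J := j)
      (fun i hi => by rw [pow_succ]; exact le_of_eq (by ring)) hj le_rfl
    simp only [pow_zero, one_mul] at hgr
    refine le_trans ?_ hgr
    have : ∀ i ≤ j, ∀ x, eulerTransport k h u₀ v₀ i x ≤ (1 + h * K) ^ i * n := by
      intro i
      induction i with
      | zero => intro _ x; rw [pow_zero, one_mul]; exact min_le_right _ _
      | succ i ih =>
        intro hi x
        have hθ := hs.bounds.measurable_theta
        have := eulerStep_le_const hs.bounds.measurable (hs.measurable_iter i)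
          (hs.step_rate_le i) (b := farWeight lam) (s := fun z => ENNReal.ofReal (z ^ 2) * θ z)
          (by fun_prop) (by fun_prop) (fun x y z => by
            refine (hs.bounds.second_difference x y z).trans (le_of_eq (by ring)))
          (ih (by omega)) x
        refine this.trans ?_
        rw [pow_succ' _ i, mul_assoc]
        refine mul_le_mul_left (add_le_add_right (mul_le_mul_right (mul_le_mul' ?_ ?_) _) _) _
        · exact hB k h hs i (le_trans (by gcongr; omega) hj)
        · exact lintegral_sq_mul_theta_le θ
    exact this j le_rfl x
  · rw [hs.lintegral_transport hg (ne_top_of_le_ne_top hm0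
      (lintegral_mono fun x => tsub_le_self))]
    exact hn.le

/-! ### Regularity in time and the weak form of the scheme -/

theorem collision_bound (θ : ℝ → ℝ≥0∞) {α lam : ℝ} {u₀ : ℝ → ℝ≥0∞}
    (hu : InitialDatum α lam u₀) (C : ℝ≥0) (T : ℝ) :
    ∃ B : ℝ≥0, ∀ k h, StableScheme k θ α lam C h u₀ → ∀ j : ℕ, j * (h : ℝ) ≤ T →
      collision k (fun _ => 1) (eulerIter k h u₀ j) (eulerIter k h u₀ j) ≤ B := by
  obtain ⟨B, hB⟩ := far_moment_bound θ hu C T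
  refine exists_bound_of_scheme fun k₁ h₁ hs₁ => ?_
  have hθ : ∫⁻ z, θ z ≠ ∞ := ne_top_of_le_ne_top hs₁.bounds.moment (lintegral_theta_le θ)
  refine ⟨B * B * (∫⁻ z, θ z).toNNReal, fun k h hs j hj => (hs.collision_le_sq j).trans ?_⟩
  push_cast
  rw [ENNReal.coe_toNNReal hθ]
  have := hB k h hs j hj
  gcongr

namespace StableScheme

variable {k : ℝ × ℝ × ℝ → ℝ≥0∞} {θ : ℝ → ℝ≥0∞} {α lam : ℝ} {C h : ℝ≥0} {u₀ : ℝ → ℝ≥0∞}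

/-- Mass gained and lost in one step. -/
theorem exists_step_difference (hs : StableScheme k θ α lam C h u₀) (j : ℕ) :
    ∃ g l : ℝ → ℝ≥0∞, Measurable g ∧ Measurable l ∧
      (∀ x, eulerIter k h u₀ (j + 1) x ≤ eulerIter k h u₀ j x + g x) ∧
      (∀ x, eulerIter k h u₀ j x ≤ eulerIter k h u₀ (j + 1) x + l x) ∧
      ∫⁻ x, g x = h * (2 * collision k (fun _ => 1) (eulerIter k h u₀ j) (eulerIter k h u₀ j)) ∧
      ∫⁻ x, l x = h * (2 * collision k (fun _ => 1) (eulerIter k h u₀ j) (eulerIter k h u₀ j)) := by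
  set U := eulerIter k h u₀ j with hU
  have hm : Measurable U := hs.measurable_iter j
  have hk := hs.bounds.measurable
  have hr := measurable_rate hk hm
  let g : ℝ → ℝ≥0∞ := fun x =>
    h * ∫⁻ q : ℝ × ℝ, (k (x - q.2, q) * U (x - q.2) + k (x + q.2, q) * U (x + q.2)) * U q.1
  let l : ℝ → ℝ≥0∞ := fun x => 2 * h * rate k U x * U x
  have hg : Measurable g := Measurable.const_mul (Measurable.lintegral_prod_right'
    (f := fun p : ℝ × ℝ × ℝ => (k (p.1 - p.2.2, p.2) * U (p.1 - p.2.2) +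
      k (p.1 + p.2.2, p.2) * U (p.1 + p.2.2)) * U p.2.1) (by fun_prop)) _
  have hl : Measurable l := by fun_prop
  have hstep : ∀ x, eulerIter k h u₀ (j + 1) x = (1 - 2 * h * rate k U x) * U x + g x :=
    fun x => rfl
  have hkeep : ∀ x, U x = (1 - 2 * h * rate k U x) * U x + l x := fun x => by
    simp only [l]
    rw [← add_mul, tsub_add_cancel_of_le (hs.step_rate_le j x), one_mul]
  have hlint : ∫⁻ x, l x = h * (2 * collision k (fun _ => 1) U U) := by
    rw [← lintegral_mul_rate hk hm hm (f := fun _ => 1) measurable_const,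
      ← lintegral_const_mul _ (by fun_prop), ← lintegral_const_mul _ (by fun_prop)]
    exact lintegral_congr fun x => by simp only [l]; ring
  have hkm : Measurable fun x => (1 - 2 * h * rate k U x) * U x := by fun_prop
  have hgl : ∫⁻ x, g x = ∫⁻ x, l x := by
    have e1 : (∫⁻ x, (1 - 2 * h * rate k U x) * U x) + ∫⁻ x, g x = ∫⁻ x, u₀ x := by
      rw [← lintegral_add_left hkm, ← hs.lintegral_iter (j + 1)]
      exact lintegral_congr fun x => (hstep x).symm
    have e2 : (∫⁻ x, (1 - 2 * h * rate k U x) * U x) + ∫⁻ x, l x = ∫⁻ x, u₀ x := by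
      rw [← lintegral_add_left hkm, ← hs.lintegral_iter j]
      exact lintegral_congr fun x => (hkeep x).symm
    have hfin : ∫⁻ x, (1 - 2 * h * rate k U x) * U x ≠ ∞ :=
      ne_top_of_le_ne_top hs.mass_ne_top (e1 ▸ le_self_add)
    exact (ENNReal.add_right_inj hfin).1 (e1.trans e2.symm)
  refine ⟨g, l, hg, hl, fun x => ?_, fun x => ?_, hgl.trans hlint, hlint⟩
  · rw [hstep]
    refine add_le_add_left ?_ _
    conv_rhs => rw [hkeep x]
    exact le_self_add
  · rw [hstep]
    conv_lhs => rw [hkeep x]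
    exact add_le_add_left le_self_add _

theorem exists_difference_of_le (hs : StableScheme k θ α lam C h u₀) {B : ℝ≥0} (i d : ℕ)
    (hB : ∀ j < i + d, collision k (fun _ => 1) (eulerIter k h u₀ j) (eulerIter k h u₀ j) ≤ B) :
    ∃ g l : ℝ → ℝ≥0∞, Measurable g ∧ Measurable l ∧
      (∀ x, eulerIter k h u₀ (i + d) x ≤ eulerIter k h u₀ i x + g x) ∧
      (∀ x, eulerIter k h u₀ i x ≤ eulerIter k h u₀ (i + d) x + l x) ∧
      ∫⁻ x, g x ≤ d * h * (2 * B) ∧ ∫⁻ x, l x ≤ d * h * (2 * B) := by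
  induction d with
  | zero => exact ⟨0, 0, measurable_zero, measurable_zero, by simp, by simp, by simp, by simp⟩
  | succ d ih =>
    obtain ⟨g, l, hg, hl, h1, h2, h3, h4⟩ := ih fun j hj => hB j (by omega)
    obtain ⟨g', l', hg', hl', h1', h2', h3', h4'⟩ := hs.exists_step_difference (i + d)
    have hb := hB (i + d) (by omega)
    have hh : h * (2 * collision k (fun _ => 1) (eulerIter k h u₀ (i + d))
        (eulerIter k h u₀ (i + d))) ≤ h * (2 * B) := by gcongr
    refine ⟨fun x => g x + g' x, fun x => l x + l' x, hg.add hg', hl.add hl', fun x => ?_,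
      fun x => ?_, ?_, ?_⟩
    · rw [← add_assoc, ← add_assoc]
      exact (h1' x).trans (add_le_add_left (h1 x) _)
    · change _ ≤ _ + (l x + l' x)
      rw [← add_assoc i d 1, add_comm (l x), ← add_assoc]
      exact (h2 x).trans (add_le_add_left (h2' x) _)
    · rw [lintegral_add_left hg, h3']
      refine (add_le_add h3 hh).trans (le_of_eq ?_)
      push_cast; ring
    · rw [lintegral_add_left hl, h4']
      refine (add_le_add h4 hh).trans (le_of_eq ?_)
      push_cast; ring

end StableScheme

/-! ### Piecewise constant interpolation in time -/

/-- The Euler scheme as a piecewise constant function of time. -/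
noncomputable def eulerPath (k : ℝ × ℝ × ℝ → ℝ≥0∞) (h : ℝ≥0) (u₀ : ℝ → ℝ≥0∞) (t : ℝ) :
    ℝ → ℝ≥0∞ :=
  eulerIter k h u₀ ⌊t / h⌋₊

theorem floor_mul_le {h : ℝ≥0} (hh : 0 < h) {t : ℝ} (ht : 0 ≤ t) : (⌊t / h⌋₊ : ℝ) * h ≤ t := by
  have hh' : (0 : ℝ) < h := hh
  have := Nat.floor_le (a := t / h) (by positivity)
  rwa [le_div_iff₀ hh'] at this

theorem lt_floor_mul_add {h : ℝ≥0} (hh : 0 < h) (t : ℝ) :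
    t < (⌊t / h⌋₊ : ℝ) * h + h := by
  have hh' : (0 : ℝ) < h := hh
  have := Nat.lt_floor_add_one (t / h)
  rw [div_lt_iff₀ hh'] at this
  linarith

/-- Uniform Lipschitz continuity in `L¹`, up to one time step. -/
theorem eulerPath_lipschitz (θ : ℝ → ℝ≥0∞) {α lam : ℝ} {u₀ : ℝ → ℝ≥0∞}
    (hu : InitialDatum α lam u₀) (C : ℝ≥0) (T : ℝ) :
    ∃ L : ℝ≥0, ∀ k h, StableScheme k θ α lam C h u₀ → 0 < h → ∀ s ∈ Icc 0 T, ∀ t ∈ Icc 0 T,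
      ∃ l : ℝ → ℝ≥0∞, Measurable l ∧
        (∀ x, eulerPath k h u₀ t x ≤ eulerPath k h u₀ s x + l x) ∧
        ∫⁻ x, l x ≤ L * (ENNReal.ofReal |t - s| + h) := by
  obtain ⟨B, hB⟩ := collision_bound θ hu C T
  refine ⟨2 * B, fun k h hs hh s hsT t htT => ?_⟩
  have hh' : (0 : ℝ) < h := hh
  have hcoll : ∀ r ∈ Icc 0 T, ∀ j < ⌊r / h⌋₊,
      collision k (fun _ => 1) (eulerIter k h u₀ j) (eulerIter k h u₀ j) ≤ B := by
    intro r hr j hj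
    refine hB k h hs j (le_trans ?_ ((floor_mul_le hh hr.1).trans hr.2))
    gcongr
  have hd : ∀ a b : ℝ, 0 ≤ a → 0 ≤ b → ∀ d : ℕ, ⌊b / h⌋₊ = ⌊a / h⌋₊ + d →
      (d : ℝ≥0∞) * h * (2 * B) ≤ (2 * B : ℝ≥0) * (ENNReal.ofReal |b - a| + h) := by
    intro a b ha hb d hd
    have h1 := floor_mul_le hh hb
    have h2 := lt_floor_mul_add hh a
    have h3 : (⌊b / h⌋₊ : ℝ) = ⌊a / h⌋₊ + d := by exact_mod_cast hd
    rw [h3] at h1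
    have h4 : (d : ℝ) * h ≤ |b - a| + h := by
      have := le_abs_self (b - a)
      linarith
    have h5 : (d : ℝ≥0∞) * h ≤ ENNReal.ofReal |b - a| + h := by
      have := ENNReal.ofReal_le_ofReal h4
      rwa [ENNReal.ofReal_add (abs_nonneg _) hh'.le, ENNReal.ofReal_mul (by positivity),
        ENNReal.ofReal_natCast, ENNReal.ofReal_coe_nnreal] at this
    rw [mul_comm]
    push_cast
    gcongr
  rcases le_total ⌊s / h⌋₊ ⌊t / h⌋₊ with hle | hle
  · obtain ⟨d, hd'⟩ := Nat.exists_eq_add_of_le hle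
    obtain ⟨g, l, hg, hl, h1, h2, h3, h4⟩ := hs.exists_difference_of_le (B := B) ⌊s / h⌋₊ d
      (by rw [← hd']; exact hcoll t htT)
    refine ⟨g, hg, fun x => ?_, h3.trans (hd s t hsT.1 htT.1 d hd')⟩
    have := h1 x
    rwa [← hd'] at this
  · obtain ⟨d, hd'⟩ := Nat.exists_eq_add_of_le hle
    obtain ⟨g, l, hg, hl, h1, h2, h3, h4⟩ := hs.exists_difference_of_le (B := B) ⌊t / h⌋₊ d
      (by rw [← hd']; exact hcoll s hsT)
    refine ⟨l, hl, fun x => ?_, h4.trans ?_⟩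
    · have := h2 x
      rwa [← hd'] at this
    · rw [abs_sub_comm]
      exact hd t s htT.1 hsT.1 d hd'

/-- Weak form of the scheme after `j` steps. -/
theorem StableScheme.weak_form {k : ℝ × ℝ × ℝ → ℝ≥0∞} {θ : ℝ → ℝ≥0∞} {α lam : ℝ} {C h : ℝ≥0}
    {u₀ : ℝ → ℝ≥0∞} (hs : StableScheme k θ α lam C h u₀) {f : ℝ → ℝ≥0∞} (hf : Measurable f)
    (j : ℕ) :
    (∫⁻ x, f x * eulerIter k h u₀ j x) + h * ∑ i ∈ Finset.range j,
        collision k (fun p => 2 * f p.1) (eulerIter k h u₀ i) (eulerIter k h u₀ i) =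
      (∫⁻ x, f x * u₀ x) + h * ∑ i ∈ Finset.range j,
        collision k (fun p => f (p.1 + p.2.2) + f (p.1 - p.2.2)) (eulerIter k h u₀ i)
          (eulerIter k h u₀ i) := by
  induction j with
  | zero => simp [eulerIter]
  | succ j ih =>
    have hm := hs.measurable_iter j
    have hid := lintegral_mul_eulerStep hs.bounds.measurable hm hm (hs.step_rate_le j) hf
    rw [Finset.sum_range_succ, Finset.sum_range_succ, mul_add, mul_add, ← add_assoc, ← add_assoc,
      ← ih, add_right_comm]
    change (∫⁻ x, f x * eulerStep k h _ _ x) + _ + _ = _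
    rw [hid]
    ring

/-! ### Passing to the limit: auxiliary facts -/

theorem tendsto_of_approx {ι : Type*} {l : Filter ι} {a : ι → ℝ≥0∞} {A : ℝ≥0∞} (hA : A ≠ ∞)
    (h : ∀ ε : ℝ≥0∞, 0 < ε → ∃ (a' : ι → ℝ≥0∞) (A' : ℝ≥0∞), Tendsto a' l (𝓝 A') ∧
      (∀ᶠ i in l, a' i ≤ a i ∧ a i ≤ a' i + ε) ∧ A' ≤ A ∧ A ≤ A' + ε) :
    Tendsto a l (𝓝 A) := by
  rw [ENNReal.tendsto_nhds hA]
  intro ε hε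
  have hε2 := ENNReal.half_pos hε.ne'
  obtain ⟨a', A', ht, hi, h1, h2⟩ := h (ε / 2) hε2
  have hA' : A' ≠ ∞ := ne_top_of_le_ne_top hA h1
  filter_upwards [(ENNReal.tendsto_nhds hA').1 ht (ε / 2) hε2, hi] with i h3 h4
  constructor
  · rw [tsub_le_iff_right]
    have h5 := h3.1
    rw [tsub_le_iff_right] at h5
    calc A ≤ A' + ε / 2 := h2
      _ ≤ (a' i + ε / 2) + ε / 2 := by gcongr
      _ = a' i + ε := by rw [add_assoc, ENNReal.add_halves]
      _ ≤ a i + ε := by gcongr; exact h4.1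
  · calc a i ≤ a' i + ε / 2 := h4.2
      _ ≤ (A' + ε / 2) + ε / 2 := by gcongr; exact h3.2
      _ = A' + ε := by rw [add_assoc, ENNReal.add_halves]
      _ ≤ A + ε := by gcongr

/-- Time integrals and limits along an arbitrary filter may be interchanged for asymptotically
equicontinuous functions. (Dominated convergence is not available along ultrafilters.) -/
theorem tendsto_intervalIntegral_of_equicontinuous {ι : Type*} {l : Filter ι} [l.NeBot]
    {g : ι → ℝ → ℝ} {G : ℝ → ℝ} {T : ℝ} (hT : 0 ≤ T)
    (hint : ∀ n, IntervalIntegrable (g n) volume 0 T)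
    (hpt : ∀ s ∈ Icc 0 T, Tendsto (fun n => g n s) l (𝓝 (G s)))
    (heq : ∀ ε > 0, ∃ δ > 0, ∀ᶠ n in l, ∀ s ∈ Icc 0 T, ∀ t ∈ Icc 0 T, |t - s| < δ →
      |g n t - g n s| ≤ ε) :
    ContinuousOn G (Icc 0 T) ∧
      Tendsto (fun n => ∫ s in (0 : ℝ)..T, g n s) l (𝓝 (∫ s in (0 : ℝ)..T, G s)) := by
  have hG : ∀ ε > 0, ∃ δ > 0, ∀ s ∈ Icc 0 T, ∀ t ∈ Icc 0 T, |t - s| < δ → |G t - G s| ≤ ε := by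
    intro ε hε
    obtain ⟨δ, hδ, h⟩ := heq ε hε
    refine ⟨δ, hδ, fun s hs t ht hst => ?_⟩
    exact le_of_tendsto ((hpt t ht).sub (hpt s hs)).abs (h.mono fun n hn => hn s hs t ht hst)
  have hcont : ContinuousOn G (Icc 0 T) := by
    intro s hs
    rw [Metric.continuousWithinAt_iff]
    intro ε hε
    obtain ⟨δ, hδ, h⟩ := hG (ε / 2) (by positivity)
    refine ⟨δ, hδ, fun t ht hst => ?_⟩
    rw [Real.dist_eq] at hst ⊢
    linarith [h s hs t ht hst]
  refine ⟨hcont, ?_⟩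
  have hGint : IntervalIntegrable G volume 0 T := by
    apply ContinuousOn.intervalIntegrable
    rwa [uIcc_of_le hT]
  have hunif : ∀ ε > 0, ∀ᶠ n in l, ∀ s ∈ Icc 0 T, |g n s - G s| ≤ ε := by
    intro ε hε
    obtain ⟨δ₁, hδ₁, h1⟩ := heq (ε / 3) (by positivity)
    obtain ⟨δ₂, hδ₂, h2⟩ := hG (ε / 3) (by positivity)
    obtain ⟨F, hFs, hF, hcov⟩ := finite_cover_balls_of_compact (isCompact_Icc (a := (0 : ℝ)) (b := T))
      (lt_min hδ₁ hδ₂)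
    have h3 : ∀ᶠ n in l, ∀ r ∈ F, |g n r - G r| ≤ ε / 3 := by
      rw [eventually_all_finite hF]
      intro r hr
      have := (Metric.tendsto_nhds.1 (hpt r (hFs hr))) (ε / 3) (by positivity)
      filter_upwards [this] with n hn
      rw [Real.dist_eq] at hn
      exact hn.le
    filter_upwards [h1, h3] with n hn1 hn3 s hs
    obtain ⟨r, hr, hsr⟩ := mem_iUnion₂.1 (hcov hs)
    rw [Metric.mem_ball, Real.dist_eq] at hsr
    have e1 := hn1 r (hFs hr) s hs (hsr.trans_le (min_le_left _ _))
    have e2 := h2 r (hFs hr) s hs (hsr.trans_le (min_le_right _ _))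
    have e3 := hn3 r hr
    rw [abs_le] at *
    constructor <;> linarith
  rw [Metric.tendsto_nhds]
  intro ε hε
  filter_upwards [hunif (ε / (T + 1)) (by positivity)] with n hn
  rw [Real.dist_eq, ← intervalIntegral.integral_sub (hint n) hGint]
  have := intervalIntegral.norm_integral_le_of_norm_le_const (a := 0) (b := T)
    (f := fun s => g n s - G s) (C := ε / (T + 1)) (fun s hs => by
      rw [uIoc_of_le hT] at hs
      exact hn s ⟨hs.1.le, hs.2⟩)
  rw [Real.norm_eq_abs, sub_zero, abs_of_nonneg hT] at this
  refine this.trans_lt ?_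
  rw [div_mul_eq_mul_div, div_lt_iff₀ (by positivity)]
  nlinarith

/-- The integral of a piecewise constant function over full time steps. -/
theorem intervalIntegral_floor {h : ℝ≥0} (hh : 0 < h) (a : ℕ → ℝ) (j : ℕ) :
    ∫ s in (0 : ℝ)..(j * (h : ℝ)), a ⌊s / h⌋₊ = h * ∑ i ∈ Finset.range j, a i := by
  have hh' : (0 : ℝ) < h := hh
  have hae : ∀ i : ℕ, ∀ᵐ s, s ∈ uIoc (i * (h : ℝ)) ((i + 1 : ℕ) * (h : ℝ)) →
      a i = a ⌊s / h⌋₊ := by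
    intro i
    have hne : ∀ᵐ s : ℝ, s ≠ (i + 1 : ℕ) * (h : ℝ) := by
      simp [ae_iff]
    filter_upwards [hne] with s hs hmem
    have hle : (i : ℝ) * h ≤ (i + 1 : ℕ) * (h : ℝ) := by gcongr; simp
    rw [uIoc_of_le hle] at hmem
    have : ⌊s / h⌋₊ = i := by
      rw [Nat.floor_eq_iff (div_nonneg (le_trans (by positivity) hmem.1.le) hh'.le),
        le_div_iff₀ hh', div_lt_iff₀ hh']
      refine ⟨hmem.1.le, ?_⟩
      have := lt_of_le_of_ne hmem.2 hs
      push_cast at this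
      exact this
    rw [this]
  have hI : ∀ i : ℕ, IntervalIntegrable (fun s : ℝ => a ⌊s / h⌋₊) volume
      (i * (h : ℝ)) ((i + 1 : ℕ) * (h : ℝ)) := fun i =>
    (intervalIntegrable_const (c := a i)).congr_ae
      ((ae_restrict_iff' measurableSet_uIoc).2 (hae i))
  have hsum := intervalIntegral.sum_integral_adjacent_intervals (f := fun s : ℝ => a ⌊s / h⌋₊)
    (μ := volume) (a := fun i : ℕ => (i : ℝ) * h) (n := j) fun i _ => hI i
  simp only [Nat.cast_zero, zero_mul] at hsum
  rw [← hsum, Finset.mul_sum]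
  refine Finset.sum_congr rfl fun i _ => ?_
  rw [← intervalIntegral.integral_congr_ae (hae i), intervalIntegral.integral_const]
  push_cast
  rw [smul_eq_mul]; ring

theorem collision_eq_lintegral_prod {k G : ℝ × ℝ × ℝ → ℝ≥0∞} (hk : Measurable k)
    (hG : Measurable G) {u : ℝ → ℝ≥0∞} (hu : Measurable u) :
    collision k G u u = ∫⁻ p : ℝ × ℝ, (∫⁻ z, G (p.1, p.2, z) * k (p.1, p.2, z))
      ∂((volume.withDensity u).prod (volume.withDensity u)) := by
  have hm : Measurable fun p : ℝ × ℝ => ∫⁻ z, G (p.1, p.2, z) * k (p.1, p.2, z) :=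
    Measurable.lintegral_prod_right'
      (f := fun q : (ℝ × ℝ) × ℝ => G (q.1.1, q.1.2, q.2) * k (q.1.1, q.1.2, q.2)) (by fun_prop)
  rw [prod_withDensity hu hu, lintegral_withDensity_eq_lintegral_mul _ (by fun_prop) hm,
    lintegral_prod _ (by fun_prop), collision, Measure.volume_eq_prod ℝ (ℝ × ℝ),
    lintegral_prod _ (by fun_prop)]
  refine lintegral_congr fun x => ?_
  rw [Measure.volume_eq_prod, lintegral_prod _ (by fun_prop)]
  refine lintegral_congr fun y => ?_
  simp only [Pi.mul_apply]
  rw [lintegral_mul_const _ (by fun_prop), mul_comm]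

/-! ### The approximations and their limit -/

/-- The kernel cut off at the level `n θ(z)`. -/
noncomputable def truncKernel (k : ℝ × ℝ × ℝ → ℝ≥0∞) (θ : ℝ → ℝ≥0∞) (n : ℕ) (p : ℝ × ℝ × ℝ) :
    ℝ≥0∞ :=
  min (k p) ((n : ℝ≥0) * θ p.2.2)

/-- A step length that keeps the Euler scheme for `truncKernel k θ n` positive. -/
noncomputable def stepSize (θ u₀ : ℝ → ℝ≥0∞) (n : ℕ) : ℝ≥0 :=
  1 / ((n + 1) * (1 + 2 * (∫⁻ z, θ z).toNNReal * (∫⁻ x, u₀ x).toNNReal))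

/-- The approximate solutions. -/
noncomputable def approx (k : ℝ × ℝ × ℝ → ℝ≥0∞) (θ u₀ : ℝ → ℝ≥0∞) (n : ℕ) (t : ℝ) : ℝ → ℝ≥0∞ :=
  eulerPath (truncKernel k θ n) (stepSize θ u₀ n) u₀ t

theorem stepSize_pos (θ u₀ : ℝ → ℝ≥0∞) (n : ℕ) : 0 < stepSize θ u₀ n := by
  unfold stepSize; positivity

theorem tendsto_stepSize (θ u₀ : ℝ → ℝ≥0∞) :
    Tendsto (fun n => (stepSize θ u₀ n : ℝ)) atTop (𝓝 0) := by
  have h := tendsto_one_div_add_atTop_nhds_zero_nat (𝕜 := ℝ)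
  refine squeeze_zero (fun n => NNReal.coe_nonneg _) (fun n => ?_) h
  unfold stepSize
  generalize (∫⁻ z, θ z).toNNReal = a
  generalize (∫⁻ x, u₀ x).toNNReal = m
  push_cast
  apply one_div_le_one_div_of_le (by positivity)
  have h1 : (0 : ℝ) ≤ 2 * a * m := by positivity
  have h2 : (0 : ℝ) ≤ n := by positivity
  nlinarith

section Limit

variable {k : ℝ × ℝ × ℝ → ℝ≥0∞} {θ : ℝ → ℝ≥0∞} {α lam : ℝ} {C : ℝ≥0} {u₀ : ℝ → ℝ≥0∞}

theorem stable_truncKernel (hk : KernelBounds k θ α lam C) (hu : InitialDatum α lam u₀) (n : ℕ) :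
    StableScheme (truncKernel k θ n) θ α lam C (stepSize θ u₀ n) u₀ where
  bounds := hk.truncate n
  datum := hu
  small u hum hmass x := by
    have hθ : ∫⁻ z, θ z ≠ ∞ := ne_top_of_le_ne_top hk.moment (lintegral_theta_le θ)
    have hm0 : ∫⁻ x, u₀ x ≠ ∞ := hu.mass_ne_top (by linarith [hk.one_lt])
    have hr := rate_le (k := truncKernel k θ n) hk.measurable_theta (N := n)
      (fun p => min_le_right _ _) hum x
    rw [hmass] at hr
    set Θ := (∫⁻ z, θ z).toNNReal with hΘ
    set m := (∫⁻ x, u₀ x).toNNReal with hm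
    have e1 : ∫⁻ z, θ z = Θ := (ENNReal.coe_toNNReal hθ).symm
    have e2 : ∫⁻ x, u₀ x = m := (ENNReal.coe_toNNReal hm0).symm
    rw [e1, e2] at hr
    have key : 2 * stepSize θ u₀ n * (n * Θ * m) ≤ 1 := by
      unfold stepSize
      rw [← hΘ, ← hm, mul_one_div, div_mul_eq_mul_div]
      apply div_le_one_of_le₀ _ zero_le
      calc 2 * (n * Θ * m) = n * (2 * Θ * m) := by ring
        _ ≤ (n + 1) * (1 + 2 * Θ * m) := by
          gcongr <;> simp
    calc 2 * (stepSize θ u₀ n : ℝ≥0∞) * rate (truncKernel k θ n) u x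
        ≤ 2 * (stepSize θ u₀ n : ℝ≥0∞) * ((n : ℝ≥0) * Θ * m) := by gcongr
      _ ≤ 1 := by exact_mod_cast key

theorem measurable_approx (hk : KernelBounds k θ α lam C) (hu : InitialDatum α lam u₀) (n : ℕ)
    (t : ℝ) : Measurable (approx k θ u₀ n t) :=
  (stable_truncKernel hk hu n).measurable_iter _

theorem lintegral_approx (hk : KernelBounds k θ α lam C) (hu : InitialDatum α lam u₀) (n : ℕ)
    (t : ℝ) : ∫⁻ x, approx k θ u₀ n t x = ∫⁻ x, u₀ x :=
  (stable_truncKernel hk hu n).lintegral_iter _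

theorem floor_stepSize_le {T t : ℝ} (ht : t ∈ Icc 0 T) (n : ℕ) :
    (⌊t / stepSize θ u₀ n⌋₊ : ℝ) * stepSize θ u₀ n ≤ T :=
  (floor_mul_le (stepSize_pos θ u₀ n) ht.1).trans ht.2

/-- The measure with density `approx`. -/
noncomputable def approxMeasure (k : ℝ × ℝ × ℝ → ℝ≥0∞) (θ u₀ : ℝ → ℝ≥0∞) (t : ℝ) (n : ℕ) :
    Measure ℝ :=
  volume.withDensity (approx k θ u₀ n t)

theorem approxMeasure_univ (hk : KernelBounds k θ α lam C) (hu : InitialDatum α lam u₀) (n : ℕ)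
    (t : ℝ) : approxMeasure k θ u₀ t n univ = ∫⁻ x, u₀ x := by
  rw [approxMeasure, withDensity_apply _ MeasurableSet.univ, Measure.restrict_univ,
    lintegral_approx hk hu]

theorem approxMeasure_dominated (hk : KernelBounds k θ α lam C) (hu : InitialDatum α lam u₀)
    {t : ℝ} (ht : 0 ≤ t) {ε : ℝ≥0∞} (hε : 0 < ε) :
    ∃ ρ : Measure ℝ, IsFiniteMeasure ρ ∧
      ∀ n, ∀ A, MeasurableSet A → approxMeasure k θ u₀ t n A ≤ ρ A + ε := by
  have hε2 := ENNReal.half_pos hε.ne'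
  obtain ⟨R₁, hR₁⟩ := far_tail_bound θ hu C t hε2
  obtain ⟨R, hR⟩ := uniform_integrability θ hu C t hε2
  have htt : t ∈ Icc 0 t := ⟨ht, le_rfl⟩
  refine ⟨(R : ℝ≥0∞) • volume.restrict (Ioc 0 (R₁ : ℝ)), ?_, fun n A hA => ?_⟩
  · have : IsFiniteMeasure (volume.restrict (Ioc 0 (R₁ : ℝ))) := ⟨by simp⟩
    exact Measure.smul_finite _ ENNReal.coe_ne_top
  have hs := stable_truncKernel hk hu n
  have hj := floor_stepSize_le (θ := θ) (u₀ := u₀) htt n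
  obtain ⟨g, hg, hle, hgε⟩ := hR _ _ hs _ hj
  have htail := hR₁ _ _ hs _ hj
  have hm := measurable_approx hk hu n t
  rw [approxMeasure, withDensity_apply _ hA, Measure.smul_apply, Measure.restrict_apply hA,
    smul_eq_mul]
  have hl : 0 ≤ lam := by linarith [hk.one_lt]
  have hpt : ∀ x, approx k θ u₀ n t x ≤ (Ioc 0 (R₁ : ℝ)).indicator (fun _ => (R : ℝ≥0∞)) x +
      (g x + (Ioi (R₁ : ℝ)).indicator (farWeight lam) x * approx k θ u₀ n t x) := by
    intro x
    rcases le_or_gt x 0 with hx | hx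
    · have : approx k θ u₀ n t x = 0 := hs.iter_eq_zero _ hx
      rw [this]; exact zero_le
    rcases le_or_gt x R₁ with hx1 | hx1
    · rw [indicator_of_mem (show x ∈ Ioc 0 (R₁ : ℝ) from ⟨hx, hx1⟩), ← add_assoc]
      exact (hle x).trans le_self_add
    · rw [indicator_of_mem (show x ∈ Ioi (R₁ : ℝ) from hx1)]
      refine le_add_left (le_add_left ?_)
      simpa using mul_le_mul_left (one_le_farWeight hl x) (approx k θ u₀ n t x)
  calc ∫⁻ x in A, approx k θ u₀ n t x
      ≤ ∫⁻ x in A, ((Ioc 0 (R₁ : ℝ)).indicator (fun _ => (R : ℝ≥0∞)) x +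
        (g x + (Ioi (R₁ : ℝ)).indicator (farWeight lam) x * approx k θ u₀ n t x)) :=
        lintegral_mono hpt
    _ = R * volume (A ∩ Ioc 0 (R₁ : ℝ)) + ((∫⁻ x in A, g x) +
        ∫⁻ x in A, (Ioi (R₁ : ℝ)).indicator (farWeight lam) x * approx k θ u₀ n t x) := by
        rw [lintegral_add_left (measurable_const.indicator measurableSet_Ioc),
          lintegral_add_left hg, lintegral_indicator measurableSet_Ioc, lintegral_const,
          Measure.restrict_restrict measurableSet_Ioc, Measure.restrict_apply_univ, inter_comm]
    _ ≤ R * volume (A ∩ Ioc 0 (R₁ : ℝ)) + (ε / 2 + ε / 2) := by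
        gcongr
        · exact (setLIntegral_le_lintegral _ _).trans hgε
        · exact (setLIntegral_le_lintegral _ _).trans htail
    _ = _ := by rw [ENNReal.add_halves]

/-- `d` is, at time `t`, the setwise limit of the approximations along the ultrafilter `U`. -/
structure IsLimit (k : ℝ × ℝ × ℝ → ℝ≥0∞) (θ u₀ : ℝ → ℝ≥0∞) (U : Ultrafilter ℕ) (t : ℝ)
    (d : ℝ → ℝ≥0∞) : Prop where
  measurable : Measurable d
  lt_top : ∀ x, d x < ∞
  eq_zero : ∀ x ≤ 0, d x = 0
  tendsto : ∀ A, MeasurableSet A →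
    Tendsto (fun n => approxMeasure k θ u₀ t n A) U (𝓝 (volume.withDensity d A))

theorem exists_isLimit (hk : KernelBounds k θ α lam C) (hu : InitialDatum α lam u₀)
    (U : Ultrafilter ℕ) {t : ℝ} (ht : 0 ≤ t) : ∃ d, IsLimit k θ u₀ U t d := by
  obtain ⟨μ, hμ, hlim⟩ := exists_setwise_limit U (approxMeasure k θ u₀ t)
    fun ε hε => approxMeasure_dominated hk hu ht hε
  have hnull : ∀ A, MeasurableSet A → (∀ n, approxMeasure k θ u₀ t n A = 0) → μ A = 0 := by
    intro A hA h0
    refine tendsto_nhds_unique (hlim A hA) ?_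
    simp [h0]
  have hac : μ ≪ volume := by
    refine Measure.AbsolutelyContinuous.mk fun A hA hA0 => hnull A hA fun n => ?_
    exact withDensity_absolutelyContinuous _ _ hA0
  have hneg : μ (Iic 0) = 0 := by
    refine hnull _ measurableSet_Iic fun n => ?_
    rw [approxMeasure, withDensity_apply _ measurableSet_Iic,
      setLIntegral_congr_fun measurableSet_Iic (f := approx k θ u₀ n t) (g := fun _ => 0)
        fun x hx => (stable_truncKernel hk hu n).iter_eq_zero _ hx, lintegral_zero]
  have hdm := Measure.measurable_rnDeriv μ volume
  have hwd := Measure.withDensity_rnDeriv_eq μ volume hac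
  set d₀ := μ.rnDeriv volume
  let B : Set ℝ := {x | 0 < x ∧ d₀ x < ∞}
  have hB : MeasurableSet B := measurableSet_Ioi.inter (measurableSet_lt hdm measurable_const)
  have hae : B.indicator d₀ =ᵐ[volume] d₀ := by
    have h1 : ∀ᵐ x, d₀ x < ∞ := Measure.rnDeriv_lt_top μ volume
    have h2 : ∀ᵐ x, x ∈ Iic (0 : ℝ) → d₀ x = 0 := by
      rw [← hwd, withDensity_apply _ measurableSet_Iic] at hneg
      have := (lintegral_eq_zero_iff hdm).1 hneg
      exact (ae_restrict_iff' measurableSet_Iic).1 this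
    filter_upwards [h1, h2] with x hx1 hx2
    by_cases hx : 0 < x
    · exact indicator_of_mem (show x ∈ B from ⟨hx, hx1⟩) _
    · rw [indicator_of_notMem (fun h => hx h.1), hx2 (not_lt.1 hx)]
  refine ⟨B.indicator d₀, hdm.indicator hB, fun x => ?_, fun x hx => ?_, fun A hA => ?_⟩
  · rw [indicator_apply]
    split_ifs with h
    · exact h.2
    · exact ENNReal.zero_lt_top
  · exact indicator_of_notMem (fun h => absurd h.1 (not_lt.2 hx)) _
  · rw [withDensity_congr_ae hae, hwd]
    exact hlim A hA

variable {U : Ultrafilter ℕ} {t : ℝ} {d : ℝ → ℝ≥0∞}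

theorem lintegral_approxMeasure (hk : KernelBounds k θ α lam C) (hu : InitialDatum α lam u₀) (n : ℕ)
    (t : ℝ) {f : ℝ → ℝ≥0∞} (hf : Measurable f) :
    ∫⁻ x, f x ∂(approxMeasure k θ u₀ t n) = ∫⁻ x, f x * approx k θ u₀ n t x := by
  rw [approxMeasure, lintegral_withDensity_eq_lintegral_mul _ (measurable_approx hk hu n t) hf]
  exact lintegral_congr fun x => mul_comm _ _

namespace IsLimit

theorem lintegral_withDensity (h : IsLimit k θ u₀ U t d) {f : ℝ → ℝ≥0∞} (hf : Measurable f) :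
    ∫⁻ x, f x ∂(volume.withDensity d) = ∫⁻ x, f x * d x := by
  rw [lintegral_withDensity_eq_lintegral_mul _ h.measurable hf]
  exact lintegral_congr fun x => mul_comm _ _

theorem withDensity_univ (h : IsLimit k θ u₀ U t d) (hk : KernelBounds k θ α lam C)
    (hu : InitialDatum α lam u₀) : volume.withDensity d univ = ∫⁻ x, u₀ x := by
  refine tendsto_nhds_unique (h.tendsto univ MeasurableSet.univ) ?_
  simp_rw [approxMeasure_univ hk hu]
  exact tendsto_const_nhds

theorem lintegral_eq (h : IsLimit k θ u₀ U t d) (hk : KernelBounds k θ α lam C)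
    (hu : InitialDatum α lam u₀) : ∫⁻ x, d x = ∫⁻ x, u₀ x := by
  rw [← h.withDensity_univ hk hu, withDensity_apply _ MeasurableSet.univ, Measure.restrict_univ]

theorem coe_mass (hk : KernelBounds k θ α lam C) (hu : InitialDatum α lam u₀) :
    ((∫⁻ x, u₀ x).toNNReal : ℝ≥0∞) = ∫⁻ x, u₀ x :=
  ENNReal.coe_toNNReal (hu.mass_ne_top (by linarith [hk.one_lt]))

theorem tendsto_lintegral (h : IsLimit k θ u₀ U t d) (hk : KernelBounds k θ α lam C)
    (hu : InitialDatum α lam u₀) {f : ℝ → ℝ≥0∞} (hf : Measurable f) {b : ℝ≥0}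
    (hb : ∀ x, f x ≤ b) :
    Tendsto (fun n => ∫⁻ x, f x * approx k θ u₀ n t x) U (𝓝 (∫⁻ x, f x * d x)) := by
  have := tendsto_lintegral_of_setwise h.tendsto (c := (∫⁻ x, u₀ x).toNNReal)
    (fun n => by rw [approxMeasure_univ hk hu, coe_mass hk hu])
    (by rw [h.withDensity_univ hk hu, coe_mass hk hu]) hf hb
  simp_rw [lintegral_approxMeasure hk hu _ _ hf] at this
  rwa [h.lintegral_withDensity hf] at this

theorem lintegral_le (h : IsLimit k θ u₀ U t d) (hk : KernelBounds k θ α lam C)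
    (hu : InitialDatum α lam u₀) {f : ℝ → ℝ≥0∞} (hf : Measurable f) {B : ℝ≥0∞}
    (hB : ∀ n, ∫⁻ x, f x * approx k θ u₀ n t x ≤ B) : ∫⁻ x, f x * d x ≤ B := by
  have := lintegral_le_of_setwise h.tendsto (c := (∫⁻ x, u₀ x).toNNReal)
    (fun n => by rw [approxMeasure_univ hk hu, coe_mass hk hu])
    (by rw [h.withDensity_univ hk hu, coe_mass hk hu]) hf (B := B)
    (fun n => by rw [lintegral_approxMeasure hk hu _ _ hf]; exact hB n)
  rwa [h.lintegral_withDensity hf] at this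

theorem tendsto_lintegral_prod (h : IsLimit k θ u₀ U t d) (hk : KernelBounds k θ α lam C)
    (hu : InitialDatum α lam u₀) (ht : 0 ≤ t) {f : ℝ × ℝ → ℝ≥0∞} (hf : Measurable f) {b : ℝ≥0}
    (hb : ∀ x, f x ≤ b) :
    Tendsto (fun n => ∫⁻ p, f p ∂((approxMeasure k θ u₀ t n).prod (approxMeasure k θ u₀ t n))) U
      (𝓝 (∫⁻ p, f p ∂((volume.withDensity d).prod (volume.withDensity d)))) := by
  have hm0 : ∫⁻ x, u₀ x ≠ ∞ := hu.mass_ne_top (by linarith [hk.one_lt])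
  have hfin : ∀ n, IsFiniteMeasure (approxMeasure k θ u₀ t n) := fun n =>
    ⟨by rw [approxMeasure_univ hk hu]; exact hm0.lt_top⟩
  have hfin' : IsFiniteMeasure (volume.withDensity d) :=
    ⟨by rw [h.withDensity_univ hk hu]; exact hm0.lt_top⟩
  refine tendsto_lintegral_of_setwise (c := (∫⁻ x, u₀ x).toNNReal * (∫⁻ x, u₀ x).toNNReal)
    (fun E hE => tendsto_prod_setwise U (c := (∫⁻ x, u₀ x).toNNReal)
      (fun n => by rw [approxMeasure_univ hk hu, coe_mass hk hu])
      (fun ε hε => approxMeasure_dominated hk hu ht hε) h.tendsto hE)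
    (fun n => ?_) ?_ hf hb
  · rw [← univ_prod_univ, Measure.prod_prod, approxMeasure_univ hk hu]
    push_cast
    rw [coe_mass hk hu]
  · rw [← univ_prod_univ, Measure.prod_prod, h.withDensity_univ hk hu]
    push_cast
    rw [coe_mass hk hu]

end IsLimit

end Limit

/-! ### Convergence of the collision functional -/

/-- The states `(x, y, z)` with `x ≤ R` and `y ≤ R`. -/
def box (R : ℝ≥0) : Set (ℝ × ℝ × ℝ) := {p | p.1 ≤ R ∧ p.2.1 ≤ R}

theorem measurableSet_box (R : ℝ≥0) : MeasurableSet (box R) :=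
  (measurableSet_le measurable_fst measurable_const).inter
    (measurableSet_le (measurable_fst.comp measurable_snd) measurable_const)

section

variable {k : ℝ × ℝ × ℝ → ℝ≥0∞} {θ : ℝ → ℝ≥0∞} {α lam : ℝ} {C : ℝ≥0} {u₀ : ℝ → ℝ≥0∞}

theorem farWeight_le_of_le (hl : 0 ≤ lam) {x R : ℝ} (h : x ≤ R) :
    farWeight lam x ≤ farWeight lam R :=
  ENNReal.ofReal_le_ofReal
    (Real.rpow_le_rpow (check_pos x).le (max_le_max_left _ h) hl)

theorem KernelBounds.le_on_box (hk : KernelBounds k θ α lam C) {R : ℝ≥0} {p : ℝ × ℝ × ℝ}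
    (hp : p ∈ box R) : k p ≤ farWeight lam R * farWeight lam R * θ p.2.2 := by
  have hl : 0 ≤ lam := by linarith [hk.one_lt]
  refine (hk.growth p.1 p.2.1 p.2.2).trans (mul_le_mul_left (mul_le_mul' ?_ ?_) _)
  · exact farWeight_le_of_le hl hp.1
  · exact farWeight_le_of_le hl hp.2

theorem truncKernel_eq_on_box (hk : KernelBounds k θ α lam C) {R : ℝ≥0} {n : ℕ}
    (hn : farWeight lam R * farWeight lam R ≤ n) {p : ℝ × ℝ × ℝ} (hp : p ∈ box R) :
    truncKernel k θ n p = k p := by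
  refine min_eq_left ((hk.le_on_box hp).trans (mul_le_mul_left ?_ _))
  simpa using hn

theorem collision_le_box_add (hk : KernelBounds k θ α lam C) {u : ℝ → ℝ≥0∞} (hu : Measurable u)
    {G : ℝ × ℝ × ℝ → ℝ≥0∞} (hG : Measurable G) {b : ℝ≥0} (hb : ∀ p, G p ≤ b) (R : ℝ≥0) :
    collision k G u u ≤ collision k ((box R).indicator G) u u +
      b * (2 * ((∫⁻ x, (Ioi (R : ℝ)).indicator (farWeight lam) x * u x) *
        (∫⁻ x, farWeight lam x * u x) * ∫⁻ z, θ z)) := by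
  have hθ := hk.measurable_theta
  have htail : Measurable ((Ioi (R : ℝ)).indicator (farWeight lam)) :=
    (measurable_farWeight lam).indicator measurableSet_Ioi
  have hGb := hG.indicator (measurableSet_box R)
  have hkm := hk.measurable
  set τ := (Ioi (R : ℝ)).indicator (farWeight lam) with hτ
  calc collision k G u u
      ≤ ∫⁻ p : ℝ × ℝ × ℝ, ((box R).indicator G p * k p * (u p.1 * u p.2.1) +
          b * ((τ p.1 * farWeight lam p.2.1 * θ p.2.2) * (u p.1 * u p.2.1) +
          (farWeight lam p.1 * τ p.2.1 * θ p.2.2) * (u p.1 * u p.2.1))) := by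
        refine lintegral_mono fun p => ?_
        by_cases hp : p ∈ box R
        · rw [indicator_of_mem hp]; exact le_self_add
        · refine le_add_left ?_
          have hgr := hk.growth p.1 p.2.1 p.2.2
          have h1 : k p ≤ τ p.1 * farWeight lam p.2.1 * θ p.2.2 +
              farWeight lam p.1 * τ p.2.1 * θ p.2.2 := by
            rcases le_or_gt p.1 R with hx | hx
            · have hy : (R : ℝ) < p.2.1 := not_le.1 fun hy => hp ⟨hx, hy⟩
              have : τ p.2.1 = farWeight lam p.2.1 := indicator_of_mem (show _ ∈ Ioi _ from hy) _
              rw [this]; exact hgr.trans le_add_self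
            · have : τ p.1 = farWeight lam p.1 := indicator_of_mem (show _ ∈ Ioi _ from hx) _
              rw [this]; exact hgr.trans le_self_add
          calc G p * k p * (u p.1 * u p.2.1) ≤ b * (τ p.1 * farWeight lam p.2.1 * θ p.2.2 +
                farWeight lam p.1 * τ p.2.1 * θ p.2.2) * (u p.1 * u p.2.1) := by
                gcongr; exact hb p
            _ = _ := by ring
    _ = _ := by
        rw [lintegral_add_left (by fun_prop), lintegral_const_mul _ (by fun_prop),
          lintegral_add_left (by fun_prop),
          lintegral_tensor htail (measurable_farWeight lam) hθ hu hu,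
          lintegral_tensor (measurable_farWeight lam) htail hθ hu hu, collision]
        ring

/-- Up to a small error, uniform along the scheme and shared by its limits, the collision
functional only sees bounded states. -/
theorem exists_box (hk : KernelBounds k θ α lam C) (hu : InitialDatum α lam u₀) (T : ℝ) (b : ℝ≥0)
    {ε : ℝ≥0∞} (hε : 0 < ε) : ∃ R : ℝ≥0, ∀ G : ℝ × ℝ × ℝ → ℝ≥0∞, Measurable G → (∀ p, G p ≤ b) →
      ∀ t ∈ Icc 0 T,
        (∀ n, collision (truncKernel k θ n) G (approx k θ u₀ n t) (approx k θ u₀ n t) ≤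
          collision (truncKernel k θ n) ((box R).indicator G) (approx k θ u₀ n t)
            (approx k θ u₀ n t) + ε) ∧
        ∀ (U : Ultrafilter ℕ) (d : ℝ → ℝ≥0∞), IsLimit k θ u₀ U t d →
          collision k G d d ≤ collision k ((box R).indicator G) d d + ε := by
  obtain ⟨B, hB⟩ := far_moment_bound θ hu C T
  have hθtop : ∫⁻ z, θ z ≠ ∞ := ne_top_of_le_ne_top hk.moment (lintegral_theta_le θ)
  set D : ℝ≥0∞ := b * (2 * (B * ∫⁻ z, θ z)) with hD
  have hDtop : D ≠ ∞ := by finiteness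
  have hη : 0 < ε / (D + 1) := ENNReal.div_pos hε.ne' (by finiteness)
  obtain ⟨R, hR⟩ := far_tail_bound θ hu C T hη
  have hbound : ∀ a c : ℝ≥0∞, a ≤ ε / (D + 1) → c ≤ B →
      b * (2 * (a * c * ∫⁻ z, θ z)) ≤ ε := by
    intro a c ha hc
    calc b * (2 * (a * c * ∫⁻ z, θ z)) ≤ b * (2 * (ε / (D + 1) * B * ∫⁻ z, θ z)) := by gcongr
      _ = ε / (D + 1) * D := by rw [hD]; ring
      _ ≤ ε / (D + 1) * (D + 1) := by gcongr; exact le_self_add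
      _ = ε := ENNReal.div_mul_cancel (by simp) (by finiteness)
  refine ⟨R, fun G hG hGb t ht => ⟨fun n => ?_, fun U d hd => ?_⟩⟩
  · have hs := stable_truncKernel hk hu n
    have hj := floor_stepSize_le (θ := θ) (u₀ := u₀) ht n
    exact (collision_le_box_add hs.bounds (measurable_approx hk hu n t) hG hGb R).trans
      (add_le_add_right (hbound _ _ (hR _ _ hs _ hj) (hB _ _ hs _ hj)) _)
  · refine (collision_le_box_add hk hd.measurable hG hGb R).trans
      (add_le_add_right (hbound _ _ ?_ ?_) _)
    · exact hd.lintegral_le hk hu ((measurable_farWeight lam).indicator measurableSet_Ioi)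
        fun n => hR _ _ (stable_truncKernel hk hu n) _ (floor_stepSize_le ht n)
    · exact hd.lintegral_le hk hu (measurable_farWeight lam)
        fun n => hB _ _ (stable_truncKernel hk hu n) _ (floor_stepSize_le ht n)

theorem collision_congr_kernel {k k' G : ℝ × ℝ × ℝ → ℝ≥0∞} {v u : ℝ → ℝ≥0∞}
    (h : ∀ p, G p ≠ 0 → k p = k' p) : collision k G v u = collision k' G v u := by
  refine lintegral_congr fun p => ?_
  by_cases hp : G p = 0
  · simp [hp]
  · rw [h p hp]

theorem collision_approx_bound (hk : KernelBounds k θ α lam C) (hu : InitialDatum α lam u₀)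
    (T : ℝ) (b : ℝ≥0) : ∃ B : ℝ≥0, ∀ G : ℝ × ℝ × ℝ → ℝ≥0∞, (∀ p, G p ≤ b) → ∀ n, ∀ t ∈ Icc 0 T,
      collision (truncKernel k θ n) G (approx k θ u₀ n t) (approx k θ u₀ n t) ≤ B := by
  obtain ⟨B, hB⟩ := collision_bound θ hu C T
  refine ⟨b * B, fun G hG n t ht => ?_⟩
  have hs := stable_truncKernel hk hu n
  have hm := measurable_approx hk hu n t
  calc collision (truncKernel k θ n) G (approx k θ u₀ n t) (approx k θ u₀ n t)
      ≤ collision (truncKernel k θ n) (fun _ => b * 1) (approx k θ u₀ n t) (approx k θ u₀ n t) :=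
        collision_mono fun p _ => by rw [mul_one]; exact hG p
    _ = b * collision (truncKernel k θ n) (fun _ => 1) (approx k θ u₀ n t) (approx k θ u₀ n t) :=
        collision_const_mul hs.bounds.measurable hm hm measurable_const _
    _ ≤ _ := by
        push_cast
        gcongr
        exact hB _ _ hs _ (floor_stepSize_le ht n)

theorem IsLimit.collision_bound (hk : KernelBounds k θ α lam C) (hu : InitialDatum α lam u₀)
    (T : ℝ) (b : ℝ≥0) : ∃ B : ℝ≥0, ∀ G : ℝ × ℝ × ℝ → ℝ≥0∞, (∀ p, G p ≤ b) → ∀ t ∈ Icc 0 T,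
      ∀ (U : Ultrafilter ℕ) (d : ℝ → ℝ≥0∞), IsLimit k θ u₀ U t d → collision k G d d ≤ B := by
  obtain ⟨B, hB⟩ := far_moment_bound θ hu C T
  have hθtop : ∫⁻ z, θ z ≠ ∞ := ne_top_of_le_ne_top hk.moment (lintegral_theta_le θ)
  refine ⟨B * B * (b * (∫⁻ z, θ z).toNNReal), fun G hG t ht U d hd => ?_⟩
  have hθ := hk.measurable_theta
  have hfar : ∫⁻ x, farWeight lam x * d x ≤ B := hd.lintegral_le hk hu (measurable_farWeight lam)
        fun n => hB _ _ (stable_truncKernel hk hu n) _ (floor_stepSize_le ht n)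
  calc collision k G d d ≤ (∫⁻ x, farWeight lam x * d x) * (∫⁻ x, farWeight lam x * d x) *
        ∫⁻ z, b * θ z := by
        refine collision_le (by fun_prop) (by fun_prop) (by fun_prop) hd.measurable hd.measurable
          fun p => ?_
        calc G p * k p ≤ b * (farWeight lam p.1 * farWeight lam p.2.1 * θ p.2.2) :=
              mul_le_mul' (hG p) (hk.growth p.1 p.2.1 p.2.2)
          _ = _ := by ring
    _ ≤ _ := by
        rw [lintegral_const_mul _ hθ]
        push_cast
        rw [ENNReal.coe_toNNReal hθtop]
        gcongr

/-- The collision functional converges along the approximations. -/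
theorem IsLimit.tendsto_collision (hk : KernelBounds k θ α lam C) (hu : InitialDatum α lam u₀)
    {U : Ultrafilter ℕ} (hU : (U : Filter ℕ) ≤ atTop) {t : ℝ} (ht : 0 ≤ t) {d : ℝ → ℝ≥0∞}
    (h : IsLimit k θ u₀ U t d) {G : ℝ × ℝ × ℝ → ℝ≥0∞} (hG : Measurable G) {b : ℝ≥0}
    (hb : ∀ p, G p ≤ b) :
    Tendsto (fun n => collision (truncKernel k θ n) G (approx k θ u₀ n t) (approx k θ u₀ n t)) U
      (𝓝 (collision k G d d)) := by
  have htt : t ∈ Icc 0 t := ⟨ht, le_rfl⟩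
  have hθtop : ∫⁻ z, θ z ≠ ∞ := ne_top_of_le_ne_top hk.moment (lintegral_theta_le θ)
  obtain ⟨B, hB⟩ := IsLimit.collision_bound hk hu t b
  refine tendsto_of_approx (ne_top_of_le_ne_top ENNReal.coe_ne_top (hB G hb t htt U d h))
    fun ε hε => ?_
  obtain ⟨R, hR⟩ := exists_box hk hu t b hε
  obtain ⟨hR1, hR2⟩ := hR G hG hb t htt
  have hGR := hG.indicator (measurableSet_box R)
  have hkm := hk.measurable
  have hle : ∀ p, (box R).indicator G p ≤ G p := fun p => indicator_le_self _ _ p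
  have hfarR : farWeight lam R * farWeight lam R ≠ ∞ := by unfold farWeight; finiteness
  refine ⟨_, collision k ((box R).indicator G) d d, ?_,
    Eventually.of_forall fun n => ⟨collision_mono fun p _ => hle p, hR1 n⟩,
    collision_mono fun p _ => hle p, hR2 U d h⟩
  have hf : Measurable fun p : ℝ × ℝ =>
      ∫⁻ z, (box R).indicator G (p.1, p.2, z) * k (p.1, p.2, z) :=
    Measurable.lintegral_prod_right' (f := fun q : (ℝ × ℝ) × ℝ =>
      (box R).indicator G (q.1.1, q.1.2, q.2) * k (q.1.1, q.1.2, q.2)) (by fun_prop)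
  have hfb : ∀ p : ℝ × ℝ, ∫⁻ z, (box R).indicator G (p.1, p.2, z) * k (p.1, p.2, z) ≤
      (b * ((farWeight lam R * farWeight lam R).toNNReal * (∫⁻ z, θ z).toNNReal) : ℝ≥0) := by
    intro p
    push_cast
    rw [ENNReal.coe_toNNReal hθtop, ENNReal.coe_toNNReal hfarR,
      ← lintegral_const_mul _ hk.measurable_theta,
      ← lintegral_const_mul _ (hk.measurable_theta.const_mul _)]
    refine lintegral_mono fun z => ?_
    by_cases hp : (p.1, p.2, z) ∈ box R
    · rw [indicator_of_mem hp]
      exact mul_le_mul' (hb _) (hk.le_on_box hp)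
    · rw [indicator_of_notMem hp, zero_mul]; exact zero_le
  have hlim := h.tendsto_lintegral_prod hk hu ht hf hfb
  rw [← collision_eq_lintegral_prod hkm hGR h.measurable] at hlim
  refine hlim.congr' ?_
  obtain ⟨N, hN⟩ := ENNReal.exists_nat_gt hfarR
  filter_upwards [hU (eventually_ge_atTop N)] with n hn
  rw [approxMeasure, ← collision_eq_lintegral_prod hkm hGR (measurable_approx hk hu n t)]
  refine (collision_congr_kernel fun p hp => ?_).symm
  have hpR : p ∈ box R := by
    by_contra hne; exact hp (indicator_of_notMem hne _)
  exact truncKernel_eq_on_box hk (hN.le.trans (by exact_mod_cast hn)) hpR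

theorem collision_mono_densities {k G : ℝ × ℝ × ℝ → ℝ≥0∞} (hk : Measurable k) (hG : Measurable G)
    {u w l : ℝ → ℝ≥0∞} (hu : Measurable u) (hw : Measurable w) (hl : Measurable l)
    (h : ∀ x, w x ≤ u x + l x) :
    collision k G w w ≤ collision k G u u + (collision k G l w + collision k G u l) := by
  unfold collision
  rw [← lintegral_add_left (by fun_prop), ← lintegral_add_left (by fun_prop)]
  refine lintegral_mono fun p => ?_
  calc G p * k p * (w p.1 * w p.2.1)
      ≤ G p * k p * ((u p.1 + l p.1) * w p.2.1) := by gcongr; exact h _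
    _ = G p * k p * (u p.1 * w p.2.1) + G p * k p * (l p.1 * w p.2.1) := by ring
    _ ≤ G p * k p * (u p.1 * (u p.2.1 + l p.2.1)) + G p * k p * (l p.1 * w p.2.1) := by
        gcongr; exact h _
    _ = _ := by ring

/-- Asymptotic equicontinuity in time of the collision functional along the approximations. -/
theorem collision_approx_equicontinuous (hk : KernelBounds k θ α lam C)
    (hu : InitialDatum α lam u₀) (T : ℝ) {G : ℝ × ℝ × ℝ → ℝ≥0∞} (hG : Measurable G) {b : ℝ≥0}
    (hb : ∀ p, G p ≤ b) {ε : ℝ} (hε : 0 < ε) :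
    ∃ δ > 0, ∀ᶠ n in atTop, ∀ s ∈ Icc 0 T, ∀ t ∈ Icc 0 T, |t - s| < δ →
      collision (truncKernel k θ n) G (approx k θ u₀ n t) (approx k θ u₀ n t) ≤
        collision (truncKernel k θ n) G (approx k θ u₀ n s) (approx k θ u₀ n s) +
          ENNReal.ofReal ε := by
  have hε2 : 0 < ENNReal.ofReal (ε / 2) := by simpa using hε
  obtain ⟨R, hR⟩ := exists_box hk hu T b hε2
  obtain ⟨L, hL⟩ := eulerPath_lipschitz θ hu C T
  have hθtop : ∫⁻ z, θ z ≠ ∞ := ne_top_of_le_ne_top hk.moment (lintegral_theta_le θ)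
  have hm0 : ∫⁻ x, u₀ x ≠ ∞ := hu.mass_ne_top (by linarith [hk.one_lt])
  have hfarR : farWeight lam R * farWeight lam R ≠ ∞ := by unfold farWeight; finiteness
  set D : ℝ≥0∞ := 2 * (L * (∫⁻ x, u₀ x) *
    (b * (farWeight lam R * farWeight lam R) * ∫⁻ z, θ z)) with hD
  have hDtop : D ≠ ∞ := by finiteness
  have hδ : 0 < ε / (4 * (D.toReal + 1)) := by positivity
  refine ⟨ε / (4 * (D.toReal + 1)), hδ, ?_⟩
  filter_upwards [(tendsto_order.1 (tendsto_stepSize θ u₀)).2 _ hδ] with n hn s hs t ht hst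
  have hsch := stable_truncKernel hk hu n
  have hms := measurable_approx hk hu n s
  have hmt := measurable_approx hk hu n t
  have hkm := hsch.bounds.measurable
  have hθ := hk.measurable_theta
  have hGR := hG.indicator (measurableSet_box R)
  obtain ⟨l, hl, hle, hlint⟩ := hL _ _ hsch (stepSize_pos θ u₀ n) s hs t ht
  have hcoll : ∀ v w : ℝ → ℝ≥0∞, Measurable v → Measurable w →
      collision (truncKernel k θ n) ((box R).indicator G) v w ≤
        (∫⁻ x, v x) * (∫⁻ x, w x) *
          (b * (farWeight lam R * farWeight lam R) * ∫⁻ z, θ z) := by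
    intro v w hv hw
    have := collision_le (k := truncKernel k θ n) (G := (box R).indicator G) (a := fun _ => 1)
      (b := fun _ => 1) (s := fun z => b * (farWeight lam R * farWeight lam R) * θ z)
      (by fun_prop) (by fun_prop) (by fun_prop) hv hw (fun p => by
        by_cases hp : p ∈ box R
        · rw [indicator_of_mem hp, one_mul, one_mul, mul_assoc]
          exact mul_le_mul' (hb p) ((min_le_left _ _).trans (hk.le_on_box hp))
        · rw [indicator_of_notMem hp, zero_mul]; exact zero_le)
    simpa only [one_mul, lintegral_const_mul _ hθ] using this
  have hsmall : D * (ENNReal.ofReal |t - s| + stepSize θ u₀ n) ≤ ENNReal.ofReal (ε / 2) := by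
    have h1 : ENNReal.ofReal |t - s| + stepSize θ u₀ n ≤
        ENNReal.ofReal (2 * (ε / (4 * (D.toReal + 1)))) := by
      rw [← ENNReal.ofReal_coe_nnreal, ← ENNReal.ofReal_add (abs_nonneg _) (NNReal.coe_nonneg _)]
      exact ENNReal.ofReal_le_ofReal (by linarith)
    calc D * (ENNReal.ofReal |t - s| + stepSize θ u₀ n)
        ≤ ENNReal.ofReal D.toReal * ENNReal.ofReal (2 * (ε / (4 * (D.toReal + 1)))) := by
          rw [ENNReal.ofReal_toReal hDtop]; gcongr
      _ ≤ _ := by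
          rw [← ENNReal.ofReal_mul ENNReal.toReal_nonneg]
          refine ENNReal.ofReal_le_ofReal ?_
          have h0 : 0 ≤ D.toReal := ENNReal.toReal_nonneg
          have : D.toReal * (2 * (ε / (4 * (D.toReal + 1)))) =
              ε / 2 * (D.toReal / (D.toReal + 1)) := by field_simp; ring
          rw [this]
          have h3 : D.toReal / (D.toReal + 1) ≤ 1 := div_le_one_of_le₀ (by linarith) (by linarith)
          nlinarith
  have hR1 := (hR G hG hb t ht).1 n
  refine hR1.trans ?_
  have hadd : ENNReal.ofReal ε = ENNReal.ofReal (ε / 2) + ENNReal.ofReal (ε / 2) := by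
    rw [← ENNReal.ofReal_add (by positivity) (by positivity)]; congr 1; ring
  rw [hadd, ← add_assoc]
  refine add_le_add_left ?_ _
  refine (collision_mono_densities hkm hGR hms hmt hl hle).trans (add_le_add ?_ ?_)
  · exact collision_mono fun p _ => indicator_le_self _ _ p
  · refine le_trans (add_le_add (hcoll _ _ hl hmt) (hcoll _ _ hms hl)) (le_trans ?_ hsmall)
    rw [lintegral_approx hk hu, lintegral_approx hk hu]
    set Q := b * (farWeight lam R * farWeight lam R) * ∫⁻ z, θ z
    set m := ∫⁻ x, u₀ x
    set τ := ENNReal.ofReal |t - s| + stepSize θ u₀ n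
    calc (∫⁻ x, l x) * m * Q + m * (∫⁻ x, l x) * Q = (∫⁻ x, l x) * (2 * (m * Q)) := by ring
      _ ≤ L * τ * (2 * (m * Q)) := by gcongr
      _ = D * τ := by rw [hD]; ring

end

/-! ### The limit equation -/

section

variable {k : ℝ × ℝ × ℝ → ℝ≥0∞} {θ : ℝ → ℝ≥0∞} {α lam : ℝ} {C : ℝ≥0} {u₀ : ℝ → ℝ≥0∞}

theorem IsLimit.weight_bound (hk : KernelBounds k θ α lam C) (hu : InitialDatum α lam u₀) (T : ℝ) :
    ∃ B : ℝ≥0, ∀ t ∈ Icc 0 T, ∀ (U : Ultrafilter ℕ) (d : ℝ → ℝ≥0∞), IsLimit k θ u₀ U t d →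
      ∫⁻ x, (nearWeight α x + farWeight lam x) * d x ≤ B := by
  obtain ⟨B, hB⟩ := far_moment_bound θ hu C T
  obtain ⟨B', hB'⟩ := near_moment_bound θ hu C T
  refine ⟨B' + B, fun t ht U d hd => hd.lintegral_le hk hu (by fun_prop) fun n => ?_⟩
  have hm := measurable_approx hk hu n t
  have hs := stable_truncKernel hk hu n
  have hj := floor_stepSize_le (θ := θ) (u₀ := u₀) ht n
  simp_rw [add_mul]
  rw [lintegral_add_left (by fun_prop)]
  push_cast
  exact add_le_add (hB' _ _ hs _ hj) (hB _ _ hs _ hj)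

/-- The first moment is conserved in the limit, as the moments of order `λ > 1` have uniformly
small tails. -/
theorem IsLimit.first_moment (hk : KernelBounds k θ α lam C) (hu : InitialDatum α lam u₀)
    {U : Ultrafilter ℕ} {t : ℝ} (ht : 0 ≤ t) {d : ℝ → ℝ≥0∞} (h : IsLimit k θ u₀ U t d) :
    ∫⁻ x, ENNReal.ofReal x * d x = ∫⁻ x, ENNReal.ofReal x * u₀ x := by
  have hl := hk.one_lt
  have htt : t ∈ Icc 0 t := ⟨ht, le_rfl⟩
  obtain ⟨B, hB⟩ := far_moment_bound θ hu C t
  have hfar : ∫⁻ x, farWeight lam x * d x ≤ B := h.lintegral_le hk hu (measurable_farWeight lam)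
    fun n => hB _ _ (stable_truncKernel hk hu n) _ (floor_stepSize_le htt n)
  have hfin : ∫⁻ x, ENNReal.ofReal x * d x ≠ ∞ := by
    refine ne_top_of_le_ne_top ENNReal.coe_ne_top (le_trans (lintegral_mono fun x => ?_) hfar)
    exact mul_le_mul_left (ofReal_le_farWeight hl.le x) _
  have hlim : Tendsto (fun n => ∫⁻ x, ENNReal.ofReal x * approx k θ u₀ n t x) U
      (𝓝 (∫⁻ x, ENNReal.ofReal x * d x)) := by
    refine tendsto_of_approx hfin fun ε hε => ?_
    obtain ⟨R, hR⟩ := far_tail_bound θ hu C t hε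
    let f : ℝ → ℝ≥0∞ := (Iic (R : ℝ)).indicator ENNReal.ofReal
    have hf : Measurable f := ENNReal.measurable_ofReal.indicator measurableSet_Iic
    have hfb : ∀ x, f x ≤ R := fun x => by
      by_cases hx : x ≤ R
      · rw [show f x = ENNReal.ofReal x from indicator_of_mem (show x ∈ Iic (R : ℝ) from hx) _]
        exact ENNReal.ofReal_le_of_le_toReal (by simpa using hx)
      · rw [show f x = 0 from indicator_of_notMem (show x ∉ Iic (R : ℝ) from hx) _]; exact zero_le
    have hτ : Measurable ((Ioi (R : ℝ)).indicator (farWeight lam)) :=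
      (measurable_farWeight lam).indicator measurableSet_Ioi
    have hle : ∀ x, ENNReal.ofReal x ≤ f x + (Ioi (R : ℝ)).indicator (farWeight lam) x := fun x => by
      by_cases hx : x ≤ R
      · rw [show f x = ENNReal.ofReal x from indicator_of_mem (show x ∈ Iic (R : ℝ) from hx) _]
        exact le_self_add
      · rw [indicator_of_mem (show x ∈ Ioi (R : ℝ) from not_le.1 hx)]
        exact le_add_left (ofReal_le_farWeight hl.le x)
    have hsplit : ∀ u : ℝ → ℝ≥0∞, Measurable u →
        ∫⁻ x, (Ioi (R : ℝ)).indicator (farWeight lam) x * u x ≤ ε →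
        ∫⁻ x, ENNReal.ofReal x * u x ≤ (∫⁻ x, f x * u x) + ε := by
      intro u hum htail
      calc ∫⁻ x, ENNReal.ofReal x * u x
          ≤ ∫⁻ x, (f x * u x + (Ioi (R : ℝ)).indicator (farWeight lam) x * u x) := by
            refine lintegral_mono fun x => ?_
            rw [← add_mul]
            exact mul_le_mul_left (hle x) _
        _ ≤ _ := by
            rw [lintegral_add_left (by fun_prop)]
            gcongr
    have hmono : ∀ u : ℝ → ℝ≥0∞, ∫⁻ x, f x * u x ≤ ∫⁻ x, ENNReal.ofReal x * u x := fun u =>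
      lintegral_mono fun x => mul_le_mul_left (indicator_le_self _ _ x) _
    have htail : ∀ n, ∫⁻ x, (Ioi (R : ℝ)).indicator (farWeight lam) x * approx k θ u₀ n t x ≤ ε :=
      fun n => hR _ _ (stable_truncKernel hk hu n) _ (floor_stepSize_le htt n)
    exact ⟨_, _, h.tendsto_lintegral hk hu hf hfb,
      Eventually.of_forall fun n => ⟨hmono _, hsplit _ (measurable_approx hk hu n t) (htail n)⟩,
      hmono _, hsplit d h.measurable (h.lintegral_le hk hu hτ htail)⟩
  refine tendsto_nhds_unique hlim ?_
  simp_rw [show ∀ n, ∫⁻ x, ENNReal.ofReal x * approx k θ u₀ n t x =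
    ∫⁻ x, ENNReal.ofReal x * u₀ x from
      fun n => (stable_truncKernel hk hu n).first_moment_iter _]
  exact tendsto_const_nhds

theorem intervalIntegrable_floor (h : ℝ≥0) (a : ℕ → ℝ) {B T x y : ℝ}
    (hx : x ∈ Icc 0 T) (hy : y ∈ Icc 0 T) (hB : ∀ s ∈ Icc 0 T, |a ⌊s / h⌋₊| ≤ B) :
    IntervalIntegrable (fun s : ℝ => a ⌊s / h⌋₊) volume x y := by
  have hm : Measurable fun s : ℝ => a ⌊s / h⌋₊ :=
    measurable_from_top.comp (Nat.measurable_floor.comp (measurable_id.div_const _))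
  rw [intervalIntegrable_iff]
  refine IntegrableOn.of_bound (by simp) hm.aestronglyMeasurable B ?_
  refine (ae_restrict_iff' measurableSet_uIoc).2 (Eventually.of_forall fun s hs => ?_)
  exact hB s (uIcc_subset_Icc hx hy (uIoc_subset_uIcc hs))

/-- Time integrals of the collision functional converge. -/
theorem IsLimit.tendsto_integral_collision (hk : KernelBounds k θ α lam C)
    (hu : InitialDatum α lam u₀) {U : Ultrafilter ℕ} (hU : (U : Filter ℕ) ≤ atTop)
    {d : ℝ → ℝ → ℝ≥0∞} (hd : ∀ t, 0 ≤ t → IsLimit k θ u₀ U t (d t))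
    {G : ℝ × ℝ × ℝ → ℝ≥0∞} (hG : Measurable G) {b : ℝ≥0} (hb : ∀ p, G p ≤ b)
    {T : ℝ} (hT : 0 ≤ T) :
    ContinuousOn (fun s => (collision k G (d s) (d s)).toReal) (Icc 0 T) ∧
    Tendsto (fun n => (stepSize θ u₀ n : ℝ) * ∑ i ∈ Finset.range ⌊T / stepSize θ u₀ n⌋₊,
      (collision (truncKernel k θ n) G (eulerIter (truncKernel k θ n) (stepSize θ u₀ n) u₀ i)
        (eulerIter (truncKernel k θ n) (stepSize θ u₀ n) u₀ i)).toReal) U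
      (𝓝 (∫ s in (0 : ℝ)..T, (collision k G (d s) (d s)).toReal)) := by
  obtain ⟨B, hB⟩ := collision_approx_bound hk hu T b
  obtain ⟨B', hB'⟩ := IsLimit.collision_bound hk hu T b
  let a : ℕ → ℕ → ℝ := fun n i =>
    (collision (truncKernel k θ n) G (eulerIter (truncKernel k θ n) (stepSize θ u₀ n) u₀ i)
        (eulerIter (truncKernel k θ n) (stepSize θ u₀ n) u₀ i)).toReal
  let g : ℕ → ℝ → ℝ := fun n s => a n ⌊s / stepSize θ u₀ n⌋₊
  have htop : ∀ n, ∀ s ∈ Icc 0 T,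
      collision (truncKernel k θ n) G (approx k θ u₀ n s) (approx k θ u₀ n s) ≠ ∞ :=
    fun n s hs => ne_top_of_le_ne_top ENNReal.coe_ne_top (hB G hb n s hs)
  have htop' : ∀ s ∈ Icc 0 T, collision k G (d s) (d s) ≠ ∞ := fun s hs =>
    ne_top_of_le_ne_top ENNReal.coe_ne_top (hB' G hb s hs U _ (hd s hs.1))
  have hgB : ∀ n, ∀ s ∈ Icc 0 T, |a n ⌊s / stepSize θ u₀ n⌋₊| ≤ B := fun n s hs => by
    rw [abs_of_nonneg ENNReal.toReal_nonneg]
    exact ENNReal.toReal_le_coe_of_le_coe (hB G hb n s hs)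
  have h0T : (0 : ℝ) ∈ Icc 0 T := ⟨le_rfl, hT⟩
  have hTT : T ∈ Icc 0 T := ⟨hT, le_rfl⟩
  have hmain := tendsto_intervalIntegral_of_equicontinuous (l := (U : Filter ℕ)) (g := g)
    (G := fun s => (collision k G (d s) (d s)).toReal) hT
    (fun n => intervalIntegrable_floor _ (a n) h0T hTT (hgB n))
    (fun s hs => (ENNReal.tendsto_toReal (htop' s hs)).comp
      ((hd s hs.1).tendsto_collision hk hu hU hs.1 hG hb))
    (fun ε hε => by
      obtain ⟨δ, hδ, h⟩ := collision_approx_equicontinuous hk hu T hG hb hε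
      refine ⟨δ, hδ, ?_⟩
      filter_upwards [hU h] with n hn s hs t ht hst
      have key : ∀ s ∈ Icc 0 T, ∀ t ∈ Icc 0 T, |t - s| < δ → g n t ≤ g n s + ε := by
        intro s hs t ht hst
        have := ENNReal.toReal_mono (ENNReal.add_ne_top.2 ⟨htop n s hs, ENNReal.ofReal_ne_top⟩)
          (hn s hs t ht hst)
        rwa [ENNReal.toReal_add (htop n s hs) ENNReal.ofReal_ne_top,
          ENNReal.toReal_ofReal hε.le] at this
      have h1 := key s hs t ht hst
      have h2 := key t ht s hs (by rwa [abs_sub_comm])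
      rw [abs_le]
      constructor <;> linarith)
  refine ⟨hmain.1, ?_⟩
  have hdiff : Tendsto (fun n => (∫ s in (0 : ℝ)..T, g n s) -
      (stepSize θ u₀ n : ℝ) * ∑ i ∈ Finset.range ⌊T / stepSize θ u₀ n⌋₊, a n i) U (𝓝 0) := by
    have hBh : Tendsto (fun n => (B : ℝ) * stepSize θ u₀ n) U (𝓝 0) := by
      simpa using ((tendsto_stepSize θ u₀).mono_left hU).const_mul (B : ℝ)
    refine squeeze_zero_norm (fun n => ?_) hBh
    have hh := stepSize_pos θ u₀ n
    have h1 := floor_mul_le hh hT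
    have h2 := lt_floor_mul_add hh T
    have h3 : (⌊T / stepSize θ u₀ n⌋₊ : ℝ) * stepSize θ u₀ n ∈ Icc 0 T :=
      ⟨by positivity, h1⟩
    rw [← intervalIntegral_floor hh (a n) ⌊T / stepSize θ u₀ n⌋₊]
    rw [intervalIntegral.integral_interval_sub_left
      (intervalIntegrable_floor _ (a n) h0T hTT (hgB n))
      (intervalIntegrable_floor _ (a n) h0T h3 (hgB n))]
    refine (intervalIntegral.norm_integral_le_of_norm_le_const (C := B) fun s hs => ?_).trans ?_
    · exact hgB n s (uIcc_subset_Icc h3 hTT (uIoc_subset_uIcc hs))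
    · gcongr
      rw [abs_of_nonneg (by linarith)]
      linarith
  have := hmain.2.sub hdiff
  simpa using this

/-- The weak formulation in the limit, for non-negative bounded test functions. -/
theorem IsLimit.weak_form (hk : KernelBounds k θ α lam C)
    (hu : InitialDatum α lam u₀) {U : Ultrafilter ℕ} (hU : (U : Filter ℕ) ≤ atTop)
    {d : ℝ → ℝ → ℝ≥0∞} (hd : ∀ t, 0 ≤ t → IsLimit k θ u₀ U t (d t))
    {f : ℝ → ℝ≥0∞} (hf : Measurable f) {b : ℝ≥0} (hb : ∀ x, f x ≤ b) {T : ℝ} (hT : 0 ≤ T) :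
    (∫⁻ x, f x * d T x).toReal +
        ∫ s in (0 : ℝ)..T, (collision k (fun p => 2 * f p.1) (d s) (d s)).toReal =
      (∫⁻ x, f x * u₀ x).toReal + ∫ s in (0 : ℝ)..T,
        (collision k (fun p => f (p.1 + p.2.2) + f (p.1 - p.2.2)) (d s) (d s)).toReal := by
  have hm0 : ∫⁻ x, u₀ x ≠ ∞ := hu.mass_ne_top (by linarith [hk.one_lt])
  have hfin : ∀ u : ℝ → ℝ≥0∞, ∫⁻ x, u x = ∫⁻ x, u₀ x → ∫⁻ x, f x * u x ≠ ∞ := by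
    intro u hmass
    refine ne_top_of_le_ne_top (b := b * ∫⁻ x, u₀ x) (by finiteness) ?_
    rw [← hmass, ← lintegral_const_mul' _ _ ENNReal.coe_ne_top]
    exact lintegral_mono fun x => mul_le_mul_left (hb x) _
  have hb1 : ∀ p : ℝ × ℝ × ℝ, 2 * f p.1 ≤ (2 * b : ℝ≥0) := fun p => by
    push_cast; gcongr; exact hb _
  have hb2 : ∀ p : ℝ × ℝ × ℝ, f (p.1 + p.2.2) + f (p.1 - p.2.2) ≤ (2 * b : ℝ≥0) := fun p => by
    push_cast; rw [two_mul]; exact add_le_add (hb _) (hb _)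
  have h1 := (IsLimit.tendsto_integral_collision hk hu hU hd
    (G := fun p => 2 * f p.1) (by fun_prop) hb1 hT).2
  have h2 := (IsLimit.tendsto_integral_collision hk hu hU hd
    (G := fun p => f (p.1 + p.2.2) + f (p.1 - p.2.2)) (by fun_prop) hb2 hT).2
  have h3 := (ENNReal.tendsto_toReal (hfin (d T) ((hd T hT).lintegral_eq hk hu))).comp
    ((hd T hT).tendsto_lintegral hk hu hf hb)
  refine tendsto_nhds_unique (h3.add h1) ((tendsto_const_nhds.add h2).congr fun n => ?_)
  have hs := stable_truncKernel hk hu n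
  have hwf := hs.weak_form hf ⌊T / stepSize θ u₀ n⌋₊
  obtain ⟨B, hB⟩ := CGEDG.collision_bound θ hu C T
  have hcfin : ∀ G : ℝ × ℝ × ℝ → ℝ≥0∞, (∀ p, G p ≤ (2 * b : ℝ≥0)) →
      ∀ i ∈ Finset.range ⌊T / stepSize θ u₀ n⌋₊,
      collision (truncKernel k θ n) G (eulerIter (truncKernel k θ n) (stepSize θ u₀ n) u₀ i)
        (eulerIter (truncKernel k θ n) (stepSize θ u₀ n) u₀ i) ≠ ∞ := by
    intro G hG i hi
    have hm := hs.measurable_iter i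
    have hiT : (i : ℝ) * stepSize θ u₀ n ≤ T :=
      le_trans (by gcongr; exact (Finset.mem_range.1 hi).le)
        (floor_mul_le (stepSize_pos θ u₀ n) hT)
    refine ne_top_of_le_ne_top (b := (2 * b : ℝ≥0) * B) (by finiteness) ?_
    refine le_trans (collision_mono (G' := fun _ => (2 * b : ℝ≥0) * 1) fun p _ => ?_) ?_
    · rw [mul_one]; exact hG p
    · rw [collision_const_mul hs.bounds.measurable hm hm measurable_const]
      gcongr
      exact hB _ _ hs i hiT
  have hsumfin : ∀ G : ℝ × ℝ × ℝ → ℝ≥0∞, (∀ p, G p ≤ (2 * b : ℝ≥0)) →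
      ∑ i ∈ Finset.range ⌊T / stepSize θ u₀ n⌋₊,
      collision (truncKernel k θ n) G (eulerIter (truncKernel k θ n) (stepSize θ u₀ n) u₀ i)
        (eulerIter (truncKernel k θ n) (stepSize θ u₀ n) u₀ i) ≠ ∞ := fun G hG =>
    ENNReal.sum_ne_top.2 (hcfin G hG)
  have hreal := congrArg ENNReal.toReal hwf
  rw [ENNReal.toReal_add (hfin _ (hs.lintegral_iter _))
      (ENNReal.mul_ne_top ENNReal.coe_ne_top (hsumfin _ hb1)),
    ENNReal.toReal_add (hfin _ rfl) (ENNReal.mul_ne_top ENNReal.coe_ne_top (hsumfin _ hb2)),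
    ENNReal.toReal_mul, ENNReal.toReal_mul, ENNReal.toReal_sum (hcfin _ hb1),
    ENNReal.toReal_sum (hcfin _ hb2), ENNReal.coe_toReal] at hreal
  exact hreal.symm

end

/-! ### Second differences of the kernel -/

/-- A function that vanishes on `(0, z)` may be extended by zero to `(-∞, 0]`. -/
theorem hasDerivAt_extend_zero {f : ℝ → ℝ} {z : ℝ} (hz : 0 < z) (hd : DifferentiableOn ℝ f (Ioi 0))
    (h0 : ∀ x, 0 < x → x < z → f x = 0) (x : ℝ) :
    HasDerivAt (fun x => if 0 < x then f x else 0) (if 0 < x then deriv f x else 0) x := by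
  rcases lt_or_ge 0 x with hx | hx
  · rw [if_pos hx]
    refine ((hd.differentiableAt (Ioi_mem_nhds hx)).hasDerivAt).congr_of_eventuallyEq ?_
    filter_upwards [Ioi_mem_nhds hx] with y hy
    exact if_pos hy
  · rw [if_neg (not_lt.2 hx)]
    refine (hasDerivAt_const x (0 : ℝ)).congr_of_eventuallyEq ?_
    filter_upwards [Iio_mem_nhds (hx.trans_lt hz)] with y hy
    split_ifs with h
    · exact h0 y h hy
    · rfl

theorem deriv_eq_zero_of_vanishing {f : ℝ → ℝ} {z : ℝ} (h0 : ∀ x, 0 < x → x < z → f x = 0) (x : ℝ)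
    (hx : 0 < x) (hxz : x < z) : deriv f x = 0 := by
  have : f =ᶠ[𝓝 x] fun _ => 0 := by
    filter_upwards [Ioi_mem_nhds hx, Iio_mem_nhds hxz] with y hy hyz
    exact h0 y hy hyz
  rw [this.deriv_eq, deriv_const]

/-- A one-sided bound on the second derivative bounds the second differences, also across the
point `z` below which the function vanishes. -/
theorem second_difference_extend_le {f : ℝ → ℝ} {z M : ℝ} (hz : 0 < z) (hM : 0 ≤ M)
    (hd : DifferentiableOn ℝ f (Ioi 0)) (hd2 : DifferentiableOn ℝ (deriv f) (Ioi 0))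
    (hf2 : ∀ x, 0 < x → deriv (deriv f) x ≤ M) (h0 : ∀ x, 0 < x → x < z → f x = 0) (x : ℝ) :
    (if z < x - z then f (x - z) else 0) + (if z < x + z then f (x + z) else 0) ≤
      2 * (if z < x then f x else 0) + M * z ^ 2 := by
  set F : ℝ → ℝ := fun x => if 0 < x then f x else 0 with hF
  set F1 : ℝ → ℝ := fun x => if 0 < x then deriv f x else 0 with hF1
  set F2 : ℝ → ℝ := fun x => if 0 < x then deriv (deriv f) x else 0 with hF2
  have hd1 : ∀ x, HasDerivAt F (F1 x) x := hasDerivAt_extend_zero hz hd h0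
  have hd2' : ∀ x, HasDerivAt F1 (F2 x) x :=
    hasDerivAt_extend_zero hz hd2 (deriv_eq_zero_of_vanishing h0)
  have hfz : f z = 0 := by
    have hc : ContinuousAt f z := (hd.differentiableAt (Ioi_mem_nhds hz)).continuousAt
    have h1 : Tendsto f (𝓝[<] z) (𝓝 (f z)) := hc.tendsto.mono_left nhdsWithin_le_nhds
    have h2 : Tendsto f (𝓝[<] z) (𝓝 0) := by
      refine tendsto_const_nhds.congr' ?_
      filter_upwards [Ioo_mem_nhdsLT hz] with y hy
      exact (h0 y hy.1 hy.2).symm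
    exact tendsto_nhds_unique h1 h2
  have hFeq : ∀ x, (if z < x then f x else 0) = F x := by
    intro x
    simp only [hF]
    split_ifs with h1 h2 h2
    · rfl
    · exact absurd (hz.trans h1) h2
    · rcases (not_lt.1 h1).lt_or_eq with h | h
      · exact (h0 x h2 h).symm
      · rw [h, hfz]
    · rfl
  rw [hFeq, hFeq, hFeq]
  have e1 : ∀ x, HasDerivAt (fun x => F x - M / 2 * x ^ 2) (F1 x - M * x) x := by
    intro x
    have := (hd1 x).sub (((hasDerivAt_id x).pow 2).const_mul (M / 2))
    refine this.congr_deriv ?_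
    simp; ring
  have e2 : ∀ x, HasDerivAt (fun x => F1 x - M * x) (F2 x - M) x := by
    intro x
    have := (hd2' x).sub ((hasDerivAt_id x).const_mul M)
    refine this.congr_deriv ?_
    simp
  have hderiv : deriv (fun x => F x - M / 2 * x ^ 2) = fun x => F1 x - M * x :=
    funext fun x => (e1 x).deriv
  -- Semiconcavity: subtracting `M x² / 2` makes the second derivative non-positive.
  have hconc : ConcaveOn ℝ univ fun x => F x - M / 2 * x ^ 2 := by
    refine concaveOn_univ_of_deriv2_nonpos (fun x => (e1 x).differentiableAt) ?_ fun x => ?_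
    · rw [hderiv]; exact fun x => (e2 x).differentiableAt
    · simp only [Function.iterate_succ, Function.iterate_zero, Function.comp_apply, id, hderiv,
        (e2 x).deriv, hF2]
      split_ifs with h
      · linarith [hf2 x h]
      · linarith
  have := hconc.2 (mem_univ (x - z)) (mem_univ (x + z)) (show (0 : ℝ) ≤ 1 / 2 by norm_num)
    (show (0 : ℝ) ≤ 1 / 2 by norm_num) (by norm_num)
  simp only [smul_eq_mul] at this
  have hmid : 1 / 2 * (x - z) + 1 / 2 * (x + z) = x := by ring
  rw [hmid] at this
  nlinarith

/-! ### The kernel as an extended non-negative function on `ℝ³` -/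

/-- The region `0 < z < x`, `z < y`, without a null set `N` of values of `z`. -/
def activeSet (N : Set ℝ) : Set (ℝ × ℝ × ℝ) :=
  {p | 0 < p.2.2 ∧ p.2.2 < p.1 ∧ p.2.2 < p.2.1 ∧ p.2.2 ∉ N}

/-- The kernel `K`, extended by zero outside the set where `0 < z < x` and `z < y`, and set to
zero for `z` in a null set `N` where `φ` differs from its measurable representative. -/
noncomputable def extendedKernel (K : ℝ → ℝ → ℝ → ℝ) (N : Set ℝ) : ℝ × ℝ × ℝ → ℝ≥0∞ :=
  (activeSet N).indicator fun p =>
    ENNReal.ofReal (K p.1.toNNReal p.2.1.toNNReal p.2.2.toNNReal)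

/-- The dependence `ẑ ^ (-2α) φ(z)` of the kernel bounds on `z`: for `z < x` and `z < y` all
singularities of `x̂` and `ŷ` are transferred to `z`. -/
noncomputable def transferWeight (φ : ℝ → ℝ) (α : ℝ) : ℝ → ℝ≥0∞ :=
  (Ioi 0).indicator fun z => ENNReal.ofReal (hat z ^ (-(2 * α)) * φ z)

section Extended

variable {K : ℝ → ℝ → ℝ → ℝ} {φ φ' : ℝ → ℝ} {α μ ν : ℝ} {N : Set ℝ}

theorem measurable_extendedKernel (hK : GlobalAssumption K) (hN : MeasurableSet N) :
    Measurable (extendedKernel K N) := by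
  refine Measurable.indicator ?_ ?_
  · have : Measurable fun p : ℝ × ℝ × ℝ => (p.1.toNNReal, p.2.1.toNNReal, p.2.2.toNNReal) := by
      fun_prop
    exact (hK.measurable.comp this).ennreal_ofReal
  · have h1 : Measurable fun p : ℝ × ℝ × ℝ => p.2.2 := by fun_prop
    refine (measurableSet_lt measurable_const h1).inter
      ((measurableSet_lt h1 measurable_fst).inter ((measurableSet_lt h1 (by fun_prop)).inter ?_))
    exact (h1 hN).compl

theorem extendedKernel_of_mem {x y z : ℝ} (hz : 0 < z) (hx : z < x) (hy : z < y) (hN : z ∉ N) :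
    extendedKernel K N (x, y, z) = ENNReal.ofReal (K x y z) := by
  rw [extendedKernel, indicator_of_mem (show (x, y, z) ∈ activeSet N from ⟨hz, hx, hy, hN⟩)]
  simp only [Real.coe_toNNReal _ hz.le, Real.coe_toNNReal _ (hz.trans hx).le,
    Real.coe_toNNReal _ (hz.trans hy).le]

theorem extendedKernel_supp {x y z : ℝ} (h : extendedKernel K N (x, y, z) ≠ 0) :
    0 < z ∧ z < x ∧ z < y ∧ z ∉ N := by
  by_contra hne
  exact h (indicator_of_notMem (show (x, y, z) ∉ activeSet N from hne) _)

theorem hat_pos {x : ℝ} (hx : 0 < x) : 0 < hat x := lt_min one_pos hx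

theorem hat_rpow_anti {z x a : ℝ} (ha : 0 ≤ a) (hz : 0 < z) (h : z ≤ x) :
    hat x ^ (-a) ≤ hat z ^ (-a) :=
  Real.rpow_le_rpow_of_nonpos (hat_pos hz) (min_le_min_left _ h) (by linarith)

theorem one_le_hat_rpow {z a : ℝ} (ha : 0 ≤ a) (hz : 0 < z) : 1 ≤ hat z ^ (-a) :=
  Real.one_le_rpow_of_pos_of_le_one_of_nonpos (hat_pos hz) (min_le_left _ _) (by linarith)

theorem hat_rpow_two_mul {z a : ℝ} (hz : 0 < z) :
    hat z ^ (-(2 * a)) = hat z ^ (-a) * hat z ^ (-a) := by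
  rw [← Real.rpow_add (hat_pos hz)]; congr 1; ring

theorem ExistenceAssumption.phi_nonneg (hK : GlobalAssumption K) (hE : ExistenceAssumption K φ α μ ν)
    {z : ℝ} (hz : 0 < z) : 0 ≤ φ z := by
  have h1 := hE.bound 1 1 z one_pos one_pos hz
  have h2 := hK.nonneg 1 1 z zero_le_one zero_le_one hz.le
  simp [hat, check] at h1
  linarith

/-- The growth bound, with the singularities at small `x` and `y` transferred to `z`. -/
theorem ExistenceAssumption.growth (hK : GlobalAssumption K) (hE : ExistenceAssumption K φ α μ ν)
    {x y z : ℝ} (hz : 0 < z) (hx : z < x) (hy : z < y) :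
    K x y z ≤ 2⁻¹ * (check x ^ μ * check y ^ ν + check x ^ ν * check y ^ μ) *
      (hat z ^ (-(2 * α)) * φ z) := by
  have hφ := hE.phi_nonneg hK hz
  have hα := hE.alpha_nonneg
  have c1 := check_pos x
  have c2 := check_pos y
  have hw := hat_rpow_two_mul (a := α) hz
  have h1 := hat_rpow_anti hα hz hx.le
  have h2 := hat_rpow_anti hα hz hy.le
  have p1 : 0 ≤ hat y ^ (-α) := (Real.rpow_pos_of_pos (hat_pos (hz.trans hy)) _).le
  have p2 : 0 ≤ hat z ^ (-α) := (Real.rpow_pos_of_pos (hat_pos hz) _).le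
  have h3 : hat x ^ (-α) * hat y ^ (-α) ≤ hat z ^ (-(2 * α)) := by
    rw [hw]; exact mul_le_mul h1 h2 p1 p2
  calc K x y z ≤ _ := hE.bound x y z (hz.trans hx) (hz.trans hy) hz
    _ = (hat x ^ (-α) * hat y ^ (-α)) *
        ((2⁻¹ * (check x ^ μ * check y ^ ν + check x ^ ν * check y ^ μ)) * φ z) := by ring
    _ ≤ hat z ^ (-(2 * α)) *
        ((2⁻¹ * (check x ^ μ * check y ^ ν + check x ^ ν * check y ^ μ)) * φ z) := by gcongr
    _ = _ := by ring

theorem transferWeight_of_eq {z : ℝ} (hz : 0 < z) (hφ : φ z = φ' z) :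
    transferWeight φ' α z = ENNReal.ofReal (hat z ^ (-(2 * α)) * φ z) := by
  rw [transferWeight, indicator_of_mem (show z ∈ Ioi (0 : ℝ) from hz), hφ]

theorem ExistenceAssumption.moment (hE : ExistenceAssumption K φ α μ ν)
    (hφ : ∀ᵐ z ∂(volume.restrict (Ioi (0 : ℝ))), φ z = φ' z) :
    ∫⁻ z, ENNReal.ofReal (1 + z ^ 2) * transferWeight φ' α z ≠ ∞ := by
  have hint := hE.phi_mem.1.2
  have hl := hE.one_lt
  have hα := hE.alpha_nonneg
  have hfin := (hint.const_mul 2).lintegral_lt_top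
  refine ne_top_of_le_ne_top hfin.ne ?_
  have hind : ∀ z, ENNReal.ofReal (1 + z ^ 2) * transferWeight φ' α z =
      (Ioi (0 : ℝ)).indicator (fun z => ENNReal.ofReal (1 + z ^ 2) *
        ENNReal.ofReal (hat z ^ (-(2 * α)) * φ' z)) z := by
    intro z
    rw [transferWeight, indicator_apply, indicator_apply]
    split_ifs <;> simp
  simp_rw [hind]
  rw [lintegral_indicator measurableSet_Ioi]
  refine lintegral_mono_ae ?_
  filter_upwards [hφ, ae_restrict_mem measurableSet_Ioi] with z hz hz0
  have hz0' : (0 : ℝ) < z := hz0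
  rw [← hz, ← ENNReal.ofReal_mul (by positivity)]
  refine ENNReal.ofReal_le_ofReal ?_
  have h1 : (1 + z ^ 2) * hat z ^ (-(2 * α)) ≤ 2 * (z ^ (-(2 * α)) + z ^ (2 * max μ ν)) := by
    rcases le_total z 1 with h | h
    · rw [hat, min_eq_right h]
      have p1 : 0 ≤ z ^ (-(2 * α)) := Real.rpow_nonneg hz0'.le _
      have p2 : 0 ≤ z ^ (2 * max μ ν) := Real.rpow_nonneg hz0'.le _
      have : z ^ 2 ≤ 1 := pow_le_one₀ hz0'.le h
      nlinarith
    · rw [hat, min_eq_left h, Real.one_rpow, mul_one]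
      have p1 : 0 ≤ z ^ (-(2 * α)) := Real.rpow_nonneg hz0'.le _
      have p2 : z ^ (2 : ℝ) ≤ z ^ (2 * max μ ν) :=
        Real.rpow_le_rpow_of_exponent_le h (by linarith)
      rw [show z ^ (2 : ℝ) = z ^ 2 by exact_mod_cast Real.rpow_natCast z 2] at p2
      nlinarith
  have h2 : 0 ≤ hat z ^ (-(2 * α)) := (Real.rpow_pos_of_pos (hat_pos hz0') _).le
  calc (1 + z ^ 2) * (hat z ^ (-(2 * α)) * φ z)
      ≤ (1 + z ^ 2) * (hat z ^ (-(2 * α)) * |φ z|) := by gcongr; exact le_abs_self _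
    _ = ((1 + z ^ 2) * hat z ^ (-(2 * α))) * |φ z| := by ring
    _ ≤ 2 * (z ^ (-(2 * α)) + z ^ (2 * max μ ν)) * |φ z| := by gcongr
    _ = _ := by ring

/-- The assumptions on `K` in the form used for the a priori estimates. -/
theorem kernelBounds_extendedKernel (hK : GlobalAssumption K) (hE : ExistenceAssumption K φ α μ ν)
    (hφ' : Measurable φ') (hN : MeasurableSet N) (hN0 : volume N = 0)
    (hφ : ∀ z, 0 < z → z ∉ N → φ z = φ' z) :
    ∃ C, KernelBounds (extendedKernel K N) (transferWeight φ' α) α (max μ ν) C := by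
  have hα := hE.alpha_nonneg
  have hμ := hE.mu_mem
  have hν := hE.nu_mem
  have hμν := hE.add_le
  set lam := max μ ν with hlam
  have hμl : μ ≤ lam := le_max_left _ _
  have hνl : ν ≤ lam := le_max_right _ _
  have hl2 : lam ≤ 2 := max_le hμ.2 hν.2
  have growth : ∀ x y z, extendedKernel K N (x, y, z) ≤
      farWeight lam x * farWeight lam y * transferWeight φ' α z := by
    intro x y z
    by_cases hne : extendedKernel K N (x, y, z) = 0
    · rw [hne]; exact zero_le
    obtain ⟨hz, hx, hy, hzN⟩ := extendedKernel_supp hne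
    have hφ0 := hE.phi_nonneg hK hz
    have c1 := check_pos x
    have c2 := check_pos y
    have c3 := hat_pos hz
    rw [extendedKernel_of_mem hz hx hy hzN, transferWeight_of_eq hz (hφ z hz hzN), farWeight,
      farWeight, ← ENNReal.ofReal_mul (by positivity), ← ENNReal.ofReal_mul (by positivity)]
    refine ENNReal.ofReal_le_ofReal ((hE.growth hK hz hx hy).trans ?_)
    have h1 : check x ^ μ * check y ^ ν ≤ check x ^ lam * check y ^ lam := by
      gcongr <;> exact one_le_check _
    have h2 : check x ^ ν * check y ^ μ ≤ check x ^ lam * check y ^ lam := by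
      gcongr <;> exact one_le_check _
    exact mul_le_mul_of_nonneg_right (by linarith) (by positivity)
  have hC : ∃ C : ℝ≥0, ∀ x y z, 0 < z → z < x → z < y → z ∉ N →
      ENNReal.ofReal (hat (x - z) ^ (-α)) * ENNReal.ofReal (K x y z) ≤
      C * ENNReal.ofReal (hat z ^ (-(2 * α)) * (hat y ^ (-α) * check x ^ lam * check y ^ lam *
        φ z)) := by
    rcases hα.eq_or_lt with h0 | h0
    · refine ⟨1, fun x y z hz hx hy hzN => ?_⟩
      have := growth x y z
      have hφ0 := hE.phi_nonneg hK hz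
      have c1 := check_pos x
      have c2 := check_pos y
      rw [extendedKernel_of_mem hz hx hy hzN, transferWeight_of_eq hz (hφ z hz hzN), farWeight,
        farWeight, ← ENNReal.ofReal_mul (by positivity), ← ENNReal.ofReal_mul (by positivity)]
        at this
      rw [← h0] at this ⊢
      simpa [mul_assoc] using this
    · obtain ⟨C, hC0, hC⟩ := hE.singular h0
      refine ⟨C.toNNReal, fun x y z hz hx hy hzN => ?_⟩
      have c1 := check_pos x
      have c2 := check_pos y
      have c3 := hat_pos hz
      have c4 := hat_pos (hz.trans hy)
      have hφ0 := hE.phi_nonneg hK hz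
      have h1 := hat_rpow_anti (a := 2 * α) (by linarith) hz hx.le
      rw [← ENNReal.ofReal_mul (Real.rpow_nonneg (hat_pos (sub_pos.2 hx)).le _)]
      change _ ≤ ENNReal.ofReal C * _
      rw [← ENNReal.ofReal_mul hC0.le]
      refine ENNReal.ofReal_le_ofReal ((hC x y z (hz.trans hy) hz hx).trans ?_)
      calc C * hat x ^ (-(2 * α)) * hat y ^ (-α) * check x ^ max μ ν * check y ^ max μ ν * φ z
          = C * (hat x ^ (-(2 * α)) * (hat y ^ (-α) * check x ^ lam * check y ^ lam * φ z)) := by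
            rw [hlam]; ring
        _ ≤ _ := by gcongr
  obtain ⟨C, hC⟩ := hC
  refine ⟨C, ?_⟩
  refine
    { measurable := measurable_extendedKernel hK hN
      measurable_theta := Measurable.indicator
        ((measurable_hat.pow_const _).mul hφ').ennreal_ofReal measurableSet_Ioi
      one_lt := hE.one_lt
      le_two := hl2
      alpha_nonneg := hα
      moment := hE.moment ?_
      supp := fun x y z h =>
        ⟨(extendedKernel_supp h).1, (extendedKernel_supp h).2.1, (extendedKernel_supp h).2.2.1⟩
      growth := growth
      growth_sub_two := ?_
      second_difference := ?_
      singular := ?_ }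
  · rw [ae_restrict_iff' measurableSet_Ioi]
    have : ∀ᵐ z, z ∉ N := measure_eq_zero_iff_ae_notMem.1 hN0
    filter_upwards [this] with z hz hz0
    exact hφ z hz0 hz
  · intro x y z
    by_cases hne : extendedKernel K N (x, y, z) = 0
    · rw [hne, mul_zero]; exact zero_le
    obtain ⟨hz, hx, hy, hzN⟩ := extendedKernel_supp hne
    have hφ0 := hE.phi_nonneg hK hz
    have c1 := check_pos x
    have c2 := check_pos y
    have c3 := hat_pos hz
    have hK0 := hK.nonneg x y z (hz.trans hx).le (hz.trans hy).le hz.le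
    rw [extendedKernel_of_mem hz hx hy hzN, transferWeight_of_eq hz (hφ z hz hzN)]
    simp only [farWeight, Real.rpow_one]
    rw [← ENNReal.ofReal_mul (by positivity), ← ENNReal.ofReal_mul (by positivity),
      ← ENNReal.ofReal_mul (by positivity), ← ENNReal.ofReal_add (by positivity) (by positivity),
      ← ENNReal.ofReal_mul (by positivity)]
    refine ENNReal.ofReal_le_ofReal ?_
    have h1 := rpow_mul_rpow_le (lam := lam) (a := lam - 2 + μ) (b := ν) (one_le_check x)
      (one_le_check y) (by linarith [hμ.2]) hνl (by linarith)
    have h2 := rpow_mul_rpow_le (lam := lam) (a := lam - 2 + ν) (b := μ) (one_le_check x)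
      (one_le_check y) (by linarith [hν.2]) hμl (by linarith)
    rw [Real.rpow_add c1] at h1 h2
    calc check x ^ (lam - 2) * K x y z
        ≤ check x ^ (lam - 2) * (2⁻¹ * (check x ^ μ * check y ^ ν + check x ^ ν * check y ^ μ) *
          (hat z ^ (-(2 * α)) * φ z)) := by
          gcongr; exact hE.growth hK hz hx hy
      _ = 2⁻¹ * (check x ^ (lam - 2) * check x ^ μ * check y ^ ν +
          check x ^ (lam - 2) * check x ^ ν * check y ^ μ) * (hat z ^ (-(2 * α)) * φ z) := by ring
      _ ≤ _ := by
          gcongr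
          linarith
  · intro x y z
    by_cases hyz : 0 < z ∧ z < y ∧ z ∉ N
    swap
    · have hzero : ∀ x', extendedKernel K N (x', y, z) = 0 := fun x' => by
        by_contra hne
        obtain ⟨a1, -, a2, a3⟩ := extendedKernel_supp hne
        exact hyz ⟨a1, a2, a3⟩
      rw [hzero, hzero, add_zero]; exact zero_le
    obtain ⟨hz, hy, hzN⟩ := hyz
    have hy0 := hz.trans hy
    have hφ0 := hE.phi_nonneg hK hz
    have c2 := check_pos y
    have c3 := hat_pos hz
    have c4 := hat_pos hy0
    have hk : ∀ x', extendedKernel K N (x', y, z) =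
        ENNReal.ofReal (if z < x' then K x' y z else 0) := by
      intro x'
      split_ifs with h
      · exact extendedKernel_of_mem hz h hy hzN
      · rw [ENNReal.ofReal_zero]
        by_contra hne
        exact h (extendedKernel_supp hne).2.1
    have hnn : ∀ x', 0 ≤ if z < x' then K x' y z else 0 := by
      intro x'
      split_ifs with h
      · exact hK.nonneg x' y z (hz.trans h).le hy0.le hz.le
      · exact le_rfl
    have key := second_difference_extend_le (f := fun x' => K x' y z)
      (M := hat y ^ (-α) * check y ^ lam * φ z) hz (by positivity) (hE.diff y z hy0 hz)
      (hE.diff_deriv y z hy0 hz) (fun x' hx' => hE.deriv2_le x' y z hx' hy0 hz)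
      (fun x' hx' hxz => hK.eq_zero x' y z hx'.le hy0.le hz.le hxz) x
    have h1 : hat y ^ (-α) ≤ hat z ^ (-(2 * α)) := by
      rw [hat_rpow_two_mul hz]
      have e1 := hat_rpow_anti hα hz hy.le
      have e2 := one_le_hat_rpow hα hz
      nlinarith
    have h2 : hat y ^ (-α) * check y ^ lam * φ z * z ^ 2 ≤
        z ^ 2 * check y ^ lam * (hat z ^ (-(2 * α)) * φ z) := by
      calc hat y ^ (-α) * check y ^ lam * φ z * z ^ 2
          ≤ hat z ^ (-(2 * α)) * check y ^ lam * φ z * z ^ 2 := by gcongr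
        _ = _ := by ring
    have e2 : (2 : ℝ≥0∞) = ENNReal.ofReal 2 := by simp
    have n1 := hnn x
    have n2 := hnn (x - z)
    have n3 := hnn (x + z)
    rw [hk, hk, hk, transferWeight_of_eq hz (hφ z hz hzN), farWeight, e2,
      ← ENNReal.ofReal_add n2 n3, ← ENNReal.ofReal_mul (by norm_num),
      ← ENNReal.ofReal_mul (by positivity), ← ENNReal.ofReal_mul (by positivity),
      ← ENNReal.ofReal_add (by linarith) (by positivity)]
    exact ENNReal.ofReal_le_ofReal (key.trans (add_le_add_right h2 _))
  · intro x y z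
    by_cases hne : extendedKernel K N (x, y, z) = 0
    · rw [hne, mul_zero]; exact zero_le
    obtain ⟨hz, hx, hy, hzN⟩ := extendedKernel_supp hne
    have hφ0 := hE.phi_nonneg hK hz
    have c1 := check_pos x
    have c2 := check_pos y
    have c3 := hat_pos hz
    have c4 := hat_pos (hz.trans hy)
    rw [extendedKernel_of_mem hz hx hy hzN, transferWeight_of_eq hz (hφ z hz hzN), nearWeight]
    refine (hC x y z hz hx hy hzN).trans (le_of_eq ?_)
    simp only [farWeight, nearWeight]
    rw [← ENNReal.ofReal_mul (by positivity), ← ENNReal.ofReal_mul (by positivity),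
      ← ENNReal.ofReal_mul (by positivity)]
    congr 2
    ring

end Extended

/-! ### From densities in `[0, ∞]` to real densities -/

section Transfer

theorem ae_shift {β : Type*} [MeasurableSpace β] {ν : Measure β} [SFinite ν] {P : ℝ → Prop}
    (h : ∀ᵐ x, P x) {s : β → ℝ} (hs : Measurable s) :
    ∀ᵐ p ∂((volume : Measure ℝ).prod ν), P (p.1 + s p.2) := by
  set S := toMeasurable volume {x | ¬P x} with hS
  have hSm : MeasurableSet S := measurableSet_toMeasurable _ _
  have hS0 : volume S = 0 := by rw [hS, measure_toMeasurable]; exact h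
  have hE : MeasurableSet {p : ℝ × β | p.1 + s p.2 ∈ S} :=
    (measurable_fst.add (hs.comp measurable_snd)) hSm
  have hE0 : ((volume : Measure ℝ).prod ν) {p : ℝ × β | p.1 + s p.2 ∈ S} = 0 := by
    rw [Measure.prod_apply_symm hE]
    refine (lintegral_congr fun q => ?_).trans lintegral_zero
    change volume ((fun x => x + s q) ⁻¹' S) = 0
    rw [measure_preimage_add_right, hS0]
  refine measure_mono_null (fun p hp => ?_) hE0
  exact subset_toMeasurable _ _ hp

theorem ae_snd {P : ℝ × ℝ → Prop} (h : ∀ᵐ q, P q) : ∀ᵐ p : ℝ × ℝ × ℝ, P p.2 :=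
  Measure.quasiMeasurePreserving_snd.ae h

/-- Almost every point of `ℝ³` with `0 ≤ z ≤ x` and `z ≤ y` is active. -/
theorem ae_mem_activeSet {N : Set ℝ} (hN0 : volume N = 0) : ∀ᵐ p : ℝ × ℝ × ℝ,
    0 ≤ p.2.2 → p.2.2 ≤ p.1 → p.2.2 ≤ p.2.1 → p ∈ activeSet N := by
  have hne : ∀ᵐ x : ℝ, x ≠ 0 := by simp [ae_iff]
  have h1 : ∀ᵐ p : ℝ × ℝ × ℝ, p.1 + -p.2.2 ≠ 0 :=
    ae_shift hne (s := fun q : ℝ × ℝ => -q.2) (by fun_prop)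
  have h2 : ∀ᵐ p : ℝ × ℝ × ℝ, p.2.1 + -p.2.2 ≠ 0 :=
    ae_snd (P := fun q => q.1 + -q.2 ≠ 0) (ae_shift hne (s := fun z : ℝ => -z) (by fun_prop))
  have h3 : ∀ᵐ z : ℝ, z ≠ 0 ∧ z ∉ N := hne.and (measure_eq_zero_iff_ae_notMem.1 hN0)
  have h4 : ∀ᵐ p : ℝ × ℝ × ℝ, p.2.2 ≠ 0 ∧ p.2.2 ∉ N :=
    ae_snd (P := fun q => q.2 ≠ 0 ∧ q.2 ∉ N) (Measure.quasiMeasurePreserving_snd.ae h3)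
  filter_upwards [h1, h2, h4] with p e1 e2 e3 a1 a2 a3
  refine ⟨lt_of_le_of_ne a1 (Ne.symm e3.1), lt_of_le_of_ne a2 fun h => e1 ?_,
    lt_of_le_of_ne a3 fun h => e2 ?_, e3.2⟩ <;> rw [← h] <;> ring

/-- A bounded test function is, up to a constant and a null set, a bounded measurable function
with values in `[0, ∞]`. -/
theorem MemLinf.exists_shift {f : ℝ → ℝ} (hf : MemLinf f) :
    ∃ (M : ℝ) (b : ℝ≥0) (g : ℝ → ℝ≥0∞), Measurable g ∧ (∀ x, g x ≤ b) ∧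
      ∀ᵐ x, 0 < x → f x = (g x).toReal - M := by
  obtain ⟨hm, hfin⟩ := hf
  set M := (eLpNorm f ∞ (volume.restrict (Ioi (0 : ℝ)))).toReal with hM
  have hbound : ∀ᵐ x ∂(volume.restrict (Ioi (0 : ℝ))), |f x| ≤ M := by
    have h1 := ae_le_eLpNormEssSup (f := f) (μ := volume.restrict (Ioi (0 : ℝ)))
    filter_upwards [h1] with x hx
    rw [← eLpNorm_exponent_top] at hx
    have := ENNReal.toReal_mono hfin.ne hx
    rwa [toReal_enorm, Real.norm_eq_abs] at this
  let g : ℝ → ℝ≥0∞ := fun x => ENNReal.ofReal (min (2 * M) (hm.mk f x + M))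
  have hmk := hm.stronglyMeasurable_mk.measurable
  refine ⟨M, (2 * M).toNNReal, g, by fun_prop,
    fun x => ENNReal.ofReal_le_ofReal (min_le_left _ _), ?_⟩
  refine (ae_restrict_iff' (measurableSet_Ioi (a := (0 : ℝ)))).1 ?_
  filter_upwards [hm.ae_eq_mk, hbound] with x h1 h2
  rw [abs_le] at h2
  simp only [g]
  rw [← h1, min_eq_right (by linarith), ENNReal.toReal_ofReal (by linarith)]
  ring

theorem setIntegral_mul_eq {u g : ℝ → ℝ≥0∞} (hu : Measurable u) (hlt : ∀ x, u x < ∞)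
    (hz : ∀ x ≤ 0, u x = 0) (hfin : ∫⁻ x, u x ≠ ∞) (hg : Measurable g) (hglt : ∀ x, g x < ∞)
    (hgfin : ∫⁻ x, g x * u x ≠ ∞) {c f : ℝ → ℝ} {M : ℝ}
    (hc : ∀ᵐ x, 0 < x → c x = (u x).toReal) (hf : ∀ᵐ x, 0 < x → f x = (g x).toReal - M) :
    IntegrableOn (fun x => f x * c x) (Ioi 0) ∧
      ∫ x in Ioi (0 : ℝ), f x * c x = (∫⁻ x, g x * u x).toReal - M * (∫⁻ x, u x).toReal := by
  have h1 : Integrable fun x => (g x * u x).toReal :=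
    integrable_toReal_of_lintegral_ne_top (hg.mul hu).aemeasurable hgfin
  have h2 : Integrable fun x => M * (u x).toReal :=
    (integrable_toReal_of_lintegral_ne_top hu.aemeasurable hfin).const_mul M
  have hae : (fun x => f x * c x) =ᵐ[volume.restrict (Ioi (0 : ℝ))]
      fun x => (g x * u x).toReal - M * (u x).toReal := by
    refine (ae_restrict_iff' measurableSet_Ioi).2 ?_
    filter_upwards [hc, hf] with x e1 e2 hx
    rw [e1 hx, e2 hx, ENNReal.toReal_mul]; ring
  refine ⟨(h1.sub h2).integrableOn.congr hae.symm, ?_⟩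
  rw [integral_congr_ae hae, setIntegral_eq_integral_of_forall_compl_eq_zero fun x hx => by
      rw [hz x (not_lt.1 hx)]; simp,
    integral_sub h1 h2, integral_const_mul,
    integral_toReal (f := fun x => g x * u x) (hg.mul hu).aemeasurable
      (Eventually.of_forall fun x => ENNReal.mul_lt_top (hglt x) (hlt x)),
    integral_toReal hu.aemeasurable (Eventually.of_forall hlt)]

variable {K : ℝ → ℝ → ℝ → ℝ} {N : Set ℝ} {u : ℝ → ℝ≥0∞}

theorem collision_integrand_toReal (hK : GlobalAssumption K) {G : ℝ × ℝ × ℝ → ℝ≥0∞}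
    {p : ℝ × ℝ × ℝ} (hp : p ∈ activeSet N) :
    (G p * extendedKernel K N p * (u p.1 * u p.2.1)).toReal =
      (G p).toReal * kappa K (fun x => (u x).toReal) p.1 p.2.1 p.2.2 := by
  obtain ⟨hz, hx, hy, hzN⟩ := hp
  have hK0 := hK.nonneg p.1 p.2.1 p.2.2 (hz.trans hx).le (hz.trans hy).le hz.le
  have := extendedKernel_of_mem (K := K) hz hx hy hzN
  rw [show (p.1, p.2.1, p.2.2) = p from rfl] at this
  rw [this, kappa]
  simp only [ENNReal.toReal_mul, ENNReal.toReal_ofReal hK0]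
  ring

theorem extendedKernel_of_notMem {p : ℝ × ℝ × ℝ} (hp : p ∉ activeSet N) :
    extendedKernel K N p = 0 := indicator_of_notMem hp _

/-- The weak form of the collision operator as a difference of gain and loss. -/
theorem weakForm_eq (hK : GlobalAssumption K) (hN : MeasurableSet N) (hN0 : volume N = 0)
    (hu : Measurable u) (hlt : ∀ x, u x < ∞) {g : ℝ → ℝ≥0∞} (hg : Measurable g) {b : ℝ≥0}
    (hb : ∀ x, g x ≤ b) {f : ℝ → ℝ} {M : ℝ} (hf : ∀ᵐ x, 0 < x → f x = (g x).toReal - M)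
    (hfin1 : collision (extendedKernel K N) (fun p => g (p.1 + p.2.2) + g (p.1 - p.2.2)) u u ≠ ∞)
    (hfin2 : collision (extendedKernel K N) (fun p => 2 * g p.1) u u ≠ ∞) :
    weakForm K f (fun x => (u x).toReal) =
      (collision (extendedKernel K N) (fun p => g (p.1 + p.2.2) + g (p.1 - p.2.2)) u u).toReal -
        (collision (extendedKernel K N) (fun p => 2 * g p.1) u u).toReal := by
  have hk := measurable_extendedKernel hK hN
  set k := extendedKernel K N with hkdef
  have hgtop : ∀ x, g x ≠ ∞ := fun x => ne_top_of_le_ne_top ENNReal.coe_ne_top (hb x)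
  let A : ℝ × ℝ × ℝ → ℝ≥0∞ := fun p => (g (p.1 + p.2.2) + g (p.1 - p.2.2)) * k p * (u p.1 * u p.2.1)
  let B : ℝ × ℝ × ℝ → ℝ≥0∞ := fun p => (2 * g p.1) * k p * (u p.1 * u p.2.1)
  have hA : Measurable A := by fun_prop
  have hB : Measurable B := by fun_prop
  have hktop : ∀ p, k p < ∞ := fun p => by
    by_cases hp : p ∈ activeSet N
    · rw [hkdef, extendedKernel, indicator_of_mem hp]
      exact ENNReal.ofReal_lt_top
    · rw [hkdef, extendedKernel_of_notMem hp]
      exact ENNReal.zero_lt_top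
  have hAtop : ∀ p, A p < ∞ := fun p => by
    have := hktop p; have := hlt p.1; have := hlt p.2.1
    have := hgtop (p.1 + p.2.2); have := hgtop (p.1 - p.2.2)
    simp only [A]; finiteness
  have hBtop : ∀ p, B p < ∞ := fun p => by
    have := hktop p; have := hlt p.1; have := hlt p.2.1; have := hgtop p.1
    simp only [B]; finiteness
  have hIA : Integrable fun p => (A p).toReal :=
    integrable_toReal_of_lintegral_ne_top hA.aemeasurable hfin1
  have hIB : Integrable fun p => (B p).toReal :=
    integrable_toReal_of_lintegral_ne_top hB.aemeasurable hfin2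
  have hexch : MeasurableSet exchangeDomain := by
    have e1 : Measurable fun p : ℝ × ℝ × ℝ => p.2.2 := by fun_prop
    have e2 : Measurable fun p : ℝ × ℝ × ℝ => p.2.1 := by fun_prop
    exact (measurableSet_le measurable_const e1).inter
      ((measurableSet_le e1 measurable_fst).inter (measurableSet_le e1 e2))
  have hae : (exchangeDomain.indicator fun p =>
      discreteLaplacian p.2.2 f p.1 * kappa K (fun x => (u x).toReal) p.1 p.2.1 p.2.2)
      =ᵐ[volume] fun p => (A p).toReal - (B p).toReal := by
    have f0 : ∀ᵐ p : ℝ × ℝ × ℝ, 0 < p.1 + 0 → f (p.1 + 0) = (g (p.1 + 0)).toReal - M :=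
      ae_shift hf (s := fun _ : ℝ × ℝ => (0 : ℝ)) measurable_const
    have f1 : ∀ᵐ p : ℝ × ℝ × ℝ, 0 < p.1 + p.2.2 →
        f (p.1 + p.2.2) = (g (p.1 + p.2.2)).toReal - M :=
      ae_shift hf (s := fun q : ℝ × ℝ => q.2) measurable_snd
    have f2 : ∀ᵐ p : ℝ × ℝ × ℝ, 0 < p.1 + -p.2.2 →
        f (p.1 + -p.2.2) = (g (p.1 + -p.2.2)).toReal - M :=
      ae_shift hf (s := fun q : ℝ × ℝ => -q.2) (by fun_prop)
    filter_upwards [f0, f1, f2, ae_mem_activeSet hN0] with p e0 e1 e2 hact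
    by_cases hp : p ∈ exchangeDomain
    · have hpa := hact hp.1 hp.2.1 hp.2.2
      rw [indicator_of_mem hp]
      simp only [A, B]
      rw [collision_integrand_toReal hK (G := fun p => g (p.1 + p.2.2) + g (p.1 - p.2.2)) hpa,
        collision_integrand_toReal hK (G := fun p => 2 * g p.1) hpa, ← sub_mul]
      congr 1
      obtain ⟨hz, hx, -, -⟩ := hpa
      rw [add_zero] at e0
      rw [← sub_eq_add_neg] at e2
      rw [discreteLaplacian, e0 (hz.trans hx), e1 (by linarith), e2 (by linarith),
        ENNReal.toReal_add (hgtop _) (hgtop _), ENNReal.toReal_mul]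
      simp only [ENNReal.toReal_ofNat]
      ring
    · have hk0 : k p = 0 := extendedKernel_of_notMem fun h =>
        hp ⟨h.1.le, h.2.1.le, h.2.2.1.le⟩
      rw [indicator_of_notMem hp]
      simp [A, B, hk0]
  rw [weakForm, ← integral_indicator hexch, integral_congr_ae hae, integral_sub hIA hIB,
    integral_toReal hA.aemeasurable (Eventually.of_forall hAtop),
    integral_toReal hB.aemeasurable (Eventually.of_forall hBtop)]
  rfl

theorem lintegral_flux_le (hK : GlobalAssumption K) (hN0 : volume N = 0) :
    ∫⁻ p in fluxDomain, ENNReal.ofReal (kappa K (fun x => (u x).toReal) p.1 p.2.1 p.2.2) ≤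
      collision (extendedKernel K N) (fun _ => 1) u u := by
  have hflux : MeasurableSet fluxDomain := by
    have e1 : Measurable fun p : ℝ × ℝ × ℝ => p.2.2 := by fun_prop
    have e2 : Measurable fun p : ℝ × ℝ × ℝ => p.2.1 := by fun_prop
    exact (measurableSet_le measurable_const e1).inter
      ((measurableSet_le e1 measurable_fst).inter (measurableSet_le measurable_const e2))
  rw [← lintegral_indicator hflux, collision]
  refine lintegral_mono_ae ?_
  filter_upwards [ae_mem_activeSet hN0] with p hact
  by_cases hp : p ∈ fluxDomain
  swap
  · rw [indicator_of_notMem hp]; exact zero_le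
  rw [indicator_of_mem hp]
  obtain ⟨hz, hx, hy⟩ := hp
  rcases lt_or_ge p.2.1 p.2.2 with hyz | hyz
  · have : K p.1 p.2.1 p.2.2 = 0 := by
      rw [hK.symm p.1 p.2.1 p.2.2 (hz.trans hx) hy hz]
      exact hK.eq_zero _ _ _ hy (hz.trans hx) hz hyz
    rw [kappa, this]; simp
  · have hpa := hact hz hx hyz
    have h1 := collision_integrand_toReal hK (G := fun _ => 1) (u := u) hpa
    simp only [ENNReal.toReal_one, one_mul] at h1
    rw [← h1, one_mul]
    exact ENNReal.ofReal_toReal_le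

end Transfer

theorem near_add_far_le {α lam x : ℝ} (hα : 0 ≤ α) (hl : 0 ≤ lam) (hx : 0 < x) :
    nearWeight α x + farWeight lam x ≤ ENNReal.ofReal (2 * (x ^ (-α) + x ^ lam)) := by
  have p1 : 0 < x ^ (-α) := Real.rpow_pos_of_pos hx _
  have p2 : 0 < x ^ lam := Real.rpow_pos_of_pos hx _
  rcases le_total x 1 with h | h
  · have e1 : 1 ≤ x ^ (-α) := Real.one_le_rpow_of_pos_of_le_one_of_nonpos hx h (by linarith)
    rw [nearWeight, farWeight, hat, check, min_eq_right h, max_eq_left h, Real.one_rpow,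
      ← ENNReal.ofReal_add p1.le zero_le_one]
    exact ENNReal.ofReal_le_ofReal (by linarith)
  · have e1 : 1 ≤ x ^ lam := Real.one_le_rpow h hl
    rw [nearWeight, farWeight, hat, check, min_eq_left h, max_eq_right h, Real.one_rpow,
      ← ENNReal.ofReal_add zero_le_one p2.le]
    exact ENNReal.ofReal_le_ofReal (by linarith)

theorem le_near_add_far {α lam x : ℝ} (hα : 0 ≤ α) (hl : 0 ≤ lam) (hx : 0 < x) :
    ENNReal.ofReal (x ^ (-α) + x ^ lam) ≤ nearWeight α x + farWeight lam x := by
  have p1 : 0 < x ^ (-α) := Real.rpow_pos_of_pos hx _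
  have p2 : 0 < x ^ lam := Real.rpow_pos_of_pos hx _
  rw [ENNReal.ofReal_add p1.le p2.le]
  refine add_le_add (ENNReal.ofReal_le_ofReal ?_) (rpow_le_farWeight hl hx.le)
  exact Real.rpow_le_rpow_of_nonpos (hat_pos hx) (min_le_right _ _) (by linarith)

/-- The initial datum as a function with values in `[0, ∞]`. -/
theorem MemYPos.exists_initialDatum {α lam : ℝ} {c₀ : ℝ → ℝ} (hα : 0 ≤ α) (hl : 0 ≤ lam)
    (h : MemYPos α lam c₀) : ∃ u₀ : ℝ → ℝ≥0∞, InitialDatum α lam u₀ ∧ (∀ x, u₀ x < ∞) ∧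
      ∀ᵐ x, 0 < x → c₀ x = (u₀ x).toReal := by
  obtain ⟨⟨hint, hw⟩, hpos⟩ := h
  have hm := hint.aestronglyMeasurable
  have hmk := hm.stronglyMeasurable_mk.measurable
  let u₀ : ℝ → ℝ≥0∞ := (Ioi 0).indicator fun x => ENNReal.ofReal (hm.mk c₀ x)
  have hmeas : Measurable u₀ := hmk.ennreal_ofReal.indicator measurableSet_Ioi
  have hae : ∀ᵐ x, 0 < x → u₀ x = ENNReal.ofReal (c₀ x) := by
    filter_upwards [(ae_restrict_iff' measurableSet_Ioi).1 hm.ae_eq_mk] with x hx hx0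
    simp only [u₀]
    rw [indicator_of_mem (show x ∈ Ioi (0 : ℝ) from hx0), hx hx0]
  have hsum : ∫⁻ x, (nearWeight α x + farWeight lam x) * u₀ x ≠ ∞ := by
    have hfin := (hw.const_mul 2).lintegral_lt_top
    refine ne_top_of_le_ne_top hfin.ne ?_
    rw [← lintegral_indicator measurableSet_Ioi]
    refine lintegral_mono_ae ?_
    filter_upwards [hae] with x hx
    by_cases hx0 : x ∈ Ioi (0 : ℝ)
    · have hx0' : 0 < x := hx0
      have p1 : 0 < x ^ (-α) := Real.rpow_pos_of_pos hx0' _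
      have p2 : 0 < x ^ lam := Real.rpow_pos_of_pos hx0' _
      rw [indicator_of_mem hx0, hx hx0]
      calc (nearWeight α x + farWeight lam x) * ENNReal.ofReal (c₀ x)
          ≤ ENNReal.ofReal (2 * (x ^ (-α) + x ^ lam)) * ENNReal.ofReal |c₀ x| := by
            gcongr
            · exact near_add_far_le hα hl hx0
            · exact le_abs_self _
        _ = _ := by
            rw [← ENNReal.ofReal_mul (by positivity), mul_assoc]
    · simp only [u₀]
      rw [indicator_of_notMem hx0, mul_zero]; exact zero_le
  refine ⟨u₀, ⟨hmeas, fun x hx => indicator_of_notMem (not_lt.2 hx) _, ?_, ?_⟩, fun x => ?_, ?_⟩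
  · exact ne_top_of_le_ne_top hsum (lintegral_mono fun x => mul_le_mul_left le_add_self _)
  · exact ne_top_of_le_ne_top hsum (lintegral_mono fun x => mul_le_mul_left le_self_add _)
  · simp only [u₀]
    rw [indicator_apply]
    split_ifs
    · exact ENNReal.ofReal_lt_top
    · exact ENNReal.zero_lt_top
  · filter_upwards [hae, (ae_restrict_iff' measurableSet_Ioi).1 hpos] with x h1 h2 hx
    rw [h1 hx, ENNReal.toReal_ofReal (h2 hx)]

/-- Membership in the weighted space, with a bound on the norm. -/
theorem memYPos_of_lintegral {α lam : ℝ} {u : ℝ → ℝ≥0∞} (hα : 0 ≤ α) (hl : 0 ≤ lam)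
    (hu : Measurable u) (hlt : ∀ x, u x < ∞) (hfin : ∫⁻ x, u x ≠ ∞) {B : ℝ≥0}
    (hB : ∫⁻ x, (nearWeight α x + farWeight lam x) * u x ≤ B) :
    MemYPos α lam (fun x => (u x).toReal) ∧ normY α lam (fun x => (u x).toReal) ≤ B := by
  have hle : ∫⁻ x in Ioi (0 : ℝ), ENNReal.ofReal ((x ^ (-α) + x ^ lam) * |(u x).toReal|) ≤ B := by
    refine le_trans ?_ hB
    rw [← lintegral_indicator measurableSet_Ioi]
    refine lintegral_mono fun x => ?_
    by_cases hx : x ∈ Ioi (0 : ℝ)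
    · have hx' : 0 < x := hx
      have p1 : 0 < x ^ (-α) := Real.rpow_pos_of_pos hx' _
      have p2 : 0 < x ^ lam := Real.rpow_pos_of_pos hx' _
      rw [indicator_of_mem hx, ENNReal.ofReal_mul (by positivity),
        abs_of_nonneg ENNReal.toReal_nonneg, ENNReal.ofReal_toReal (hlt x).ne]
      exact mul_le_mul_left (le_near_add_far hα hl hx) _
    · rw [indicator_of_notMem hx]; exact zero_le
  have hmeas : AEStronglyMeasurable (fun x => (x ^ (-α) + x ^ lam) * |(u x).toReal|)
      (volume.restrict (Ioi (0 : ℝ))) := by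
    have : Measurable fun x => (x ^ (-α) + x ^ lam) * |(u x).toReal| := by fun_prop
    exact this.aestronglyMeasurable
  have hnn : 0 ≤ᵐ[volume.restrict (Ioi (0 : ℝ))]
      fun x => (x ^ (-α) + x ^ lam) * |(u x).toReal| := by
    filter_upwards [ae_restrict_mem measurableSet_Ioi] with x hx
    have hx' : (0 : ℝ) < x := hx
    have p1 : 0 < x ^ (-α) := Real.rpow_pos_of_pos hx' _
    have p2 : 0 < x ^ lam := Real.rpow_pos_of_pos hx' _
    simp only [Pi.zero_apply]
    positivity
  refine ⟨⟨⟨(integrable_toReal_of_lintegral_ne_top hu.aemeasurable hfin).integrableOn, ?_⟩,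
    Eventually.of_forall fun x => ENNReal.toReal_nonneg⟩, ?_⟩
  · refine ⟨hmeas, ?_⟩
    rw [hasFiniteIntegral_iff_ofReal hnn]
    exact hle.trans_lt ENNReal.coe_lt_top
  · rw [normY, integral_eq_lintegral_of_nonneg_ae hnn hmeas]
    exact ENNReal.toReal_le_coe_of_le_coe hle

end CGEDG

open CGEDG in
theorem theorem1 (K : ℝ → ℝ → ℝ → ℝ) (φ : ℝ → ℝ) (α μ ν : ℝ)
    (hK : CGEDG.GlobalAssumption K) (hE : CGEDG.ExistenceAssumption K φ α μ ν)
    (c₀ : ℝ → ℝ) (hc₀ : CGEDG.MemYPos α (max μ ν) c₀) :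
    ∃ c : ℝ → ℝ → ℝ,
      CGEDG.IsGlobalWeakSolution K α (max μ ν) c₀ c ∧
      (∀ t : ℝ, 0 ≤ t → CGEDG.MemYPos α (max μ ν) (c t)) ∧
      (∀ t : ℝ, 0 ≤ t →
        ∫ x in Set.Ioi (0 : ℝ), c t x = ∫ x in Set.Ioi (0 : ℝ), c₀ x) ∧
      (∀ t : ℝ, 0 ≤ t →
        ∫ x in Set.Ioi (0 : ℝ), x * c t x = ∫ x in Set.Ioi (0 : ℝ), x * c₀ x) := by
  have hα := hE.alpha_nonneg
  have hl : 0 ≤ max μ ν := by linarith [hE.one_lt]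
  -- A measurable representative of `φ`, and a null set outside of which it agrees with `φ`.
  have hφm := hE.phi_mem.1.1.aestronglyMeasurable
  have hφae := (ae_restrict_iff' measurableSet_Ioi).1 hφm.ae_eq_mk
  set N := toMeasurable volume {z | ¬(z ∈ Ioi (0 : ℝ) → φ z = hφm.mk φ z)} with hN
  have hNm : MeasurableSet N := measurableSet_toMeasurable _ _
  have hN0 : volume N = 0 := by rw [hN, measure_toMeasurable]; exact hφae
  obtain ⟨C, hk⟩ := kernelBounds_extendedKernel hK hE hφm.stronglyMeasurable_mk.measurable hNm hN0
    fun z hz hzN => by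
      by_contra hne
      exact hzN (subset_toMeasurable _ _ fun h => hne (h hz))
  set θ := transferWeight (hφm.mk φ) α
  set k := extendedKernel K N with hkdef
  obtain ⟨u₀, hu, hu₀lt, hu₀⟩ := hc₀.exists_initialDatum hα hl
  have hU : ((hyperfilter ℕ : Ultrafilter ℕ) : Filter ℕ) ≤ atTop := Nat.hyperfilter_le_atTop
  have hex : ∀ t : ℝ, ∃ d, 0 ≤ t → IsLimit k θ u₀ (hyperfilter ℕ) t d := fun t => by
    by_cases ht : 0 ≤ t
    · obtain ⟨d, hd⟩ := exists_isLimit hk hu (hyperfilter ℕ) ht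
      exact ⟨d, fun _ => hd⟩
    · exact ⟨0, fun h => absurd h ht⟩
  choose d hd using hex
  have hm0 : ∫⁻ x, u₀ x ≠ ∞ := hu.mass_ne_top hl
  have hmass : ∀ t, 0 ≤ t → ∫⁻ x, d t x = ∫⁻ x, u₀ x := fun t ht => (hd t ht).lintegral_eq hk hu
  have hdfin : ∀ t, 0 ≤ t → ∫⁻ x, d t x ≠ ∞ := fun t ht => by rw [hmass t ht]; exact hm0
  let c : ℝ → ℝ → ℝ := fun t x => (d t x).toReal
  have hmem : ∀ T : ℝ, ∃ B : ℝ≥0, ∀ t ∈ Icc 0 T,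
      MemYPos α (max μ ν) (c t) ∧ normY α (max μ ν) (c t) ≤ B := by
    intro T
    obtain ⟨B, hB⟩ := IsLimit.weight_bound hk hu T
    exact ⟨B, fun t ht => memYPos_of_lintegral hα hl (hd t ht.1).measurable (hd t ht.1).lt_top
      (hdfin t ht.1) (hB t ht _ _ (hd t ht.1))⟩
  -- Pairing with a test function.
  have hpair : ∀ f : ℝ → ℝ, ∀ (M : ℝ) (b : ℝ≥0) (g : ℝ → ℝ≥0∞), Measurable g → (∀ x, g x ≤ b) →
      (∀ᵐ x, 0 < x → f x = (g x).toReal - M) →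
      ∀ u : ℝ → ℝ≥0∞, Measurable u → (∀ x, u x < ∞) → (∀ x ≤ 0, u x = 0) →
      ∫⁻ x, u x = ∫⁻ x, u₀ x → ∀ c' : ℝ → ℝ, (∀ᵐ x, 0 < x → c' x = (u x).toReal) →
      IntegrableOn (fun x => f x * c' x) (Ioi 0) ∧
      ∫ x in Ioi (0 : ℝ), f x * c' x = (∫⁻ x, g x * u x).toReal - M * (∫⁻ x, u₀ x).toReal := by
    intro f M b g hg hb hfg u hum hult hu0 hum0 c' hc'
    have hbfin : ∫⁻ x, g x * u x ≠ ∞ := by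
      refine ne_top_of_le_ne_top (b := b * ∫⁻ x, u₀ x) (by finiteness) ?_
      rw [← hum0, ← lintegral_const_mul' _ _ ENNReal.coe_ne_top]
      exact lintegral_mono fun x => mul_le_mul_left (hb x) _
    have := setIntegral_mul_eq hum hult hu0 (by rw [hum0]; exact hm0) hg
      (fun x => (hb x).trans_lt ENNReal.coe_lt_top) hbfin hc' hfg
    rwa [hum0] at this
  -- The weak formulation on `[0, T]`.
  have hweak : ∀ f : ℝ → ℝ, MemLinf f → ∀ T : ℝ, 0 ≤ T →
      ContinuousOn (fun s => weakForm K f (c s)) (Icc 0 T) ∧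
      ∀ t ∈ Icc 0 T, IntegrableOn (fun x => f x * c t x) (Ioi 0) ∧
        IntegrableOn (fun x => f x * c₀ x) (Ioi 0) ∧
        (∫ x in Ioi (0 : ℝ), f x * c t x) = (∫ x in Ioi (0 : ℝ), f x * c₀ x) +
          ∫ s in (0 : ℝ)..t, weakForm K f (c s) := by
    intro f hf T hT
    obtain ⟨M, b, g, hg, hb, hfg⟩ := hf.exists_shift
    have hb1 : ∀ p : ℝ × ℝ × ℝ, 2 * g p.1 ≤ (2 * b : ℝ≥0) := fun p => by
      push_cast; gcongr; exact hb _
    have hb2 : ∀ p : ℝ × ℝ × ℝ, g (p.1 + p.2.2) + g (p.1 - p.2.2) ≤ (2 * b : ℝ≥0) := fun p => by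
      push_cast; rw [two_mul]; exact add_le_add (hb _) (hb _)
    obtain ⟨B, hB⟩ := IsLimit.collision_bound hk hu T (2 * b)
    have hcont1 := (IsLimit.tendsto_integral_collision hk hu hU hd
      (G := fun p => 2 * g p.1) (by fun_prop) hb1 hT).1
    have hcont2 := (IsLimit.tendsto_integral_collision hk hu hU hd
      (G := fun p => g (p.1 + p.2.2) + g (p.1 - p.2.2)) (by fun_prop) hb2 hT).1
    have heq : ∀ s ∈ Icc 0 T, weakForm K f (c s) =
        (collision k (fun p => g (p.1 + p.2.2) + g (p.1 - p.2.2)) (d s) (d s)).toReal -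
        (collision k (fun p => 2 * g p.1) (d s) (d s)).toReal := fun s hs =>
      weakForm_eq hK hNm hN0 (hd s hs.1).measurable (hd s hs.1).lt_top hg hb hfg
        (ne_top_of_le_ne_top ENNReal.coe_ne_top (hB _ hb2 s hs _ _ (hd s hs.1)))
        (ne_top_of_le_ne_top ENNReal.coe_ne_top (hB _ hb1 s hs _ _ (hd s hs.1)))
    refine ⟨(hcont2.sub hcont1).congr heq, fun t ht => ?_⟩
    have hdt := hd t ht.1
    obtain ⟨i1, e1⟩ := hpair f M b g hg hb hfg (d t) hdt.measurable hdt.lt_top hdt.eq_zero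
      (hmass t ht.1) (c t) (Eventually.of_forall fun x _ => rfl)
    obtain ⟨i2, e2⟩ := hpair f M b g hg hb hfg u₀ hu.measurable hu₀lt hu.eq_zero rfl c₀ hu₀
    refine ⟨i1, i2, ?_⟩
    have hsub : uIcc 0 t ⊆ Icc 0 T := by
      rw [uIcc_of_le ht.1]; exact Icc_subset_Icc_right ht.2
    have hw := IsLimit.weak_form hk hu hU hd hg hb ht.1
    rw [intervalIntegral.integral_congr fun s hs => heq s (hsub hs),
      intervalIntegral.integral_sub (hcont2.mono hsub).intervalIntegrable
        (hcont1.mono hsub).intervalIntegrable, e1, e2]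
    linarith
  refine ⟨c, fun T hT => ?_, fun t ht => ?_, fun t ht => ?_, fun t ht => ?_⟩
  · obtain ⟨B, hB⟩ := hmem T
    have hIco : ∀ t ∈ Ico 0 T, t ∈ Icc 0 T := fun t ht => Ico_subset_Icc_self ht
    refine ⟨fun t ht => (hB t (hIco t ht)).1, fun f hf => ?_,
      ⟨B, fun t ht => (hB t (hIco t ht)).2⟩, fun t ht => ?_, fun t ht f hf => ?_⟩
    · obtain ⟨hcont, hid⟩ := hweak f hf T hT.le
      have hprim : ContinuousOn (fun t => ∫ s in (0 : ℝ)..t, weakForm K f (c s)) (Icc 0 T) := by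
        have := intervalIntegral.continuousOn_primitive_interval
          (f := fun s => weakForm K f (c s)) (μ := volume) (a := 0) (b := T)
          (by rw [uIcc_of_le hT.le]; exact hcont.integrableOn_Icc)
        rwa [uIcc_of_le hT.le] at this
      refine ((continuousOn_const (c := (2 : ℝ))).mul
        ((continuousOn_const (c := ∫ x in Ioi (0 : ℝ), f x * c₀ x)).add
          (hprim.mono Ico_subset_Icc_self))).congr fun t ht => ?_
      simp only [neg_zero, Real.rpow_zero]
      change _ = 2 * ((∫ x in Ioi (0 : ℝ), f x * c₀ x) + ∫ s in (0 : ℝ)..t, weakForm K f (c s))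
      rw [← (hid t (hIco t ht)).2.2, ← integral_const_mul]
      exact integral_congr_ae (Eventually.of_forall fun x => by simp only []; ring)
    · obtain ⟨B', hB'⟩ := IsLimit.collision_bound hk hu T 1
      calc ∫⁻ s in Ioc 0 t, ∫⁻ p in fluxDomain, ENNReal.ofReal (kappa K (c s) p.1 p.2.1 p.2.2)
          ≤ ∫⁻ _ in Ioc 0 t, B' := by
            refine setLIntegral_mono measurable_const fun s hs => ?_
            have hsd := hd s hs.1.le
            exact (lintegral_flux_le hK hN0).trans
              (hB' _ (fun _ => by simp) s ⟨hs.1.le, hs.2.trans ht.2.le⟩ _ _ hsd)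
        _ < ∞ := by
            rw [setLIntegral_const]
            exact ENNReal.mul_lt_top ENNReal.coe_lt_top (by simp)
    · obtain ⟨hcont, hid⟩ := hweak f hf T hT.le
      obtain ⟨i1, i2, e⟩ := hid t (hIco t ht)
      refine ⟨(hcont.mono ?_).intervalIntegrable, ?_⟩
      · rw [uIcc_of_le ht.1]; exact Icc_subset_Icc_right ht.2.le
      · simp_rw [mul_sub]
        rw [integral_sub i1 i2, e]
        ring
  · obtain ⟨B, hB⟩ := hmem t
    exact (hB t ⟨ht, le_rfl⟩).1
  · have h1 := fun u hum hult hu0 hmass c' hc' => (hpair (fun _ => 1) 0 1 (fun _ => 1)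
      measurable_const (by simp) (by simp) u hum hult hu0 hmass c' hc').2
    have e1 := h1 (d t) (hd t ht).measurable (hd t ht).lt_top (hd t ht).eq_zero (hmass t ht) (c t)
      (Eventually.of_forall fun x _ => rfl)
    have e2 := h1 u₀ hu.measurable hu₀lt hu.eq_zero rfl c₀ hu₀
    simp only [one_mul, hmass t ht] at e1 e2
    rw [e1, e2]
  · have hfm := hu.first_moment_ne_top hE.one_lt.le
    have hid : ∀ᵐ x : ℝ, 0 < x → x = (ENNReal.ofReal x).toReal - 0 :=
      Eventually.of_forall fun x hx => by rw [ENNReal.toReal_ofReal hx.le, sub_zero]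
    have hdt := hd t ht
    have hfmd := hdt.first_moment hk hu ht
    have e1 := (setIntegral_mul_eq hdt.measurable hdt.lt_top hdt.eq_zero (hdfin t ht)
      ENNReal.measurable_ofReal (fun _ => ENNReal.ofReal_lt_top) (by rw [hfmd]; exact hfm)
      (c := c t) (Eventually.of_forall fun x _ => rfl) hid).2
    have e2 := (setIntegral_mul_eq hu.measurable hu₀lt hu.eq_zero hm0
      ENNReal.measurable_ofReal (fun _ => ENNReal.ofReal_lt_top) hfm hu₀ hid).2
    rw [e1, e2, hfmd, zero_mul, zero_mul]
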